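/- **Theorem (non-strict relative monadicity).** Let $\mathbb X$ be a virtual equipment, that is, a virtual double category (objects; tight-cells $f\colon A\to B$, forming a category; loose-cells $p\colon X\nrightarrow Y$; 2-cells from chains of loose-cells to loose-cells) in which every object $A$ has a loose-identity $A(1,1)$ and every loose-cell $p\colon X\nrightarrow Y$ has a restriction $p(f,g)\colon W\nrightarrow Z$ along tight-cells $g\colon W\to X$, $f\colon Z\to Y$. Write $A(f,g)$ for the restriction of $A(1,1)$. A 2-cell $f\Rightarrow g$ between tight-cells $A\to B$ is a 2-cell $()\Rightarrow B(f,g)$, and a tight-cell is an *equivalence* if it has an inverse up to invertible 2-cells. We write $f;g$ for the composite of $f$ followed by $g$. *Colimits.* For $p\colon Y\nrightarrow Z$ and $f\colon Z\to W$, a $p$-cocone $(c\colon Y\to W,\ \lambda\colon p\Rightarrow W(f,c))$ is the *$p$-weighted colimit* of $f$ if pasting with $\lambda$ gives, for all chains $q_1,\dots,q_n$, a bijection between 2-cells $q_1,\dots,q_n\Rightarrow W(c,1)$ and 2-cells $p,q_1,\dots,q_n\Rightarrow W(f,1)$. The *left extension* of $f\colon D\to E$ along $c\colon D\to D'$ is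 the $D'(c,1)$-weighted colimit of $f$; an *$r$-extension* is a left extension of $r$ along some tight-cell. A tight-cell $j\colon A\to E$ is *dense* if the identity exhibits $1_E$ as the left extension of $j$ along $j$. For $j\colon A\to E$, a colimit $(c,\lambda)$ of $f\colon Z\to E$ with weight $p$ is *$j$-absolute* if the left-composite of $E(j,f)$ and $p$ exists (a loose-cell with a 2-cell from $E(j,f),p$ through which every 2-cell out of a chain $E(j,f),p,s_1,\dots,s_m$ factors uniquely), and the 2-cell from it to $E(j,c)$ induced by $\lambda$ is invertible. Suppose that the $p$-weighted colimit of $f;g$ exists. A tight-cell $g\colon W\to X$ *non-strictly creates* it if the $p$-weighted colimit of $f\colon Z\to W$ exists and a $p$-cocone $(w,\lambda')$ for $f$ is a colimit of $f$ if and only if $((w;g),(\lambda';g))$ is a colimit of $f;g$. An $r$-extension, being a colimit of $r=1_D;r$, is created by $r\colon D\to E$ in this sense with $f=1_D$ and $g=r$. *Relative monads.* Let $j\colon A\to E$. A *left $j$-adjoint* of $r\colon D\to E$ is a tight-cell $\ell\colon A\to D$ with an isomorphism $D(\ell,1)\cong E(j,r)$. A *$j$-monad* $T$ is a tight-cell $t\colon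 A\to E$ with 2-cells $\dagger\colon E(j,t)\Rightarrow E(t,t)$ and $\eta\colon j\Rightarrow t$ satisfying the unit and associativity laws. A *$T$-algebra* is a tight-cell $e\colon D\to E$ with a 2-cell $\rtimes\colon E(j,e)\Rightarrow E(t,e)$ compatible with $\dagger$ and $\eta$; a *$(p_1,\dots,p_n)$-graded morphism* from $(e,\rtimes)$ to $(e',\rtimes')$ is a 2-cell $p_1,\dots,p_n\Rightarrow E(e,e')$ compatible with $\rtimes,\rtimes'$. An *algebra object* is a $T$-algebra $(u_T\colon \mathbf{Alg}(T)\to E,\rtimes_T)$ such that every $T$-algebra is of the form $(c;u_T,\rtimes_T(1,c))$ for a unique tight-cell $c$, and every graded morphism from $(c;u_T,\rtimes_T(1,c))$ to $(c';u_T,\rtimes_T(1,c'))$ is of the form $\tau;u_T$ for a unique 2-cell $\tau\colon p_1,\dots,p_n\Rightarrow \mathbf{Alg}(T)(c,c')$. A left $j$-adjoint $\ell$ of $r$ induces a $j$-monad $T$ with carrier $\ell;r$ and a $T$-algebra structure on $r$; if $T$ has an algebra object, the *comparison tight-cell* $D\to\mathbf{Alg}(T)$ is the unique tight-cell corresponding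 to this algebra. The tight-cell $r$ is *non-strictly $j$-monadic* if it has a left $j$-adjoint, the induced $j$-monad $T$ has an algebra object, and the comparison tight-cell $D\to\mathbf{Alg}(T)$ is an equivalence. *Statement.* Let $j\colon A\to E$ be a dense tight-cell in $\mathbb X$. A tight-cell $r\colon D\to E$ is non-strictly $j$-monadic if and only if $r$ has a left $j$-adjoint, the induced $j$-monad has an algebra object, and $r$ non-strictly creates $j$-absolute $r$-extensions. -/

import Mathlib

open CategoryTheory

universe w x v u

namespace FormalCat

/-- Finite composable chains of loose-cells.  Here `L A B` stands for loose-cells `B ⇸ A` (target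
first, as in the notation `p(a, b)`), so that a chain reads from left to right as in the usual
pictures: `Chain L A₀ Aₙ` consists of `p₁ : A₁ ⇸ A₀, …, pₙ : Aₙ ⇸ Aₙ₋₁`. -/
inductive Chain {C : Type u} (L : C → C → Type w) : C → C → Type (max u w)
  | nil (A : C) : Chain L A A
  | cons {A B D : C} (p : L A B) (P : Chain L B D) : Chain L A D

namespace Chain

variable {C : Type u} {L : C → C → Type w}

/-- Concatenation of chains. -/
def append : {A B D : C} → Chain L A B → Chain L B D → Chain L A D
  | _, _, _, nil _, Q => Q
  | _, _, _, cons p P, Q => cons p (append P Q)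

/-- The chain consisting of one loose-cell. -/
abbrev single {A B : C} (p : L A B) : Chain L A B := cons p (nil B)

@[simp] theorem nil_append {A B : C} (Q : Chain L A B) : (nil A).append Q = Q := rfl

@[simp] theorem cons_append {A B D F : C} (p : L A B) (P : Chain L B D) (Q : Chain L D F) :
    (cons p P).append Q = cons p (P.append Q) := rfl

@[simp] theorem append_nil {A B : C} (P : Chain L A B) : P.append (nil B) = P := by
  induction P with
  | nil => rfl
  | cons p P ih => simp [ih]

@[simp] theorem append_assoc {A B D F : C} (P : Chain L A B) (Q : Chain L B D) (R : Chain L D F) :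
    (P.append Q).append R = P.append (Q.append R) := by
  induction P with
  | nil => rfl
  | cons p P ih => simp [ih]

end Chain

/-- The cells of a virtual double category whose objects and tight-cells form the category `C`.
`Cell P f g q` is the set of 2-cells with top boundary the chain `P`, left boundary `f`,
right boundary `g`, and bottom boundary `q`. -/
class VDCData (C : Type u) [Category.{v} C] where
  /-- `Loose A B` is the type of loose-cells `B ⇸ A`. -/
  Loose : C → C → Type w
  /-- The 2-cells. -/
  Cell : {A B A' B' : C} → Chain Loose A B → (A ⟶ A') → (B ⟶ B') → Loose A' B' → Type x

open VDCData

variable {C : Type u} [Category.{v} C]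

section Multi

variable [VDCData.{w, x} C]

/-- Horizontally composable sequences of 2-cells: an element of `MCell f g Q` is a list of 2-cells
`φ₁, …, φₙ`, with leftmost boundary `f` and rightmost boundary `g`, adjacent 2-cells sharing a
tight-cell, whose bottom boundaries form the chain `Q`. -/
inductive MCell : {A B A' B' : C} → (A ⟶ A') → (B ⟶ B') → Chain (Loose (C := C)) A' B' →
    Type (max u v w x)
  | nil {A A' : C} (f : A ⟶ A') : MCell f f (Chain.nil A')
  | cons {A B D A' B' D' : C} {P : Chain (Loose (C := C)) A B} {f : A ⟶ A'} {g : B ⟶ B'}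
      {h : D ⟶ D'} {q : Loose A' B'} {Q : Chain (Loose (C := C)) B' D'}
      (φ : Cell P f g q) (M : MCell g h Q) : MCell f h (Chain.cons q Q)

namespace MCell

/-- The concatenation of the top boundaries. -/
def dom : {A B A' B' : C} → {f : A ⟶ A'} → {g : B ⟶ B'} → {Q : Chain (Loose (C := C)) A' B'} →
    MCell f g Q → Chain (Loose (C := C)) A B
  | _, _, _, _, _, _, _, nil (A := A) _ => Chain.nil A
  | _, _, _, _, _, _, _, cons (P := P) _ M => P.append M.dom

/-- Concatenation of sequences of 2-cells. -/
def append : {A B D A' B' D' : C} → {f : A ⟶ A'} → {g : B ⟶ B'} → {h : D ⟶ D'} →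
    {P : Chain (Loose (C := C)) A' B'} → {Q : Chain (Loose (C := C)) B' D'} →
    MCell f g P → MCell g h Q → MCell f h (P.append Q)
  | _, _, _, _, _, _, _, _, _, _, _, nil _, N => N
  | _, _, _, _, _, _, _, _, _, _, _, cons φ M, N => cons φ (append M N)

/-- The sequence consisting of one 2-cell. -/
abbrev single {A B A' B' : C} {P : Chain (Loose (C := C)) A B} {f : A ⟶ A'} {g : B ⟶ B'}
    {q : Loose A' B'} (φ : Cell P f g q) : MCell f g (Chain.single q) := cons φ (nil g)

/-- The sequence consisting of two 2-cells. -/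
abbrev pair {A B D A' B' D' : C} {P : Chain (Loose (C := C)) A B} {Q : Chain (Loose (C := C)) B D}
    {f : A ⟶ A'} {g : B ⟶ B'} {h : D ⟶ D'} {p : Loose A' B'} {q : Loose B' D'}
    (φ : Cell P f g p) (ψ : Cell Q g h q) : MCell f h (Chain.cons p (Chain.single q)) :=
  cons φ (single ψ)

@[simp] theorem dom_nil {A A' : C} (f : A ⟶ A') : (nil f).dom = Chain.nil A := rfl

@[simp] theorem dom_cons {A B D A' B' D' : C} {P : Chain (Loose (C := C)) A B} {f : A ⟶ A'}
    {g : B ⟶ B'} {h : D ⟶ D'} {q : Loose A' B'} {Q : Chain (Loose (C := C)) B' D'}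
    (φ : Cell P f g q) (M : MCell g h Q) : (cons φ M).dom = P.append M.dom := rfl

@[simp] theorem dom_append {A B D A' B' D' : C} {f : A ⟶ A'} {g : B ⟶ B'} {h : D ⟶ D'}
    {P : Chain (Loose (C := C)) A' B'} {Q : Chain (Loose (C := C)) B' D'}
    (M : MCell f g P) (N : MCell g h Q) : (M.append N).dom = M.dom.append N.dom := by
  induction M with
  | nil => rfl
  | cons φ M ih => simp [append, ih]

end MCell

end Multi

/-- Identity 2-cells and composition of 2-cells. -/
class VDCOps (C : Type u) [Category.{v} C] extends VDCData.{w, x} C where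
  /-- The identity 2-cell of a loose-cell. -/
  cid {A B : C} (p : Loose A B) : Cell (Chain.single p) (𝟙 A) (𝟙 B) p
  /-- The composite of a sequence of 2-cells followed by a 2-cell. -/
  comp {A B A' B' A'' B'' : C} {f : A ⟶ A'} {g : B ⟶ B'} {Q : Chain Loose A' B'}
    {f' : A' ⟶ A''} {g' : B' ⟶ B''} {r : Loose A'' B''}
    (M : MCell f g Q) (ψ : Cell Q f' g' r) : Cell M.dom (f ≫ f') (g ≫ g') r

open VDCOps

section Trees

variable [VDCOps.{w, x} C]

/-- The sequence of identity 2-cells on a chain. -/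
def MCell.idm : {A B : C} → (P : Chain (Loose (C := C)) A B) → MCell (𝟙 A) (𝟙 B) P
  | _, _, .nil A => .nil (𝟙 A)
  | _, _, .cons p P => .cons (cid p) (MCell.idm P)

/-- Two-storey arrangements of 2-cells: a sequence of 2-cells `ν₁, …, νₙ`, with a sequence `Mᵢ` of
2-cells placed on top of each `νᵢ`. -/
inductive MCell₂ : {A B A' B' A'' B'' : C} → (A ⟶ A') → (B ⟶ B') → (A' ⟶ A'') → (B' ⟶ B'') →
    Chain (Loose (C := C)) A'' B'' → Type (max u v w x)
  | nil {A A' A'' : C} (f : A ⟶ A') (f' : A' ⟶ A'') : MCell₂ f f f' f' (Chain.nil A'')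
  | cons {A B D A' B' D' A'' B'' D'' : C} {f : A ⟶ A'} {g : B ⟶ B'} {h : D ⟶ D'}
      {f' : A' ⟶ A''} {g' : B' ⟶ B''} {h' : D' ⟶ D''} {P : Chain (Loose (C := C)) A' B'}
      {q : Loose A'' B''} {Q : Chain (Loose (C := C)) B'' D''}
      (M : MCell f g P) (ν : Cell P f' g' q) (T : MCell₂ g h g' h' Q) :
      MCell₂ f h f' h' (Chain.cons q Q)

namespace MCell₂

/-- The lower storey. -/
def lower : {A B A' B' A'' B'' : C} → {f : A ⟶ A'} → {g : B ⟶ B'} → {f' : A' ⟶ A''} →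
    {g' : B' ⟶ B''} → {Q : Chain (Loose (C := C)) A'' B''} → MCell₂ f g f' g' Q → MCell f' g' Q
  | _, _, _, _, _, _, _, _, _, _, _, nil _ f' => .nil f'
  | _, _, _, _, _, _, _, _, _, _, _, cons _ ν T => .cons ν T.lower

/-- The upper storey. -/
def upper : {A B A' B' A'' B'' : C} → {f : A ⟶ A'} → {g : B ⟶ B'} → {f' : A' ⟶ A''} →
    {g' : B' ⟶ B''} → {Q : Chain (Loose (C := C)) A'' B''} → (T : MCell₂ f g f' g' Q) →
    MCell f g T.lower.dom
  | _, _, _, _, _, _, _, _, _, _, _, nil f _ => .nil f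
  | _, _, _, _, _, _, _, _, _, _, _, cons M _ T => M.append T.upper

/-- The sequence of the composites of the columns. -/
def columns : {A B A' B' A'' B'' : C} → {f : A ⟶ A'} → {g : B ⟶ B'} → {f' : A' ⟶ A''} →
    {g' : B' ⟶ B''} → {Q : Chain (Loose (C := C)) A'' B''} → MCell₂ f g f' g' Q →
    MCell (f ≫ f') (g ≫ g') Q
  | _, _, _, _, _, _, _, _, _, _, _, nil f f' => .nil (f ≫ f')
  | _, _, _, _, _, _, _, _, _, _, _, cons M ν T => .cons (comp M ν) T.columns

end MCell₂

end Trees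

/-- A virtual double category with underlying category of objects and tight-cells `C`.  In each
law the two sides have types that are equal only up to the (provable) associativity and unit laws
for concatenation of chains and composition of tight-cells, whence the use of `HEq`. -/
class VirtualDoubleCategory (C : Type u) [Category.{v} C] extends VDCOps.{w, x} C where
  comp_cid {A B A' B' : C} {P : Chain Loose A B} {f : A ⟶ A'} {g : B ⟶ B'} {q : Loose A' B'}
    (φ : Cell P f g q) : HEq (comp (MCell.single φ) (cid q)) φ
  idm_comp {A B A' B' : C} {P : Chain Loose A B} {f : A ⟶ A'} {g : B ⟶ B'} {q : Loose A' B'}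
    (φ : Cell P f g q) : HEq (comp (MCell.idm P) φ) φ
  comp_assoc {A B A' B' A'' B'' A₃ B₃ : C} {f : A ⟶ A'} {g : B ⟶ B'} {f' : A' ⟶ A''}
    {g' : B' ⟶ B''} {f'' : A'' ⟶ A₃} {g'' : B'' ⟶ B₃} {Q : Chain Loose A'' B''}
    {r : Loose A₃ B₃} (T : MCell₂ f g f' g' Q) (χ : Cell Q f'' g'' r) :
    HEq (comp T.columns χ) (comp T.upper (comp T.lower χ))

open VirtualDoubleCategory

section Cartesian

variable [VDCOps.{w, x} C]

/-- A 2-cell `φ : p ⇒ q` with tight boundaries `f, g` is cartesian if every 2-cell with bottom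
boundary `q` and tight boundaries `h ≫ f`, `k ≫ g` factors uniquely through `φ`. -/
def IsCartesian {A B A' B' : C} {p : Loose A B} {f : A ⟶ A'} {g : B ⟶ B'} {q : Loose A' B'}
    (φ : Cell (Chain.single p) f g q) : Prop :=
  ∀ {D F : C} (P : Chain (Loose (C := C)) D F) (h : D ⟶ A) (k : F ⟶ B)
    (ψ : Cell (P.append (Chain.nil F)) (h ≫ f) (k ≫ g) q),
    ∃! χ : Cell P h k p, comp (MCell.single χ) φ = ψ

/-- A 2-cell `φ : p₁, …, pₙ ⇒ q` with identity tight boundaries is opcartesian if every 2-cell with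
top boundary `R, p₁, …, pₙ, S` factors uniquely through `R, φ, S`. -/
def IsOpcartesian {A B : C} {P : Chain (Loose (C := C)) A B} {q : Loose A B}
    (φ : Cell P (𝟙 A) (𝟙 B) q) : Prop :=
  ∀ {D F D' F' : C} (R : Chain (Loose (C := C)) D A) (S : Chain (Loose (C := C)) B F)
    (f : D ⟶ D') (g : F ⟶ F') (r : Loose D' F')
    (ψ : Cell ((MCell.idm R).append (MCell.cons φ (MCell.idm S))).dom (𝟙 D ≫ f) (𝟙 F ≫ g) r),
    ∃! χ : Cell (R.append (Chain.cons q S)) f g r,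
      comp ((MCell.idm R).append (MCell.cons φ (MCell.idm S))) χ = ψ

/-- A 2-cell `φ : p₁, …, pₙ ⇒ q` with identity tight boundaries is left-opcartesian, and exhibits
`q` as the left-composite of `p₁, …, pₙ`, if every 2-cell with top boundary `p₁, …, pₙ, S`
factors uniquely through `φ, S`. -/
def IsLeftOpcartesian {A B : C} {P : Chain (Loose (C := C)) A B} {q : Loose A B}
    (φ : Cell P (𝟙 A) (𝟙 B) q) : Prop :=
  ∀ {F D' F' : C} (S : Chain (Loose (C := C)) B F) (f : A ⟶ D') (g : F ⟶ F') (r : Loose D' F')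
    (ψ : Cell (MCell.cons φ (MCell.idm S)).dom (𝟙 A ≫ f) (𝟙 F ≫ g) r),
    ∃! χ : Cell (Chain.cons q S) f g r, comp (MCell.cons φ (MCell.idm S)) χ = ψ

end Cartesian

/-- A virtual equipment: a virtual double category with loose-identities and restrictions. -/
class VirtualEquipment (C : Type u) [Category.{v} C] extends VirtualDoubleCategory.{w, x} C where
  /-- The loose-identity `A(1, 1)`. -/
  unit (A : C) : Loose A A
  /-- The universal 2-cell `() ⇒ A(1, 1)`. -/
  unitCell (A : C) : Cell (Chain.nil A) (𝟙 A) (𝟙 A) (unit A)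
  unitCell_opcartesian (A : C) : IsOpcartesian (C := C) (unitCell A)
  /-- The restriction `p(f, g)`. -/
  restr {A B A' B' : C} (p : Loose A' B') (f : A ⟶ A') (g : B ⟶ B') : Loose A B
  /-- The universal 2-cell `p(f, g) ⇒ p`. -/
  restrCell {A B A' B' : C} (p : Loose A' B') (f : A ⟶ A') (g : B ⟶ B') :
    Cell (Chain.single (restr p f g)) f g p
  restrCell_cartesian {A B A' B' : C} (p : Loose A' B') (f : A ⟶ A') (g : B ⟶ B') :
    IsCartesian (C := C) (restrCell p f g)

open VirtualEquipment

section Flexible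

variable [VirtualDoubleCategory.{w, x} C]

/-- Composition of 2-cells, transported along given equalities of boundaries. -/
def compC {A B A' B' A'' B'' : C} {f : A ⟶ A'} {g : B ⟶ B'} {Q : Chain (Loose (C := C)) A' B'}
    {f' : A' ⟶ A''} {g' : B' ⟶ B''} {r : Loose A'' B''} (M : MCell f g Q) (ψ : Cell Q f' g' r)
    {P : Chain (Loose (C := C)) A B} {F : A ⟶ A''} {G : B ⟶ B''}
    (hP : M.dom = P) (hF : f ≫ f' = F) (hG : g ≫ g' = G) : Cell P F G r :=
  cast (by rw [hP, hF, hG]) (comp M ψ)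

theorem compC_heq {A B A' B' A'' B'' : C} {f : A ⟶ A'} {g : B ⟶ B'}
    {Q : Chain (Loose (C := C)) A' B'} {f' : A' ⟶ A''} {g' : B' ⟶ B''} {r : Loose A'' B''}
    (M : MCell f g Q) (ψ : Cell Q f' g' r) {P : Chain (Loose (C := C)) A B} {F : A ⟶ A''}
    {G : B ⟶ B''} (hP : M.dom = P) (hF : f ≫ f' = F) (hG : g ≫ g' = G) :
    HEq (compC M ψ hP hF hG) (comp M ψ) := cast_heq _ _

theorem comp_heq {A B A' B' A'' B'' : C} {f : A ⟶ A'} {g : B ⟶ B'}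
    {Q Q' : Chain (Loose (C := C)) A' B'} {f' f₁' : A' ⟶ A''} {g' g₁' : B' ⟶ B''}
    {r : Loose A'' B''} {M : MCell f g Q} {M' : MCell f g Q'} {ψ : Cell Q f' g' r}
    {ψ' : Cell Q' f₁' g₁' r} (hQ : Q = Q') (hM : HEq M M') (hf : f' = f₁') (hg : g' = g₁')
    (hψ : HEq ψ ψ') : HEq (comp M ψ) (comp M' ψ') := by
  subst hQ hf hg; cases hM; cases hψ; rfl

theorem MCell.append_nil {A B A' B' : C} {f : A ⟶ A'} {g : B ⟶ B'}
    {Q : Chain (Loose (C := C)) A' B'} (M : MCell f g Q) : HEq (M.append (MCell.nil g)) M := by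
  induction M with
  | nil => rfl
  | cons φ M ih =>
    have : ∀ {A B D A' B' D' : C} {P : Chain (Loose (C := C)) A B} {f : A ⟶ A'} {g : B ⟶ B'}
        {h : D ⟶ D'} {q : Loose A' B'} {Q Q' : Chain (Loose (C := C)) B' D'} (φ : Cell P f g q)
        (M : MCell g h Q) (M' : MCell g h Q'), Q = Q' → HEq M M' →
        HEq (MCell.cons φ M) (MCell.cons φ M') := by
      intros; rename_i h₁ h₂; subst h₁; cases h₂; rfl
    exact this _ _ _ (Chain.append_nil _) ih

/-- Associativity for one column. -/
theorem compC_assoc₁ {A B A' B' A'' B'' A₃ B₃ : C} {f : A ⟶ A'} {g : B ⟶ B'} {f' : A' ⟶ A''}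
    {g' : B' ⟶ B''} {f'' : A'' ⟶ A₃} {g'' : B'' ⟶ B₃} {P : Chain (Loose (C := C)) A' B'}
    {q : Loose A'' B''} {r : Loose A₃ B₃} (M : MCell f g P) (ν : Cell P f' g' q)
    (χ : Cell (Chain.single q) f'' g'' r) {X Y : Chain (Loose (C := C)) A B}
    {F : A ⟶ A''} {G : B ⟶ B''} {F₂ : A ⟶ A₃} {G₂ : B ⟶ B₃} {K : A' ⟶ A₃} {K' : B' ⟶ B₃}
    (hP : M.dom = X) (hF : f ≫ f' = F) (hG : g ≫ g' = G)
    (hY : (MCell.single (compC M ν hP hF hG)).dom = Y) (hF₂ : F ≫ f'' = F₂) (hG₂ : G ≫ g'' = G₂)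
    (h : (MCell.single ν).dom = P) (hK : f' ≫ f'' = K) (hK' : g' ≫ g'' = K')
    (h₁ : M.dom = Y) (h₂ : f ≫ K = F₂) (h₃ : g ≫ K' = G₂) :
    compC (MCell.single (compC M ν hP hF hG)) χ hY hF₂ hG₂ =
      compC M (compC (MCell.single ν) χ h hK hK') h₁ h₂ h₃ := by
  apply eq_of_heq
  refine (compC_heq ..).trans (HEq.trans ?_ (compC_heq ..).symm)
  subst hP hF hG hK hK'
  refine (comp_assoc (MCell₂.cons M ν (MCell₂.nil g g')) χ).trans ?_
  exact comp_heq (Chain.append_nil _) (MCell.append_nil M) rfl rfl (compC_heq ..).symm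

/-- Associativity for two columns. -/
theorem compC_assoc₂ {A B D A' B' D' A'' B'' D'' A₃ D₃ : C} {f : A ⟶ A'} {g : B ⟶ B'}
    {k : D ⟶ D'} {f' : A' ⟶ A''} {g' : B' ⟶ B''} {k' : D' ⟶ D''} {f'' : A'' ⟶ A₃}
    {k'' : D'' ⟶ D₃} {P : Chain (Loose (C := C)) A' B'} {Q : Chain (Loose (C := C)) B' D'}
    {p : Loose A'' B''} {q : Loose B'' D''} {r : Loose A₃ D₃} (M : MCell f g P)
    (ν : Cell P f' g' p) (N : MCell g k Q) (ξ : Cell Q g' k' q)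
    (χ : Cell (Chain.cons p (Chain.single q)) f'' k'' r)
    {X : Chain (Loose (C := C)) A B} {X' : Chain (Loose (C := C)) B D}
    {Y : Chain (Loose (C := C)) A D}
    {F : A ⟶ A''} {G : B ⟶ B''} {H : D ⟶ D''} {F₂ : A ⟶ A₃} {H₂ : D ⟶ D₃} {K : A' ⟶ A₃}
    {K' : D' ⟶ D₃}
    (hM : M.dom = X) (hF : f ≫ f' = F) (hG : g ≫ g' = G)
    (hN : N.dom = X') (hG' : g ≫ g' = G) (hH : k ≫ k' = H)
    (hY : (MCell.pair (compC M ν hM hF hG) (compC N ξ hN hG' hH)).dom = Y)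
    (hF₂ : F ≫ f'' = F₂) (hH₂ : H ≫ k'' = H₂)
    (h : (MCell.pair ν ξ).dom = P.append Q) (hK : f' ≫ f'' = K) (hK' : k' ≫ k'' = K')
    (h₁ : (M.append N).dom = Y) (h₂ : f ≫ K = F₂) (h₃ : k ≫ K' = H₂) :
    compC (MCell.pair (compC M ν hM hF hG) (compC N ξ hN hG' hH)) χ hY hF₂ hH₂ =
      compC (M.append N) (compC (MCell.pair ν ξ) χ h hK hK') h₁ h₂ h₃ := by
  apply eq_of_heq
  refine (compC_heq ..).trans (HEq.trans ?_ (compC_heq ..).symm)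
  subst hM hF hG hK hK' hN hH
  refine (comp_assoc (MCell₂.cons M ν (MCell₂.cons N ξ (MCell₂.nil k k'))) χ).trans ?_
  refine comp_heq (by simp [MCell₂.lower]) ?_ rfl rfl (compC_heq ..).symm
  have : ∀ {Q' : Chain (Loose (C := C)) B' D'} (N' : MCell g k Q') (_ : Q' = Q), HEq N' N →
      HEq (M.append N') (M.append N) := by
    intro Q' N' h₁ h₂; subst h₁; cases h₂; rfl
  exact this _ (Chain.append_nil _) (MCell.append_nil N)

theorem compC_congr {A B A' B' A'' B'' : C} {f : A ⟶ A'} {g : B ⟶ B'}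
    {Q : Chain (Loose (C := C)) A' B'} {f' : A' ⟶ A''} {g' : B' ⟶ B''} {r : Loose A'' B''}
    {M M' : MCell f g Q} {ψ ψ' : Cell Q f' g' r} {P : Chain (Loose (C := C)) A B} {F : A ⟶ A''}
    {G : B ⟶ B''} {hP : M.dom = P} {hF : f ≫ f' = F} {hG : g ≫ g' = G}
    (hM : M = M') (hψ : ψ = ψ') : compC M ψ hP hF hG = compC M' ψ' (hM ▸ hP) hF hG := by
  subst hM hψ; rfl

theorem compC_cid {A B A' B' : C} {P : Chain (Loose (C := C)) A B} {f : A ⟶ A'} {g : B ⟶ B'}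
    {q : Loose A' B'} (φ : Cell P f g q) (hP : (MCell.single φ).dom = P) (hF : f ≫ 𝟙 A' = f)
    (hG : g ≫ 𝟙 B' = g) : compC (MCell.single φ) (cid q) hP hF hG = φ :=
  eq_of_heq ((compC_heq ..).trans (comp_cid φ))

theorem idm_compC {A B A' B' : C} {P : Chain (Loose (C := C)) A B} {f : A ⟶ A'} {g : B ⟶ B'}
    {q : Loose A' B'} (φ : Cell P f g q) (hP : (MCell.idm P).dom = P) (hF : 𝟙 A ≫ f = f)
    (hG : 𝟙 B ≫ g = g) : compC (MCell.idm P) φ hP hF hG = φ :=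
  eq_of_heq ((compC_heq ..).trans (idm_comp φ))

@[simp] theorem MCell.dom_idm {A B : C} (P : Chain (Loose (C := C)) A B) :
    (MCell.idm P).dom = P := by
  induction P with
  | nil => rfl
  | cons p P ih => simp [MCell.idm, ih]

end Flexible

section Equipment

variable [VirtualEquipment.{w, x} C]

/-- The restriction `E(f, g)` of the loose-identity of `E`. -/
def hom {A B E : C} (f : A ⟶ E) (g : B ⟶ E) : Loose A B := restr (unit E) f g

/-- The cartesian 2-cell `E(f, g) ⇒ E(1, 1)`. -/
def homCell {A B E : C} (f : A ⟶ E) (g : B ⟶ E) : Cell (Chain.single (hom f g)) f g (unit E) :=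
  restrCell (unit E) f g

/-- `HomCell P f g` is the type of 2-cells `p₁, …, pₙ ⇒ E(f, g)` with identity tight boundaries.
For `P` empty, these are the 2-cells `f ⇒ g` between parallel tight-cells. -/
abbrev HomCell {A B E : C} (P : Chain (Loose (C := C)) A B) (f : A ⟶ E) (g : B ⟶ E) : Type x :=
  Cell P (𝟙 A) (𝟙 B) (hom f g)

theorem exists_lift {A B D F E : C} {P : Chain (Loose (C := C)) A B} {f : D ⟶ E} {g : F ⟶ E}
    {h : A ⟶ D} {k : B ⟶ F} {m : A ⟶ E} {n : B ⟶ E} (ψ : Cell P m n (unit E))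
    (hm : h ≫ f = m) (hn : k ≫ g = n) :
    ∃ χ : Cell P h k (hom f g),
      compC (MCell.single χ) (homCell f g) (P := P) (by simp) hm hn = ψ := by
  subst hm hn
  obtain ⟨χ, hχ, -⟩ := restrCell_cartesian (unit E) f g P h k (cast (by simp) ψ)
  refine ⟨χ, eq_of_heq ((compC_heq ..).trans ?_)⟩
  exact (heq_of_eq hχ).trans (cast_heq _ _)

/-- The factorization of a 2-cell into `E(1, 1)` through the cartesian 2-cell of `E(f, g)`. -/
noncomputable def lift {A B D F E : C} {P : Chain (Loose (C := C)) A B} {f : D ⟶ E} {g : F ⟶ E}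
    {h : A ⟶ D} {k : B ⟶ F} {m : A ⟶ E} {n : B ⟶ E} (ψ : Cell P m n (unit E))
    (hm : h ≫ f = m) (hn : k ≫ g = n) : Cell P h k (hom f g) :=
  (exists_lift ψ hm hn).choose

theorem lift_comp {A B D F E : C} {P : Chain (Loose (C := C)) A B} {f : D ⟶ E} {g : F ⟶ E}
    {h : A ⟶ D} {k : B ⟶ F} {m : A ⟶ E} {n : B ⟶ E} (ψ : Cell P m n (unit E))
    (hm : h ≫ f = m) (hn : k ≫ g = n) :
    compC (MCell.single (lift ψ hm hn)) (homCell f g) (P := P) (by simp) hm hn = ψ :=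
  (exists_lift ψ hm hn).choose_spec

theorem lift_ext {A B D F E : C} {P : Chain (Loose (C := C)) A B} {f : D ⟶ E} {g : F ⟶ E}
    {h : A ⟶ D} {k : B ⟶ F} {m : A ⟶ E} {n : B ⟶ E} {χ χ' : Cell P h k (hom f g)}
    (hm : h ≫ f = m) (hn : k ≫ g = n)
    (H : compC (MCell.single χ) (homCell f g) (P := P) (by simp) hm hn =
      compC (MCell.single χ') (homCell f g) (P := P) (by simp) hm hn) : χ = χ' := by
  subst hm hn
  refine (restrCell_cartesian (unit E) f g P h k _).unique (y₁ := χ) rfl ?_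
  exact eq_of_heq (((compC_heq ..).symm.trans (heq_of_eq H.symm)).trans (compC_heq ..))

/-- The 2-cell into `E(1, 1)` with tight boundaries `f, g` corresponding to a 2-cell into
`E(f, g)`. -/
def toUnit {A B E : C} {P : Chain (Loose (C := C)) A B} {f : A ⟶ E} {g : B ⟶ E}
    (φ : HomCell P f g) : Cell P f g (unit E) :=
  compC (MCell.single φ) (homCell f g) (by simp) (by simp) (by simp)

/-- The inverse of `toUnit`. -/
noncomputable def ofUnit {A B E : C} {P : Chain (Loose (C := C)) A B} {f : A ⟶ E} {g : B ⟶ E}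
    (φ : Cell P f g (unit E)) : HomCell P f g :=
  lift φ (by simp) (by simp)

@[simp] theorem toUnit_ofUnit {A B E : C} {P : Chain (Loose (C := C)) A B} {f : A ⟶ E}
    {g : B ⟶ E} (φ : Cell P f g (unit E)) : toUnit (ofUnit φ) = φ := lift_comp _ _ _

theorem toUnit_injective {A B E : C} {P : Chain (Loose (C := C)) A B} {f : A ⟶ E}
    {g : B ⟶ E} {φ ψ : HomCell P f g} (H : toUnit φ = toUnit ψ) : φ = ψ := lift_ext _ _ H

@[simp] theorem ofUnit_toUnit {A B E : C} {P : Chain (Loose (C := C)) A B} {f : A ⟶ E}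
    {g : B ⟶ E} (φ : HomCell P f g) : ofUnit (toUnit φ) = φ :=
  toUnit_injective (toUnit_ofUnit _)

@[simp] theorem toUnit_cid {A B E : C} (f : A ⟶ E) (g : B ⟶ E) :
    toUnit (cid (hom f g)) = homCell f g :=
  idm_compC (P := Chain.single (hom f g)) _ _ _ _

theorem exists_unit_factor {A D F D' F' : C} {R : Chain (Loose (C := C)) D A}
    {S : Chain (Loose (C := C)) A F} {f : D ⟶ D'} {g : F ⟶ F'} {r : Loose D' F'}
    (ψ : Cell (R.append S) f g r) : ∃ χ : Cell (R.append (Chain.cons (unit A) S)) f g r,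
      compC ((MCell.idm R).append (MCell.cons (unitCell A) (MCell.idm S))) χ (P := R.append S)
        (by simp) (by simp) (by simp) = ψ := by
  obtain ⟨χ, hχ, -⟩ := unitCell_opcartesian A R S f g r (cast (by simp) ψ)
  exact ⟨χ, eq_of_heq ((compC_heq ..).trans ((heq_of_eq hχ).trans (cast_heq _ _)))⟩

theorem unit_factor_ext {A D F D' F' : C} {R : Chain (Loose (C := C)) D A}
    {S : Chain (Loose (C := C)) A F} {f : D ⟶ D'} {g : F ⟶ F'} {r : Loose D' F'}
    {χ χ' : Cell (R.append (Chain.cons (unit A) S)) f g r} {X : Chain (Loose (C := C)) D F}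
    {f' : D ⟶ D'} {g' : F ⟶ F'}
    (hX : ((MCell.idm R).append (MCell.cons (unitCell A) (MCell.idm S))).dom = X)
    (hf : 𝟙 D ≫ f = f') (hg : 𝟙 F ≫ g = g')
    (H : compC ((MCell.idm R).append (MCell.cons (unitCell A) (MCell.idm S))) χ hX hf hg =
      compC ((MCell.idm R).append (MCell.cons (unitCell A) (MCell.idm S))) χ' hX hf hg) :
    χ = χ' := by
  refine (unitCell_opcartesian A R S f g r _).unique (y₁ := χ) rfl ?_
  exact eq_of_heq (((compC_heq ..).symm.trans (heq_of_eq H.symm)).trans (compC_heq ..))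

/-- The composition 2-cell `A(1, 1), A(1, 1) ⇒ A(1, 1)`. -/
noncomputable def unitComp (A : C) :
    Cell (Chain.cons (unit A) (Chain.single (unit A))) (𝟙 A) (𝟙 A) (unit A) :=
  (exists_unit_factor (R := Chain.single (unit A)) (S := Chain.nil A) (cid (unit A))).choose

theorem unitComp_right (A : C) : compC (MCell.pair (cid (unit A)) (unitCell A)) (unitComp A)
    (P := Chain.single (unit A)) rfl (by simp) (by simp) = cid (unit A) :=
  (exists_unit_factor (R := Chain.single (unit A)) (S := Chain.nil A) (cid (unit A))).choose_spec

/-- The action `A(1, 1) ⇒ B(k, k)` of a tight-cell `k : A → B`, as a 2-cell into `B(1, 1)`. -/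
noncomputable def unitMap {A B : C} (k : A ⟶ B) : Cell (Chain.single (unit A)) k k (unit B) :=
  (exists_unit_factor (R := Chain.nil A) (S := Chain.nil A)
    (compC (MCell.nil k) (unitCell B) (P := Chain.nil A) rfl (by simp) (by simp))).choose

/-- The nullary 2-cell `() ⇒ E(1, 1)` with both boundaries `f`. -/
def idUnit {A E : C} (f : A ⟶ E) : Cell (Chain.nil A) f f (unit E) :=
  compC (MCell.nil f) (unitCell E) rfl (by simp) (by simp)

theorem unitMap_unit {A B : C} (k : A ⟶ B) : compC (MCell.single (unitCell A)) (unitMap k)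
    (P := Chain.nil A) rfl (by simp) (by simp) = idUnit k :=
  (exists_unit_factor (R := Chain.nil A) (S := Chain.nil A)
    (compC (MCell.nil k) (unitCell B) (P := Chain.nil A) rfl (by simp) (by simp))).choose_spec

/-- Pasting of 2-cells into `E(1, 1)` along a common tight boundary. -/
noncomputable def paste {A B D E : C} {P : Chain (Loose (C := C)) A B}
    {Q : Chain (Loose (C := C)) B D} {f : A ⟶ E} {g : B ⟶ E} {h : D ⟶ E}
    (φ : Cell P f g (unit E)) (ψ : Cell Q g h (unit E)) {X : Chain (Loose (C := C)) A D}
    (hX : P.append Q = X) : Cell X f h (unit E) :=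
  compC (MCell.pair φ ψ) (unitComp E) (by simp [hX]) (by simp) (by simp)

/-- Postcomposition of a 2-cell into `E(1, 1)` with a tight-cell `k : E → F`. -/
noncomputable def push {A B E F : C} {P : Chain (Loose (C := C)) A B} {f : A ⟶ E} {g : B ⟶ E}
    (φ : Cell P f g (unit E)) (k : E ⟶ F) {f' : A ⟶ F} {g' : B ⟶ F} (hf : f ≫ k = f')
    (hg : g ≫ k = g') : Cell P f' g' (unit F) :=
  compC (MCell.single φ) (unitMap k) (by simp) hf hg

theorem nil_compC {A A' : C} {f : A ⟶ A'} {q : Loose A' A'} {f' : A ⟶ A'}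
    (φ : Cell (Chain.nil A) f f' q) (hP : (MCell.nil (𝟙 A)).dom = Chain.nil A) (hf : 𝟙 A ≫ f = f)
    (hf' : 𝟙 A ≫ f' = f') : compC (MCell.nil (𝟙 A)) φ hP hf hf' = φ :=
  idm_compC (P := Chain.nil A) φ hP hf hf'

theorem paste_comp {A B D A' B' D' E : C} {f : A ⟶ A'} {g : B ⟶ B'}
    {k : D ⟶ D'} {f' : A' ⟶ E} {g' : B' ⟶ E} {k' : D' ⟶ E}
    {P : Chain (Loose (C := C)) A' B'} {Q : Chain (Loose (C := C)) B' D'}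
    (M : MCell f g P) (ν : Cell P f' g' (unit E)) (N : MCell g k Q) (ξ : Cell Q g' k' (unit E))
    {X : Chain (Loose (C := C)) A B} {X' : Chain (Loose (C := C)) B D}
    {Y : Chain (Loose (C := C)) A D} {Z : Chain (Loose (C := C)) A' D'}
    {F : A ⟶ E} {G : B ⟶ E} {H : D ⟶ E}
    (hM : M.dom = X) (hF : f ≫ f' = F) (hG : g ≫ g' = G)
    (hN : N.dom = X') (hG' : g ≫ g' = G) (hH : k ≫ k' = H) (hY : X.append X' = Y)
    (h : P.append Q = Z) (MN : MCell f k Z) (hMN : HEq MN (M.append N)) (h₁ : MN.dom = Y) :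
    paste (compC M ν hM hF hG) (compC N ξ hN hG' hH) hY =
      compC MN (paste ν ξ h) h₁ hF hH := by
  subst h; cases hMN
  exact compC_assoc₂ M ν N ξ (unitComp E) hM hF hG hN hG' hH _ _ _ _ (by simp) (by simp) _ _ _

theorem unitComp_left (A : C) : compC (MCell.pair (unitCell A) (cid (unit A))) (unitComp A)
    (P := Chain.single (unit A)) rfl (by simp) (by simp) = cid (unit A) := by
  apply unit_factor_ext (R := Chain.nil A) (S := Chain.nil A) (X := Chain.nil A) rfl
    (Category.id_comp _) (Category.id_comp _)
  have e₁ : compC (MCell.nil (𝟙 A)) (unitCell A) rfl (by simp) (by simp) = unitCell A :=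
    idm_compC (P := Chain.nil A) _ _ _ _
  have e₂ : compC (MCell.single (unitCell A)) (cid (unit A)) rfl (by simp) (by simp) =
    unitCell A := compC_cid _ _ _ _
  have h₁ := compC_assoc₂ (MCell.nil (𝟙 A)) (unitCell A) (MCell.single (unitCell A))
    (cid (unit A)) (unitComp A) (X := Chain.nil A) (X' := Chain.nil A) (Y := Chain.nil A)
    rfl (Category.id_comp (𝟙 A)) (Category.id_comp (𝟙 A)) rfl (Category.id_comp (𝟙 A))
    (Category.id_comp (𝟙 A)) rfl (Category.id_comp (𝟙 A)) (Category.id_comp (𝟙 A)) rfl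
    (Category.id_comp (𝟙 A)) (Category.id_comp (𝟙 A)) rfl (Category.id_comp (𝟙 A)) (Category.id_comp (𝟙 A))
  have h₂ := compC_assoc₂ (MCell.single (unitCell A)) (cid (unit A)) (MCell.nil (𝟙 A))
    (unitCell A) (unitComp A) (X := Chain.nil A) (X' := Chain.nil A) (Y := Chain.nil A)
    rfl (Category.id_comp (𝟙 A)) (Category.id_comp (𝟙 A)) rfl (Category.id_comp (𝟙 A))
    (Category.id_comp (𝟙 A)) rfl (Category.id_comp (𝟙 A)) (Category.id_comp (𝟙 A)) rfl
    (Category.id_comp (𝟙 A)) (Category.id_comp (𝟙 A)) rfl (Category.id_comp (𝟙 A)) (Category.id_comp (𝟙 A))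
  have e₃ := unitComp_right A
  exact h₁.symm.trans ((compC_congr (congrArg₂ MCell.pair (e₁.trans e₂.symm) (e₂.trans e₁.symm))
    rfl).trans (h₂.trans (compC_congr rfl e₃)))

theorem paste_idUnit {A B E : C} {P : Chain (Loose (C := C)) A B} {f : A ⟶ E} {g : B ⟶ E}
    (φ : Cell P f g (unit E)) (h : P.append (Chain.nil B) = P) : paste φ (idUnit g) h = φ := by
  have e : compC (MCell.single φ) (cid (unit E)) (P := P) h (Category.comp_id f)
    (Category.comp_id g) = φ := compC_cid _ _ _ _
  have h₁ := paste_comp (MCell.single φ) (cid (unit E)) (MCell.nil g) (unitCell E)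
    (Z := Chain.single (unit E)) (X := P) (X' := Chain.nil B) (Y := P) h (Category.comp_id f)
    (Category.comp_id g) rfl (Category.comp_id g) (Category.comp_id g) h rfl (MCell.single φ)
    HEq.rfl h
  have h₂ : paste (cid (unit E)) (unitCell E) rfl = cid (unit E) := unitComp_right E
  exact (congrArg (fun y => paste y (idUnit g) h) e.symm).trans
    (h₁.trans ((compC_congr rfl h₂).trans e))

theorem idUnit_paste {A B E : C} {P : Chain (Loose (C := C)) A B} {f : A ⟶ E} {g : B ⟶ E}
    (φ : Cell P f g (unit E)) (h : (Chain.nil A).append P = P) : paste (idUnit f) φ h = φ := by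
  have h₀ : P.append (Chain.nil B) = P := Chain.append_nil P
  have e : compC (MCell.single φ) (cid (unit E)) (P := P) h₀ (Category.comp_id f)
    (Category.comp_id g) = φ := compC_cid _ _ _ _
  have h₁ := paste_comp (MCell.nil f) (unitCell E) (MCell.single φ) (cid (unit E))
    (Z := Chain.single (unit E)) (X := Chain.nil A) (X' := P) (Y := P) rfl (Category.comp_id f)
    (Category.comp_id f) h₀ (Category.comp_id f) (Category.comp_id g) h rfl (MCell.single φ)
    HEq.rfl h₀
  have h₂ : paste (unitCell E) (cid (unit E)) rfl = cid (unit E) := unitComp_left E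
  exact (congrArg (fun y => paste (idUnit f) y h) e.symm).trans
    (h₁.trans ((compC_congr rfl h₂).trans e))

theorem compC_nil_nil {A A' A'' A₃ : C} (f : A ⟶ A') (f' : A' ⟶ A'') {f'' g'' : A'' ⟶ A₃}
    {r : Loose A₃ A₃} (χ : Cell (Chain.nil A'') f'' g'' r) {m : A ⟶ A''} {k l : A' ⟶ A₃}
    {F G : A ⟶ A₃} (hm : f ≫ f' = m) (hk : f' ≫ f'' = k) (hl : f' ≫ g'' = l) (h₁ : f ≫ k = F)
    (h₂ : f ≫ l = G) (h₃ : m ≫ f'' = F) (h₄ : m ≫ g'' = G) :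
    compC (MCell.nil f) (compC (MCell.nil f') χ rfl hk hl) rfl h₁ h₂ =
      compC (MCell.nil m) χ rfl h₃ h₄ := by
  apply eq_of_heq
  subst hm hk hl
  refine (compC_heq ..).trans (HEq.trans ?_ (compC_heq ..).symm)
  refine HEq.trans ?_ (comp_assoc (MCell₂.nil f f') χ).symm
  exact comp_heq rfl HEq.rfl rfl rfl (compC_heq ..)

theorem push_idUnit {A E F : C} (f : A ⟶ E) (k : E ⟶ F) {f' : A ⟶ F} (hf : f ≫ k = f') :
    push (idUnit f) k hf hf = idUnit f' := by
  have h₁ := compC_assoc₁ (MCell.nil f) (unitCell E) (unitMap k) (X := Chain.nil A)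
    (Y := Chain.nil A) rfl (Category.comp_id f) (Category.comp_id f) rfl hf hf rfl
    (Category.id_comp k) (Category.id_comp k) rfl hf hf
  have h₂ := unitMap_unit k
  have h₃ := compC_nil_nil f k (unitCell F) hf (Category.comp_id k) (Category.comp_id k) hf hf
    (Category.comp_id f') (Category.comp_id f')
  rw [h₂] at h₁
  exact h₁.trans h₃

theorem unitMap_comp {A B : C} (k : A ⟶ B) :
    compC (MCell.single (unitComp A)) (unitMap k)
      (P := Chain.cons (unit A) (Chain.single (unit A))) rfl (Category.id_comp k)
      (Category.id_comp k) = paste (unitMap k) (unitMap k) rfl := by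
  apply unit_factor_ext (R := Chain.single (unit A)) (S := Chain.nil A)
    (X := Chain.single (unit A)) rfl (Category.id_comp _) (Category.id_comp _)
  have e : compC (MCell.single (cid (unit A))) (unitMap k) rfl (Category.id_comp k)
    (Category.id_comp k) = unitMap k := idm_compC (P := Chain.single (unit A)) _ _ _ _
  have h₁ := compC_assoc₁ (MCell.pair (cid (unit A)) (unitCell A)) (unitComp A) (unitMap k)
    (X := Chain.single (unit A)) (Y := Chain.single (unit A)) rfl (Category.id_comp (𝟙 A))
    (Category.id_comp (𝟙 A)) rfl (Category.id_comp k) (Category.id_comp k) rfl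
    (Category.id_comp k) (Category.id_comp k) rfl (Category.id_comp k) (Category.id_comp k)
  have h₀ := unitComp_right A
  rw [h₀] at h₁
  have h₂ := paste_comp (MCell.single (cid (unit A))) (unitMap k) (MCell.single (unitCell A))
    (unitMap k) (X := Chain.single (unit A)) (X' := Chain.nil A) (Y := Chain.single (unit A))
    rfl (Category.id_comp k) (Category.id_comp k) rfl (Category.id_comp k) (Category.id_comp k)
    rfl rfl (MCell.pair (cid (unit A)) (unitCell A)) HEq.rfl rfl
  have h₃ := unitMap_unit k
  rw [h₃] at h₂
  have h₄ := paste_idUnit (unitMap k) rfl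
  have h₅ : paste (compC (MCell.single (cid (unit A))) (unitMap k) rfl (Category.id_comp k)
    (Category.id_comp k)) (idUnit k) rfl = unitMap k := by rw [e]; exact h₄
  exact (h₁.symm.trans e).trans (h₅.symm.trans h₂)

theorem push_paste {A B D E F : C} {P : Chain (Loose (C := C)) A B}
    {Q : Chain (Loose (C := C)) B D} {f : A ⟶ E} {g : B ⟶ E} {h : D ⟶ E}
    (φ : Cell P f g (unit E)) (ψ : Cell Q g h (unit E)) {X : Chain (Loose (C := C)) A D}
    (hX : P.append Q = X) (k : E ⟶ F) {f' : A ⟶ F} {g' : B ⟶ F} {h' : D ⟶ F}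
    (hf : f ≫ k = f') (hg : g ≫ k = g') (hh : h ≫ k = h') :
    push (paste φ ψ hX) k hf hh = paste (push φ k hf hg) (push ψ k hg hh) hX := by
  have hX' : (MCell.pair φ ψ).dom = X := by simp [hX]
  have h₁ := compC_assoc₁ (MCell.pair φ ψ) (unitComp E) (unitMap k) (X := X) (Y := X)
    hX' (Category.comp_id f) (Category.comp_id h) (by simp) hf hh rfl
    (Category.id_comp k) (Category.id_comp k) hX' hf hh
  rw [unitMap_comp] at h₁
  exact h₁.trans (paste_comp (MCell.single φ) (unitMap k) (MCell.single ψ) (unitMap k) (by simp)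
    hf hg (by simp) hg hh hX rfl (MCell.pair φ ψ) HEq.rfl hX').symm

/-- Vertical composition of 2-cells with identity tight boundaries. -/
def vcomp {A B : C} {P : Chain (Loose (C := C)) A B} {p q : Loose A B}
    (φ : Cell P (𝟙 A) (𝟙 B) p) (χ : Cell (Chain.single p) (𝟙 A) (𝟙 B) q) :
    Cell P (𝟙 A) (𝟙 B) q :=
  compC (MCell.single φ) χ (Chain.append_nil P) (Category.comp_id _) (Category.comp_id _)

/-- A 2-cell between loose-cells, with identity tight boundaries, is invertible. -/
def IsInvertible {A B : C} {p q : Loose A B}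
    (φ : Cell (Chain.single p) (𝟙 A) (𝟙 B) q) : Prop :=
  ∃ ψ : Cell (Chain.single q) (𝟙 A) (𝟙 B) p, vcomp φ ψ = cid p ∧ vcomp ψ φ = cid q

/-- The 2-cell `() ⇒ E(f, f)`, that is, the identity 2-cell `f ⇒ f`. -/
noncomputable def hid {A E : C} (f : A ⟶ E) : HomCell (Chain.nil A) f f := ofUnit (idUnit f)

/-- The composite of `P ⇒ E(f, g)` and `Q ⇒ E(g, h)` with the canonical 2-cell
`E(f, g), E(g, h) ⇒ E(f, h)`. -/
noncomputable def hcomp {A B D E : C} {P : Chain (Loose (C := C)) A B}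
    {Q : Chain (Loose (C := C)) B D} {f : A ⟶ E} {g : B ⟶ E} {h : D ⟶ E}
    (φ : HomCell P f g) (ψ : HomCell Q g h) : HomCell (P.append Q) f h :=
  ofUnit (paste (toUnit φ) (toUnit ψ) rfl)

/-- The composite of `φ : P ⇒ E(f, g)` with the action `E(f, g) ⇒ F(f ≫ k, g ≫ k)` of a tight-cell
`k : E → F`, written `φ ; k`. -/
noncomputable def whisker {A B E F : C} {P : Chain (Loose (C := C)) A B} {f : A ⟶ E} {g : B ⟶ E}
    (φ : HomCell P f g) (k : E ⟶ F) : HomCell P (f ≫ k) (g ≫ k) :=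
  ofUnit (push (toUnit φ) k rfl rfl)

/-- A tight-cell is an equivalence if it has a pseudo-inverse, that is, an inverse up to invertible
2-cells between tight-cells. -/
def IsEquivalenceCell {A B : C} (c : A ⟶ B) : Prop :=
  ∃ (d : B ⟶ A)
    (η : HomCell (Chain.nil A) (𝟙 A) (c ≫ d)) (η' : HomCell (Chain.nil A) (c ≫ d) (𝟙 A))
    (ε : HomCell (Chain.nil B) (d ≫ c) (𝟙 B)) (ε' : HomCell (Chain.nil B) (𝟙 B) (d ≫ c)),
    hcomp η η' = hid (𝟙 A) ∧ hcomp η' η = hid (c ≫ d) ∧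
    hcomp ε ε' = hid (d ≫ c) ∧ hcomp ε' ε = hid (𝟙 B)

/-! ### Weighted colimits -/

/-- Let `p : Y ⇸ Z` and `f : Z → W`.  The `p`-cocone `(c, l)` for `f`, consisting of `c : Y → W`
and a 2-cell `l : p ⇒ W(f, c)`, is the `p`-weighted colimit of `f` if pasting with `l` is
a bijection between 2-cells `Q ⇒ W(c, 1)` and 2-cells `p, Q ⇒ W(f, 1)`, for every chain `Q`. -/
def IsColimit {Z Y W : C} (p : Loose Z Y) (f : Z ⟶ W) (c : Y ⟶ W)
    (l : HomCell (Chain.single p) f c) : Prop :=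
  ∀ Q : Chain (Loose (C := C)) Y W, Function.Bijective
    (fun ψ : HomCell Q c (𝟙 W) => (hcomp l ψ : HomCell (Chain.cons p Q) f (𝟙 W)))

/-- A tight-cell `j : A → E` is dense if the identity 2-cell of `E(j, 1)` exhibits `1` as the left
extension of `j` along itself, that is, as the `E(j, 1)`-weighted colimit of `j`. -/
def IsDense {A E : C} (j : A ⟶ E) : Prop :=
  IsColimit (hom j (𝟙 E)) j (𝟙 E) (cid (hom j (𝟙 E)))

/-- A `p`-cocone `(c, l)` for `f : Z → E` (usually a colimit) is `j`-absolute if the left-composite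
of `E(j, f)` and `p` exists and the 2-cell from it to `E(j, c)` induced by
`E(j, f), p ⇒ E(j, f), E(f, c) ⇒ E(j, c)` is invertible. -/
def IsAbsolute {A E Z Y : C} (j : A ⟶ E) (p : Loose Z Y) (f : Z ⟶ E) (c : Y ⟶ E)
    (l : HomCell (Chain.single p) f c) : Prop :=
  ∃ (q : Loose A Y) (φ : Cell (Chain.cons (hom j f) (Chain.single p)) (𝟙 A) (𝟙 Y) q)
    (θ : Cell (Chain.single q) (𝟙 A) (𝟙 Y) (hom j c)),
    IsLeftOpcartesian φ ∧ vcomp φ θ = hcomp (cid (hom j f)) l ∧ IsInvertible θ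

/-- Let `p : Y ⇸ Z`, `f : Z → W` and `g : W → X` be such that the `p`-weighted colimit of `f ≫ g`
exists.  It is non-strictly created by `g` if a `p`-cocone for `f` is a colimit precisely when its
image under `g` is, and the `p`-weighted colimit of `f` exists. -/
def NonStrictlyCreates {Z Y W X : C} (p : Loose Z Y) (f : Z ⟶ W) (g : W ⟶ X) : Prop :=
  (∀ (c : Y ⟶ W) (l : HomCell (Chain.single p) f c),
    IsColimit p (f ≫ g) (c ≫ g) (whisker l g) ↔ IsColimit p f c l) ∧
  ∃ (c : Y ⟶ W) (l : HomCell (Chain.single p) f c), IsColimit p f c l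

/-- The tight-cell `r : D → E` non-strictly creates `j`-absolute `r`-extensions: whenever the left
extension of `r` along a tight-cell `c : D → D'` (the `D'(c, 1)`-weighted colimit of `r = 1 ≫ r`)
exists and is `j`-absolute, it is non-strictly created by `r`. -/
def NonStrictlyCreatesAbsoluteExtensions {A D E : C} (j : A ⟶ E) (r : D ⟶ E) : Prop :=
  ∀ {D' : C} (c : D ⟶ D') (e : D' ⟶ E) (l : HomCell (Chain.single (hom c (𝟙 D'))) r e),
    IsColimit (hom c (𝟙 D')) r e l → IsAbsolute j (hom c (𝟙 D')) r e l →
    NonStrictlyCreates (hom c (𝟙 D')) (𝟙 D) r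

/-! ### Relative monads, algebras, relative adjunctions -/

/-- A relative monad with root `j`. -/
structure RelMonad {A E : C} (j : A ⟶ E) where
  /-- The carrier `t`. -/
  carrier : A ⟶ E
  /-- The extension operator `E(j, t) ⇒ E(t, t)`. -/
  ext : HomCell (Chain.single (hom j carrier)) carrier carrier
  /-- The unit `j ⇒ t`. -/
  η : HomCell (Chain.nil A) j carrier
  η_ext : hcomp η ext = cid (hom j carrier)
  ext_η : vcomp η ext = hid carrier
  assoc : hcomp ext ext = vcomp (hcomp (cid (hom j carrier)) ext) ext

/-- An algebra with domain `D` for a relative monad `T`. -/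
structure Algebra {A E : C} {j : A ⟶ E} (T : RelMonad j) (D : C) where
  /-- The carrier `e`. -/
  carrier : D ⟶ E
  /-- The extension operator `E(j, e) ⇒ E(t, e)`. -/
  ext : HomCell (Chain.single (hom j carrier)) T.carrier carrier
  η_ext : hcomp T.η ext = cid (hom j carrier)
  assoc : hcomp T.ext ext = vcomp (hcomp (cid (hom j T.carrier)) ext) ext

/-- A 2-cell `ε : P ⇒ E(e, e')` is a `P`-graded morphism of algebras from `e` to `e'`. -/
def IsGradedMorphism {A E : C} {j : A ⟶ E} {T : RelMonad j} {D D' : C} (a : Algebra T D)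
    (a' : Algebra T D') {P : Chain (Loose (C := C)) D D'}
    (ε : HomCell P a.carrier a'.carrier) : Prop :=
  hcomp a.ext ε = vcomp (hcomp (cid (hom j a.carrier)) ε) a'.ext

theorem toUnit_vcomp {A B E F : C} {P : Chain (Loose (C := C)) A B} {f : A ⟶ E} {g : B ⟶ E}
    {f' : A ⟶ F} {g' : B ⟶ F}
    (φ : HomCell P f g) (χ : HomCell (Chain.single (hom f g)) f' g') :
    toUnit (vcomp φ χ) = compC (MCell.single φ) (toUnit χ) (Chain.append_nil P)
      (Category.id_comp f') (Category.id_comp g') :=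
  compC_assoc₁ (MCell.single φ) χ (homCell f' g') (X := P) (Y := P) (Chain.append_nil P)
    (Category.comp_id _) (Category.comp_id _) (Chain.append_nil P) (Category.id_comp _)
    (Category.id_comp _) rfl (Category.id_comp _) (Category.id_comp _) (Chain.append_nil P)
    (Category.id_comp _) (Category.id_comp _)

@[simp] theorem toUnit_hcomp {A B D E : C} {P : Chain (Loose (C := C)) A B}
    {Q : Chain (Loose (C := C)) B D} {f : A ⟶ E} {g : B ⟶ E} {h : D ⟶ E}
    (φ : HomCell P f g) (ψ : HomCell Q g h) :
    toUnit (hcomp φ ψ) = paste (toUnit φ) (toUnit ψ) rfl := toUnit_ofUnit _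

/-- The canonical 2-cell `E(f, k ≫ g) ⇒ E(f, g)` with tight boundaries `1, k`. -/
noncomputable def restrictCell {A B B' E : C} (f : A ⟶ E) (g : B ⟶ E) (k : B' ⟶ B) :
    Cell (Chain.single (hom f (k ≫ g))) (𝟙 A) k (hom f g) :=
  lift (homCell f (k ≫ g)) (Category.id_comp f) rfl

theorem restrictCell_comp {A B B' E : C} (f : A ⟶ E) (g : B ⟶ E) (k : B' ⟶ B) :
    compC (MCell.single (restrictCell f g k)) (homCell f g)
      (P := Chain.single (hom f (k ≫ g))) rfl (Category.id_comp f) rfl = homCell f (k ≫ g) :=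
  lift_comp _ _ _

/-- The restriction `α(1, k) : E(f, k ≫ g) ⇒ F(f', k ≫ g')` of `α : E(f, g) ⇒ F(f', g')`. -/
noncomputable def restrictRight {A B B' E F : C} {f : A ⟶ E} {g : B ⟶ E} {f' : A ⟶ F}
    {g' : B ⟶ F} (α : HomCell (Chain.single (hom f g)) f' g') (k : B' ⟶ B) :
    HomCell (Chain.single (hom f (k ≫ g))) f' (k ≫ g') :=
  ofUnit (compC (MCell.single (restrictCell f g k)) (toUnit α) rfl (Category.id_comp f') rfl)

theorem compC_paste_right {A B D D' E : C} {P : Chain (Loose (C := C)) A B}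
    {f : A ⟶ E} {g : B ⟶ E} {h : D ⟶ E} {h' : D' ⟶ E} {k : D' ⟶ D} {p : Loose B D} {q : Loose B D'}
    (φ : Cell P f g (unit E)) (ψ : Cell (Chain.single p) g h (unit E))
    (κ : Cell (Chain.single q) (𝟙 B) k p) (hh : k ≫ h = h') :
    paste φ (compC (MCell.single κ) ψ (P := Chain.single q) rfl (Category.id_comp g) hh) rfl =
      compC ((MCell.idm P).append (MCell.single κ)) (paste φ ψ rfl) (by simp)
        (Category.id_comp f) hh := by
  have hP : (MCell.idm P).dom = P := MCell.dom_idm P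
  have e : compC (MCell.idm P) φ hP (Category.id_comp f) (Category.id_comp g) = φ :=
    idm_compC _ _ _ _
  have h₁ := paste_comp (MCell.idm P) φ (MCell.single κ) ψ (X := P) (X' := Chain.single q)
    hP (Category.id_comp f) (Category.id_comp g) rfl (Category.id_comp g) hh rfl rfl
    ((MCell.idm P).append (MCell.single κ)) HEq.rfl (by simp)
  rw [e] at h₁
  exact h₁

/-- The restriction of an algebra along a tight-cell `c`, with carrier `c ≫ e` and extension
operator `ext(1, c)`. -/
noncomputable def Algebra.restrict {A E : C} {j : A ⟶ E} {T : RelMonad j} {N : C}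
    (M : Algebra T N) {D : C} (c : D ⟶ N) : Algebra T D where
  carrier := c ≫ M.carrier
  ext := restrictRight M.ext c
  η_ext := by
    apply toUnit_injective
    have h₁ := compC_paste_right (toUnit T.η) (toUnit M.ext) (restrictCell j M.carrier c) rfl
    have h₂ : paste (toUnit T.η) (toUnit M.ext) rfl = homCell j M.carrier := by
      have := congrArg toUnit M.η_ext
      exact (toUnit_hcomp _ _).symm.trans (this.trans (toUnit_cid _ _))
    have h₃ : toUnit (restrictRight M.ext c) = _ := toUnit_ofUnit _
    refine (toUnit_hcomp _ _).trans ?_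
    refine (congrArg (fun y => paste (toUnit T.η) y rfl) h₃).trans (h₁.trans ?_)
    refine (compC_congr rfl h₂).trans ?_
    exact (restrictCell_comp j M.carrier c).trans (toUnit_cid _ _).symm
  assoc := by
    apply toUnit_injective
    set L := restrictCell j M.carrier c
    have h₃ : toUnit (restrictRight M.ext c) = compC (MCell.single L) (toUnit M.ext) rfl
      (Category.id_comp _) rfl := toUnit_ofUnit _
    have h₁ := compC_paste_right (toUnit T.ext) (toUnit M.ext) L rfl
    have h₂ := congrArg toUnit M.assoc
    rw [toUnit_hcomp, toUnit_vcomp] at h₂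
    rw [toUnit_hcomp, toUnit_vcomp, h₃]
    refine h₁.trans ((compC_congr rfl h₂).trans ?_)
    have h₄ : compC (MCell.single (hcomp (cid (hom j T.carrier)) (restrictRight M.ext c))) L
        (P := Chain.cons (hom j T.carrier) (Chain.single (hom j (c ≫ M.carrier)))) rfl
        (Category.id_comp _) (Category.id_comp _) =
        compC (MCell.pair (cid (hom j T.carrier)) L)
          (hcomp (cid (hom j T.carrier)) M.ext) rfl (Category.id_comp _) (Category.comp_id _) := by
      apply lift_ext (Category.id_comp _) rfl
      have k₁ := compC_assoc₁
        (MCell.single (hcomp (cid (hom j T.carrier)) (restrictRight M.ext c))) L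
        (homCell j M.carrier)
        (X := Chain.cons (hom j T.carrier) (Chain.single (hom j (c ≫ M.carrier))))
        (Y := Chain.cons (hom j T.carrier) (Chain.single (hom j (c ≫ M.carrier))))
        rfl (Category.id_comp _) (Category.id_comp _) rfl (Category.id_comp _) rfl rfl
        (Category.id_comp _) rfl rfl (Category.id_comp _) (Category.id_comp _)
      have k₂ := compC_assoc₁ (MCell.pair (cid (hom j T.carrier)) L)
        (hcomp (cid (hom j T.carrier)) M.ext) (homCell j M.carrier)
        (X := Chain.cons (hom j T.carrier) (Chain.single (hom j (c ≫ M.carrier))))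
        (Y := Chain.cons (hom j T.carrier) (Chain.single (hom j (c ≫ M.carrier))))
        rfl (Category.id_comp _) (Category.comp_id _) rfl (Category.id_comp _) rfl rfl
        (Category.id_comp _) (Category.id_comp _) rfl (Category.id_comp _) rfl
      have k₃ := compC_paste_right (homCell j T.carrier) (toUnit M.ext) L rfl
      have k₄ : toUnit (hcomp (cid (hom j T.carrier)) (restrictRight M.ext c)) =
          paste (homCell j T.carrier) (compC (MCell.single L) (toUnit M.ext) rfl
            (Category.id_comp _) rfl) rfl := by
        rw [toUnit_hcomp, toUnit_cid, h₃]
        rfl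
      have k₅ : toUnit (hcomp (cid (hom j T.carrier)) M.ext) =
          paste (homCell j T.carrier) (toUnit M.ext) rfl := by
        rw [toUnit_hcomp, toUnit_cid]
      refine k₁.trans (Eq.trans ?_ k₂.symm)
      refine (compC_congr rfl (restrictCell_comp j M.carrier c)).trans ?_
      exact (k₄.trans k₃).trans (compC_congr rfl k₅.symm)
    have l₁ := compC_assoc₁ (MCell.pair (cid (hom j T.carrier)) L)
      (hcomp (cid (hom j T.carrier)) M.ext) (toUnit M.ext)
      (X := Chain.cons (hom j T.carrier) (Chain.single (hom j (c ≫ M.carrier))))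
      (Y := Chain.cons (hom j T.carrier) (Chain.single (hom j (c ≫ M.carrier))))
      rfl (Category.id_comp _) (Category.comp_id _) rfl (Category.id_comp _) rfl rfl
      (Category.id_comp _) (Category.id_comp _) rfl (Category.id_comp _) rfl
    have l₂ := compC_assoc₁
      (MCell.single (hcomp (cid (hom j T.carrier)) (restrictRight M.ext c))) L (toUnit M.ext)
      (X := Chain.cons (hom j T.carrier) (Chain.single (hom j (c ≫ M.carrier))))
      (Y := Chain.cons (hom j T.carrier) (Chain.single (hom j (c ≫ M.carrier))))
      rfl (Category.id_comp _) (Category.id_comp _) rfl (Category.id_comp _) rfl rfl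
      (Category.id_comp _) rfl rfl (Category.id_comp _) (Category.id_comp _)
    refine l₁.symm.trans (Eq.trans ?_ l₂)
    exact compC_congr (congrArg MCell.single h₄.symm) rfl

/-- An algebra `(u : N → E, ext)` for `T` is an algebra object for `T` if every algebra is
the restriction of it along a unique tight-cell, and every graded morphism between algebras (which
are of the form `(c ≫ u, ext(1, c))`) is of the form `τ ; u` for a unique 2-cell `τ`. -/
structure IsAlgebraObject {A E : C} {j : A ⟶ E} {T : RelMonad j} {N : C} (M : Algebra T N) :
    Prop where
  existsUnique_tight : ∀ {D : C} (a : Algebra T D), ∃! c : D ⟶ N, M.restrict c = a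
  existsUnique_cell : ∀ {D D' : C} (c : D ⟶ N) (c' : D' ⟶ N) (P : Chain (Loose (C := C)) D D')
    (ε : HomCell P (c ≫ M.carrier) (c' ≫ M.carrier)),
    IsGradedMorphism (M.restrict c) (M.restrict c') (P := P) ε →
    ∃! τ : HomCell P c c', whisker τ M.carrier = ε

/-- A relative adjunction with root `j`, left adjoint `ℓ` and right adjoint `r`: an isomorphism
`D(ℓ, 1) ≅ E(j, r)`. -/
structure RelAdjunction {A D E : C} (j : A ⟶ E) (ℓ : A ⟶ D) (r : D ⟶ E) where
  /-- The left-to-right transposition operator. -/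
  sharp : HomCell (Chain.single (hom ℓ (𝟙 D))) j r
  /-- The right-to-left transposition operator. -/
  flat : HomCell (Chain.single (hom j r)) ℓ (𝟙 D)
  sharp_flat : vcomp sharp flat = cid (hom ℓ (𝟙 D))
  flat_sharp : vcomp flat sharp = cid (hom j r)

namespace RelAdjunction

variable {A B D E : C} {j : A ⟶ E} {ℓ : A ⟶ D} {r : D ⟶ E} (adj : RelAdjunction j ℓ r)

/-- The transpose `P ⇒ E(j, k ≫ r)` of a 2-cell `P ⇒ D(ℓ, k)`, as 2-cells with tight boundaries
into loose-identities. -/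
noncomputable def toRight {P : Chain (Loose (C := C)) A B} {k : B ⟶ D} {m : B ⟶ E}
    (φ : Cell P ℓ k (unit D)) (hm : k ≫ r = m) : Cell P j m (unit E) :=
  compC (MCell.single (lift φ (Category.id_comp ℓ) (Category.comp_id k))) (toUnit adj.sharp)
    (Chain.append_nil P) (Category.id_comp j) hm

/-- The transpose `P ⇒ D(ℓ, k)` of a 2-cell `P ⇒ E(j, k ≫ r)`, as 2-cells with tight boundaries
into loose-identities. -/
noncomputable def toLeft {P : Chain (Loose (C := C)) A B} {k : B ⟶ D} {m : B ⟶ E}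
    (φ : Cell P j m (unit E)) (hm : k ≫ r = m) : Cell P ℓ k (unit D) :=
  compC (MCell.single (lift φ (Category.id_comp j) hm)) (toUnit adj.flat)
    (Chain.append_nil P) (Category.id_comp ℓ) (Category.comp_id k)

theorem toRight_toLeft {P : Chain (Loose (C := C)) A B} {k : B ⟶ D} {m : B ⟶ E}
    (φ : Cell P j m (unit E)) (hm : k ≫ r = m) : adj.toRight (adj.toLeft φ hm) hm = φ := by
  have hP := Chain.append_nil P
  set κ := lift φ (Category.id_comp j) hm with hκ
  have h₁ : lift (adj.toLeft φ hm) (Category.id_comp ℓ) (Category.comp_id k) =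
      compC (MCell.single κ) adj.flat hP (Category.id_comp _) (Category.comp_id k) := by
    apply lift_ext (Category.id_comp ℓ) (Category.comp_id k)
    refine (lift_comp _ _ _).trans ?_
    exact (compC_assoc₁ (MCell.single κ) adj.flat (homCell ℓ (𝟙 D)) hP (Category.id_comp _)
      (Category.comp_id k) hP (Category.id_comp ℓ) (Category.comp_id k) rfl (Category.id_comp _)
      (Category.id_comp _) hP (Category.id_comp _) (Category.comp_id _)).symm
  have h₂ := compC_assoc₁ (MCell.single κ) adj.flat (toUnit adj.sharp) hP (Category.id_comp _)
      (Category.comp_id k) hP (Category.id_comp j) hm rfl (Category.id_comp _)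
      (Category.id_comp _) hP (Category.id_comp _) hm
  have h₃ := toUnit_vcomp adj.flat adj.sharp
  rw [adj.flat_sharp, toUnit_cid] at h₃
  refine (compC_congr (congrArg MCell.single h₁) rfl).trans (h₂.trans ?_)
  exact (compC_congr rfl h₃.symm).trans (lift_comp φ _ _)

theorem toLeft_toRight {P : Chain (Loose (C := C)) A B} {k : B ⟶ D} {m : B ⟶ E}
    (φ : Cell P ℓ k (unit D)) (hm : k ≫ r = m) : adj.toLeft (adj.toRight φ hm) hm = φ := by
  have hP := Chain.append_nil P
  set κ := lift φ (Category.id_comp ℓ) (Category.comp_id k) with hκ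
  have h₁ : lift (adj.toRight φ hm) (Category.id_comp j) hm =
      compC (MCell.single κ) adj.sharp hP (Category.id_comp _) (Category.comp_id k) := by
    apply lift_ext (Category.id_comp j) hm
    refine (lift_comp _ _ _).trans ?_
    exact (compC_assoc₁ (MCell.single κ) adj.sharp (homCell j r) hP (Category.id_comp _)
      (Category.comp_id k) hP (Category.id_comp j) hm rfl (Category.id_comp _)
      (Category.id_comp _) hP (Category.id_comp _) hm).symm
  have h₂ := compC_assoc₁ (MCell.single κ) adj.sharp (toUnit adj.flat) hP (Category.id_comp _)
      (Category.comp_id k) hP (Category.id_comp ℓ) (Category.comp_id k) rfl (Category.id_comp _)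
      (Category.id_comp _) hP (Category.id_comp _) (Category.comp_id k)
  have h₃ := toUnit_vcomp adj.sharp adj.flat
  rw [adj.sharp_flat, toUnit_cid] at h₃
  refine (compC_congr (congrArg MCell.single h₁) rfl).trans (h₂.trans ?_)
  exact (compC_congr rfl h₃.symm).trans (lift_comp φ _ _)

theorem compC_toLeft {P Q : Chain (Loose (C := C)) A B} {k : B ⟶ D} {m : B ⟶ E}
    (M : MCell (𝟙 A) (𝟙 B) P) (hM : M.dom = Q) (φ : Cell P j m (unit E)) (hm : k ≫ r = m) :
    compC M (adj.toLeft φ hm) hM (Category.id_comp _) (Category.id_comp _) =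
      adj.toLeft (compC M φ hM (Category.id_comp _) (Category.id_comp _)) hm := by
  have hQ := Chain.append_nil Q
  have hP := Chain.append_nil P
  have h₁ : lift (compC M φ hM (Category.id_comp _) (Category.id_comp _))
      (Category.id_comp j) hm = compC M (lift φ (Category.id_comp j) hm) hM
        (Category.id_comp _) (Category.id_comp _) := by
    apply lift_ext (Category.id_comp j) hm
    refine (lift_comp _ _ _).trans ?_
    refine Eq.trans ?_ (compC_assoc₁ M (lift φ (Category.id_comp j) hm) (homCell j r) hM
      (Category.id_comp _) (Category.id_comp _) hQ (Category.id_comp j) hm hP (Category.id_comp _)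
      hm hM (Category.id_comp _) (Category.id_comp _)).symm
    exact (compC_congr rfl (lift_comp φ (Category.id_comp j) hm)).symm
  have h₂ := compC_assoc₁ M (lift φ (Category.id_comp j) hm) (toUnit adj.flat) hM
    (Category.id_comp _) (Category.id_comp _) hQ (Category.id_comp ℓ) (Category.comp_id k) hP
    (Category.id_comp _) (Category.comp_id k) hM (Category.id_comp _) (Category.id_comp _)
  exact h₂.symm.trans (compC_congr (congrArg MCell.single h₁) rfl).symm

theorem toRight_unit :
    adj.toRight (k := 𝟙 D) (m := r) (paste (homCell ℓ (𝟙 D)) (cid (unit D)) rfl)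
      (Category.id_comp r) = paste (toUnit adj.sharp) (unitMap r) rfl := by
  set p := hom ℓ (𝟙 D)
  apply unit_factor_ext (R := Chain.single p) (S := Chain.nil D) (X := Chain.single p) rfl
    (Category.id_comp j) (Category.id_comp r)
  set κ := lift (h := 𝟙 A) (k := 𝟙 D) (f := ℓ) (g := 𝟙 D)
    (paste (homCell ℓ (𝟙 D)) (cid (unit D)) rfl) (Category.id_comp ℓ) (Category.comp_id (𝟙 D))
    with hκ
  have hη : idUnit (𝟙 D) = unitCell D := nil_compC _ _ _ _
  have h₁ : compC (MCell.pair (cid p) (unitCell D)) κ (P := Chain.single p) rfl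
      (Category.id_comp (𝟙 A)) (Category.id_comp (𝟙 D)) = cid p := by
    apply lift_ext (Category.id_comp ℓ) (Category.id_comp (𝟙 D))
    have k₁ := compC_assoc₁ (MCell.pair (cid p) (unitCell D)) κ (homCell ℓ (𝟙 D))
      (X := Chain.single p) (Y := Chain.single p) rfl (Category.id_comp (𝟙 A))
      (Category.id_comp (𝟙 D)) rfl (Category.id_comp ℓ) (Category.id_comp (𝟙 D)) rfl
      (Category.id_comp ℓ) (Category.id_comp (𝟙 D)) rfl (Category.id_comp ℓ)
      (Category.id_comp (𝟙 D))
    have k₂ : compC (MCell.single κ) (homCell ℓ (𝟙 D)) rfl (Category.id_comp ℓ)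
      (Category.id_comp (𝟙 D)) = paste (homCell ℓ (𝟙 D)) (cid (unit D)) rfl := lift_comp _ _ _
    have e₁ : compC (MCell.single (cid p)) (homCell ℓ (𝟙 D)) (P := Chain.single p) rfl
      (Category.id_comp ℓ) (Category.id_comp (𝟙 D)) = homCell ℓ (𝟙 D) :=
      idm_compC (P := Chain.single p) _ _ _ _
    have e₂ : compC (MCell.single (unitCell D)) (cid (unit D)) (P := Chain.nil D) rfl
      (Category.id_comp (𝟙 D)) (Category.id_comp (𝟙 D)) = unitCell D := compC_cid _ _ _ _
    have k₃ := paste_comp (MCell.single (cid p)) (homCell ℓ (𝟙 D)) (MCell.single (unitCell D))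
      (cid (unit D)) (X := Chain.single p) (X' := Chain.nil D) (Y := Chain.single p) rfl
      (Category.id_comp ℓ) (Category.id_comp (𝟙 D)) rfl (Category.id_comp (𝟙 D))
      (Category.id_comp (𝟙 D)) rfl rfl (MCell.pair (cid p) (unitCell D)) HEq.rfl rfl
    have k₄ : paste (homCell ℓ (𝟙 D)) (unitCell D) (X := Chain.single p) rfl = homCell ℓ (𝟙 D) :=
      (congrArg (fun y => paste (homCell ℓ (𝟙 D)) y rfl) hη.symm).trans (paste_idUnit _ rfl)
    refine k₁.trans ((compC_congr rfl k₂).trans (k₃.symm.trans ?_))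
    exact ((congrArg₂ (fun x y => paste x y rfl) e₁ e₂).trans k₄).trans e₁.symm
  have h₂ := compC_assoc₁ (MCell.pair (cid p) (unitCell D)) κ (toUnit adj.sharp)
    (X := Chain.single p) (Y := Chain.single p) rfl (Category.id_comp (𝟙 A))
    (Category.id_comp (𝟙 D)) rfl (Category.id_comp j) (Category.id_comp r) rfl
    (Category.id_comp j) (Category.id_comp r) rfl (Category.id_comp j) (Category.id_comp r)
  have e₃ : compC (MCell.single (cid p)) (toUnit adj.sharp) (P := Chain.single p) rfl
    (Category.id_comp j) (Category.id_comp r) = toUnit adj.sharp :=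
    idm_compC (P := Chain.single p) _ _ _ _
  have h₃ := paste_comp (MCell.single (cid p)) (toUnit adj.sharp) (MCell.single (unitCell D))
    (unitMap r) (X := Chain.single p) (X' := Chain.nil D) (Y := Chain.single p) rfl
    (Category.id_comp j) (Category.id_comp r) rfl (Category.id_comp r)
    (Category.id_comp r) rfl rfl (MCell.pair (cid p) (unitCell D)) HEq.rfl rfl
  refine (h₂.symm.trans ((compC_congr (congrArg MCell.single h₁) rfl).trans e₃)).trans ?_
  refine Eq.trans ?_ h₃
  exact ((congrArg₂ (fun x y => paste x y rfl) e₃ (unitMap_unit r)).trans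
    (paste_idUnit _ rfl)).symm

theorem toRight_paste {B' : C} {P : Chain (Loose (C := C)) A B} {Q : Chain (Loose (C := C)) B B'}
    {k : B ⟶ D} {k' : B' ⟶ D} {m : B ⟶ E} {m' : B' ⟶ E} (φ : Cell P ℓ k (unit D))
    (ψ : Cell Q k k' (unit D)) (hm : k ≫ r = m) (hm' : k' ≫ r = m') :
    adj.toRight (paste φ ψ rfl) hm' =
      paste (adj.toRight φ hm) (push ψ r hm hm') rfl := by
  set p := hom ℓ (𝟙 D)
  set κ := lift φ (Category.id_comp ℓ) (Category.comp_id k) with hκ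
  set μ := lift (h := 𝟙 A) (k := 𝟙 D) (f := ℓ) (g := 𝟙 D)
    (paste (homCell ℓ (𝟙 D)) (cid (unit D)) rfl) (Category.id_comp ℓ) (Category.comp_id (𝟙 D))
    with hμ
  have hX : (MCell.pair κ ψ).dom = P.append Q := by simp
  have h₁ : lift (paste φ ψ rfl) (Category.id_comp ℓ) (Category.comp_id k') =
      compC (MCell.pair κ ψ) μ hX (Category.id_comp (𝟙 A)) (Category.comp_id k') := by
    apply lift_ext (Category.id_comp ℓ) (Category.comp_id k')
    refine (lift_comp _ _ _).trans ?_
    have k₁ := compC_assoc₁ (MCell.pair κ ψ) μ (homCell ℓ (𝟙 D)) hX (Category.id_comp (𝟙 A))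
      (Category.comp_id k') (Chain.append_nil _) (Category.id_comp ℓ) (Category.comp_id k') rfl
      (Category.id_comp ℓ) (Category.id_comp (𝟙 D)) hX (Category.id_comp ℓ) (Category.comp_id k')
    have k₂ : compC (MCell.single μ) (homCell ℓ (𝟙 D)) rfl (Category.id_comp ℓ)
      (Category.id_comp (𝟙 D)) = paste (homCell ℓ (𝟙 D)) (cid (unit D)) rfl := lift_comp _ _ _
    have k₃ := paste_comp (MCell.single κ) (homCell ℓ (𝟙 D)) (MCell.single ψ) (cid (unit D))
      (Chain.append_nil P) (Category.id_comp ℓ) (Category.comp_id k) (Chain.append_nil Q)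
      (Category.comp_id k) (Category.comp_id k') rfl rfl (MCell.pair κ ψ) HEq.rfl hX
    have k₄ : compC (MCell.single κ) (homCell ℓ (𝟙 D)) (Chain.append_nil P) (Category.id_comp ℓ)
      (Category.comp_id k) = φ := lift_comp _ _ _
    have k₅ : compC (MCell.single ψ) (cid (unit D)) (Chain.append_nil Q) (Category.comp_id k)
      (Category.comp_id k') = ψ := compC_cid _ _ _ _
    rw [k₄, k₅] at k₃
    exact k₃.trans ((compC_congr rfl k₂).symm.trans k₁.symm)
  have h₂ := compC_assoc₁ (MCell.pair κ ψ) μ (toUnit adj.sharp) hX (Category.id_comp (𝟙 A))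
      (Category.comp_id k') (Chain.append_nil _) (Category.id_comp j) hm' rfl
      (Category.id_comp j) (Category.id_comp r) hX (Category.id_comp j) hm'
  have h₃ := paste_comp (MCell.single κ) (toUnit adj.sharp) (MCell.single ψ) (unitMap r)
      (Chain.append_nil P) (Category.id_comp j) hm (Chain.append_nil Q)
      hm hm' rfl rfl (MCell.pair κ ψ) HEq.rfl hX
  refine (compC_congr (congrArg MCell.single h₁) rfl).trans (h₂.trans ?_)
  exact (compC_congr rfl adj.toRight_unit).trans h₃.symm

/-- The 2-cell `E(j, k ≫ r) ⇒ D(ℓ, k) ⇒ E(ℓ ≫ r, k ≫ r)` obtained by transposition and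
postcomposition with `r`. -/
noncomputable def bind {k : B ⟶ D} {m : B ⟶ E} (hm : k ≫ r = m) :
    HomCell (Chain.single (hom j m)) (ℓ ≫ r) m :=
  ofUnit (push (adj.toLeft (homCell j m) hm) r rfl hm)

/-- The unit `j ⇒ ℓ ≫ r` of a relative adjunction, the transpose of the identity of `ℓ`. -/
noncomputable def η : HomCell (Chain.nil A) j (ℓ ≫ r) := ofUnit (adj.toRight (idUnit ℓ) rfl)

theorem toUnit_vcomp_bind {P : Chain (Loose (C := C)) A B} {k : B ⟶ D} {m : B ⟶ E}
    (hm : k ≫ r = m) (φ : HomCell P j m) :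
    toUnit (vcomp φ (adj.bind hm)) = push (adj.toLeft (toUnit φ) hm) r rfl hm := by
  have hP := Chain.append_nil P
  rw [toUnit_vcomp, bind, toUnit_ofUnit]
  have h₁ := compC_assoc₁ (MCell.single φ) (adj.toLeft (homCell j m) hm) (unitMap r) hP
    (Category.id_comp ℓ) (Category.id_comp k) hP rfl hm rfl rfl hm hP (Category.id_comp _)
    (Category.id_comp _)
  have h₂ := adj.compC_toLeft (MCell.single φ) hP (homCell j m) hm
  exact h₁.symm.trans (compC_congr (congrArg MCell.single h₂) rfl)

theorem η_bind {k : B ⟶ D} {m : B ⟶ E} (hm : k ≫ r = m) :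
    hcomp adj.η (adj.bind hm) = cid (hom j m) := by
  apply toUnit_injective
  rw [toUnit_hcomp, η, bind, toUnit_ofUnit, toUnit_ofUnit]
  refine Eq.trans ?_ (toUnit_cid j m).symm
  refine (adj.toRight_paste (idUnit ℓ) (adj.toLeft (homCell j m) hm) rfl hm).symm.trans ?_
  exact (congrArg (fun y => adj.toRight y hm) (idUnit_paste _ rfl)).trans
    (adj.toRight_toLeft _ hm)

theorem vcomp_η_bind : vcomp adj.η (adj.bind rfl) = hid (ℓ ≫ r) := by
  apply toUnit_injective
  rw [toUnit_vcomp_bind, η, toUnit_ofUnit, toLeft_toRight, push_idUnit, hid, toUnit_ofUnit]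

theorem bind_assoc {k : B ⟶ D} {m : B ⟶ E} (hm : k ≫ r = m) :
    hcomp (adj.bind (rfl : ℓ ≫ r = ℓ ≫ r)) (adj.bind hm) =
      vcomp (hcomp (cid (hom j (ℓ ≫ r))) (adj.bind hm)) (adj.bind hm) := by
  apply toUnit_injective
  rw [toUnit_vcomp_bind, toUnit_hcomp, toUnit_hcomp, toUnit_cid, bind, bind, toUnit_ofUnit,
    toUnit_ofUnit, ← push_paste]
  have h := adj.toRight_paste (adj.toLeft (homCell j (ℓ ≫ r)) rfl)
    (adj.toLeft (homCell j m) hm) rfl hm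
  rw [toRight_toLeft] at h
  rw [← h, toLeft_toRight]

/-- The relative monad induced by a relative adjunction, with carrier `ℓ ≫ r`. -/
noncomputable def monad : RelMonad j where
  carrier := ℓ ≫ r
  ext := adj.bind rfl
  η := adj.η
  η_ext := adj.η_bind rfl
  ext_η := adj.vcomp_η_bind
  assoc := adj.bind_assoc rfl

/-- The algebra for the induced relative monad carried by the right adjoint. -/
noncomputable def algebra : Algebra adj.monad D where
  carrier := r
  ext := adj.bind (Category.id_comp r)
  η_ext := adj.η_bind (Category.id_comp r)
  assoc := adj.bind_assoc (Category.id_comp r)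

/-- The comparison tight-cell into an algebra object for the induced relative monad, induced by
the algebra structure on the right adjoint. -/
noncomputable def comparison {N : C} {M : Algebra adj.monad N} (hM : IsAlgebraObject M) : D ⟶ N :=
  (hM.existsUnique_tight adj.algebra).choose

end RelAdjunction

/-- A tight-cell `r : D → E` is non-strictly `j`-monadic if it admits a left `j`-adjoint, the
induced relative monad admits an algebra object, and the comparison tight-cell is an equivalence. -/
def IsNonStrictlyMonadic {A D E : C} (j : A ⟶ E) (r : D ⟶ E) : Prop :=
  ∃ (ℓ : A ⟶ D) (adj : RelAdjunction j ℓ r) (N : C) (M : Algebra adj.monad N)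
    (hM : IsAlgebraObject M), IsEquivalenceCell (adj.comparison hM)

end Equipment

end FormalCat

/-! Because restrictions are cartesian, a 2-cell P ⇒ E(f, g) amounts to a 2-cell from P into E(1, 1)
with tight boundaries f and g. In that form everything needed is pasting (`paste`), image under a
tight-cell (`push`), restriction along a tight-cell (`res`) and application of a 2-cell E(f, g) ⇒
F(f', g') (`act`). Identities between these are checked on generic 2-cells, namely `homCell f g` and
the universal 2-cell of a loose-identity, as in a Yoneda argument.

Let ℓ be left j-adjoint to r, and let l : D'(c, 1) ⇒ E(r, e). Since E(j, r) ≅ D(ℓ, 1), the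
left-composite of E(j, r) and D'(c, 1) is D'(ℓ;c, 1). So l is j-absolute exactly when its transpose
D'(ℓ;c, 1) ⇒ E(j, e) is invertible. The proof works with an inverse μ of this transpose, described
by the two equations of `IsTransposeInverse`. Given μ, three things follow. If j is dense, l is
automatically a colimit (`IsTransposeInverse.isColimitCell`). The composite E(j, e) ≅ D'(ℓ;c, 1) ⇒
E(ℓ;r, e) is an algebra structure on e, the only one for which l is a graded morphism
(`eq_extCell`). And compatibility of a 2-cell out of e with algebra structures may be tested after
pasting with l (`isGradedCell_of_paste`).

Now let u : N → E be an algebra object and K : D → N the comparison, so that K;u = r. By the above,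
a j-absolute extension of r lifts along u to a cocone under K, and the lift is a colimit in N
(`exists_push`, `isColimitCell_of_push`). If K is an equivalence, it is fully faithful and
essentially surjective, and the lifted colimit is carried back to D. This gives creation by r.

Conversely, suppose that r creates. The point is that u is itself the j-absolute extension of r
along K (`exists_isTransposeInverse_comparison`): here μ is the lift to N of the extension operator
of u. Creation provides an extension w : N → D of the identity of D along K, preserved by r, whence
an isomorphism u ≅ w;r. This isomorphism is compatible with the algebra structures, so it lifts to 1
≅ w;K. The unit 1 ⇒ K;w is sent by r to an invertible 2-cell, namely the restriction of u ≅ w;r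
along K. It is then invertible itself, by creation of the extension of r along the identity of D
(`isTransposeInverse_id`). -/

namespace FormalCat

open VDCData VDCOps VirtualDoubleCategory VirtualEquipment

variable {C : Type u} [Category.{v} C] [VirtualEquipment.{w, x} C]

/-! ### The calculus of 2-cells into loose-identities -/

/-- The application of a 2-cell `a : E(f, g) ⇒ F(f', g')` to a 2-cell `P ⇒ E(h ≫ f, k ≫ g)`. -/
noncomputable def act {A B X Y E F : C} {f : X ⟶ E} {g : Y ⟶ E} {f' : X ⟶ F} {g' : Y ⟶ F}
    (a : Cell (Chain.single (hom f g)) f' g' (unit F)) {P : Chain (Loose (C := C)) A B}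
    {h : A ⟶ X} {k : B ⟶ Y} {m : A ⟶ E} {n : B ⟶ E} {m' : A ⟶ F} {n' : B ⟶ F}
    (φ : Cell P m n (unit E)) (hm : h ≫ f = m) (hn : k ≫ g = n) (hm' : h ≫ f' = m')
    (hn' : k ≫ g' = n') : Cell P m' n' (unit F) :=
  compC (MCell.single (lift φ hm hn)) a (Chain.append_nil P) hm' hn'

/-- The restriction of a 2-cell between parallel tight-cells along a tight-cell. -/
noncomputable def res {A B E : C} {a b : B ⟶ E} (θ : Cell (Chain.nil B) a b (unit E)) (k : A ⟶ B)
    {a' b' : A ⟶ E} (ha : k ≫ a = a') (hb : k ≫ b = b') : Cell (Chain.nil A) a' b' (unit E) :=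
  compC (MCell.nil k) θ rfl ha hb

theorem lift_homCell {X Y E : C} (f : X ⟶ E) (g : Y ⟶ E) :
    lift (homCell f g) (Category.id_comp f) (Category.id_comp g) = cid (hom f g) := by
  apply lift_ext (Category.id_comp f) (Category.id_comp g)
  exact (lift_comp _ _ _).trans (idm_compC (P := Chain.single (hom f g)) (homCell f g) _ _ _).symm

theorem act_homCell {X Y E F : C} {f : X ⟶ E} {g : Y ⟶ E} {f' : X ⟶ F} {g' : Y ⟶ F}
    (a : Cell (Chain.single (hom f g)) f' g' (unit F)) :
    act a (homCell f g) (Category.id_comp f) (Category.id_comp g) (Category.id_comp f')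
      (Category.id_comp g') = a := by
  unfold act
  rw [lift_homCell]
  exact idm_compC (P := Chain.single (hom f g)) a _ _ _

theorem compC_lift {A B A₀ B₀ X Y E : C} {s : A₀ ⟶ A} {t : B₀ ⟶ B}
    {P : Chain (Loose (C := C)) A B} (M : MCell s t P) {f : X ⟶ E} {g : Y ⟶ E}
    {h : A ⟶ X} {k : B ⟶ Y} {m : A ⟶ E} {n : B ⟶ E} (φ : Cell P m n (unit E))
    (hm : h ≫ f = m) (hn : k ≫ g = n) {P₀ : Chain (Loose (C := C)) A₀ B₀} {h₀ : A₀ ⟶ X}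
    {k₀ : B₀ ⟶ Y} {m₀ : A₀ ⟶ E} {n₀ : B₀ ⟶ E} (hP : M.dom = P₀) (hs : s ≫ h = h₀)
    (ht : t ≫ k = k₀) (hsm : s ≫ m = m₀) (htn : t ≫ n = n₀) (hm₀ : h₀ ≫ f = m₀)
    (hn₀ : k₀ ≫ g = n₀) :
    compC M (lift φ hm hn) hP hs ht = lift (compC M φ hP hsm htn) hm₀ hn₀ := by
  apply lift_ext hm₀ hn₀
  refine (compC_assoc₁ M (lift φ hm hn) (homCell f g) hP hs ht (Chain.append_nil _) hm₀ hn₀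
    (Chain.append_nil _) hm hn hP hsm htn).trans (Eq.trans ?_ (lift_comp _ _ _).symm)
  exact compC_congr rfl (lift_comp φ hm hn)

theorem compC_act {A B A₀ B₀ X Y E F : C} {s : A₀ ⟶ A} {t : B₀ ⟶ B}
    {P : Chain (Loose (C := C)) A B} (M : MCell s t P) {f : X ⟶ E} {g : Y ⟶ E}
    {f' : X ⟶ F} {g' : Y ⟶ F} (a : Cell (Chain.single (hom f g)) f' g' (unit F))
    {h : A ⟶ X} {k : B ⟶ Y} {m : A ⟶ E} {n : B ⟶ E} {m' : A ⟶ F} {n' : B ⟶ F}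
    (φ : Cell P m n (unit E)) (hm : h ≫ f = m) (hn : k ≫ g = n) (hm' : h ≫ f' = m')
    (hn' : k ≫ g' = n') {P₀ : Chain (Loose (C := C)) A₀ B₀} {h₀ : A₀ ⟶ X}
    {k₀ : B₀ ⟶ Y} {m₀ : A₀ ⟶ E} {n₀ : B₀ ⟶ E} {m₀' : A₀ ⟶ F} {n₀' : B₀ ⟶ F} (hP : M.dom = P₀)
    (hs : s ≫ h = h₀) (ht : t ≫ k = k₀) (hsm : s ≫ m = m₀) (htn : t ≫ n = n₀)
    (hsm' : s ≫ m' = m₀') (htn' : t ≫ n' = n₀') (hm₀ : h₀ ≫ f = m₀) (hn₀ : k₀ ≫ g = n₀)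
    (hm₀' : h₀ ≫ f' = m₀') (hn₀' : k₀ ≫ g' = n₀') :
    compC M (act a φ hm hn hm' hn') hP hsm' htn' =
      act a (compC M φ hP hsm htn) hm₀ hn₀ hm₀' hn₀' := by
  refine (compC_assoc₁ M (lift φ hm hn) a hP hs ht (Chain.append_nil _) hm₀' hn₀'
    (Chain.append_nil _) hm' hn' hP hsm' htn').symm.trans ?_
  exact compC_congr (congrArg MCell.single (compC_lift M φ hm hn hP hs ht hsm htn hm₀ hn₀)) rfl

/-- An instance of `compC_act`: `act a φ` is `a` precomposed with the factorization of `φ` through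
E(f, g), and precomposition passes through the action of `b`. -/
theorem act_act {A B X Y X' Y' E F G : C} {f : X ⟶ E} {g : Y ⟶ E} {f₁ : X ⟶ F} {g₁ : Y ⟶ F}
    {f₂ : X' ⟶ F} {g₂ : Y' ⟶ F} {f₃ : X' ⟶ G} {g₃ : Y' ⟶ G} {f₄ : X ⟶ G} {g₄ : Y ⟶ G}
    (b : Cell (Chain.single (hom f₂ g₂)) f₃ g₃ (unit G))
    (a : Cell (Chain.single (hom f g)) f₁ g₁ (unit F)) {P : Chain (Loose (C := C)) A B}
    {h : A ⟶ X} {k : B ⟶ Y} {h' : X ⟶ X'} {k' : Y ⟶ Y'} {h'' : A ⟶ X'} {k'' : B ⟶ Y'}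
    {m : A ⟶ E} {n : B ⟶ E} {m' : A ⟶ F} {n' : B ⟶ F} {m'' : A ⟶ G} {n'' : B ⟶ G}
    (φ : Cell P m n (unit E)) (hm : h ≫ f = m) (hn : k ≫ g = n) (hm' : h ≫ f₁ = m')
    (hn' : k ≫ g₁ = n') (hf : h' ≫ f₂ = f₁) (hg : k' ≫ g₂ = g₁) (hf' : h' ≫ f₃ = f₄)
    (hg' : k' ≫ g₃ = g₄) (hh : h ≫ h' = h'') (hk : k ≫ k' = k'') (h₁ : h'' ≫ f₂ = m')
    (h₂ : k'' ≫ g₂ = n') (h₃ : h'' ≫ f₃ = m'') (h₄ : k'' ≫ g₃ = n'') (h₅ : h ≫ f₄ = m'')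
    (h₆ : k ≫ g₄ = n'') :
    act b (act a φ hm hn hm' hn') h₁ h₂ h₃ h₄ =
      act (act b a hf hg hf' hg') φ hm hn h₅ h₆ :=
  (compC_act (MCell.single (lift φ hm hn)) b a hf hg hf' hg' (Chain.append_nil P) hh hk hm' hn'
    h₅ h₆ h₁ h₂ h₃ h₄).symm

theorem push_act {A B X Y E F G : C} {f : X ⟶ E} {g : Y ⟶ E} {f' : X ⟶ F} {g' : Y ⟶ F}
    (a : Cell (Chain.single (hom f g)) f' g' (unit F)) {P : Chain (Loose (C := C)) A B}
    {h : A ⟶ X} {k : B ⟶ Y} {m : A ⟶ E} {n : B ⟶ E} {m' : A ⟶ F} {n' : B ⟶ F}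
    (φ : Cell P m n (unit E)) (hm : h ≫ f = m) (hn : k ≫ g = n) (hm' : h ≫ f' = m')
    (hn' : k ≫ g' = n') (z : F ⟶ G) {f'' : X ⟶ G} {g'' : Y ⟶ G} {m'' : A ⟶ G} {n'' : B ⟶ G}
    (hm'' : m' ≫ z = m'') (hn'' : n' ≫ z = n'') (hf : f' ≫ z = f'') (hg : g' ≫ z = g'')
    (h₁ : h ≫ f'' = m'') (h₂ : k ≫ g'' = n'') :
    push (act a φ hm hn hm' hn') z hm'' hn'' = act (push a z hf hg) φ hm hn h₁ h₂ :=
  compC_assoc₁ (MCell.single (lift φ hm hn)) a (unitMap z) _ _ _ _ _ _ _ _ _ _ _ _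

theorem compC_push {A B A₀ B₀ E F : C} {s : A₀ ⟶ A} {t : B₀ ⟶ B}
    {P : Chain (Loose (C := C)) A B} (M : MCell s t P) {f : A ⟶ E} {g : B ⟶ E}
    (φ : Cell P f g (unit E)) (z : E ⟶ F) {f' : A ⟶ F} {g' : B ⟶ F} (hf : f ≫ z = f')
    (hg : g ≫ z = g') {P₀ : Chain (Loose (C := C)) A₀ B₀} {f₀ : A₀ ⟶ E} {g₀ : B₀ ⟶ E}
    {f₀' : A₀ ⟶ F} {g₀' : B₀ ⟶ F} (hP : M.dom = P₀) (hs : s ≫ f = f₀) (ht : t ≫ g = g₀)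
    (hs' : s ≫ f' = f₀') (ht' : t ≫ g' = g₀') (hf₀ : f₀ ≫ z = f₀') (hg₀ : g₀ ≫ z = g₀') :
    compC M (push φ z hf hg) hP hs' ht' = push (compC M φ hP hs ht) z hf₀ hg₀ :=
  (compC_assoc₁ M φ (unitMap z) _ _ _ _ _ _ _ _ _ _ _ _).symm

/-- Pulls the factorization of `φ` out of a pasting and leaves the fixed 2-cell `paste a ψ` below
it. Naturality statements for `act` are thereby reduced to the case where `φ` is `homCell f g`. -/
theorem paste_act {A B D X Y E F : C} {f : X ⟶ E} {g : Y ⟶ E} {f' : X ⟶ F} {g' : Y ⟶ F}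
    {z : D ⟶ F} (a : Cell (Chain.single (hom f g)) f' g' (unit F))
    {P : Chain (Loose (C := C)) A B} {h : A ⟶ X} {k : B ⟶ Y} {m : A ⟶ E} {n : B ⟶ E}
    {m' : A ⟶ F} {n' : B ⟶ F} (φ : Cell P m n (unit E)) (hm : h ≫ f = m) (hn : k ≫ g = n)
    (hm' : h ≫ f' = m') (hn' : k ≫ g' = n') {D₀ : C} {t : D₀ ⟶ D}
    {Q : Chain (Loose (C := C)) Y D} (N : MCell k t Q) (ψ : Cell Q g' z (unit F))
    {Q₀ : Chain (Loose (C := C)) B D₀} {X₀ : Chain (Loose (C := C)) A D₀} {z₀ : D₀ ⟶ F}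
    (hQ : N.dom = Q₀) (ht : t ≫ z = z₀) (hX : P.append Q₀ = X₀)
    (hX' : (MCell.cons (lift φ hm hn) N).dom = X₀) :
    paste (act a φ hm hn hm' hn') (compC N ψ hQ hn' ht) hX =
      compC (MCell.cons (lift φ hm hn) N) (paste a ψ rfl) hX' hm' ht :=
  paste_comp (MCell.single (lift φ hm hn)) a N ψ (Chain.append_nil P) hm' hn' hQ hn' ht hX rfl
    (MCell.cons (lift φ hm hn) N) HEq.rfl hX'

/-- The universal 2-cell of the loose-identity turns `unitMap g` into the identity of `g`, which is
neutral for pasting. This is the computation left after testing an equality by `unit_factor_ext`. -/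
theorem compC_paste_unitMap {X Y E : C} {f : X ⟶ E} {g : Y ⟶ E} {p : Loose X Y}
    (b : Cell (Chain.single p) f g (unit E)) :
    compC (MCell.pair (cid p) (unitCell Y)) (paste b (unitMap g) rfl)
      (P := Chain.single p) rfl (Category.id_comp f) (Category.id_comp g) = b := by
  have e : compC (MCell.single (cid p)) b (P := Chain.single p) rfl
    (Category.id_comp f) (Category.id_comp g) = b :=
    idm_compC (P := Chain.single p) _ _ _ _
  have h₃ := paste_comp (MCell.single (cid p)) b (MCell.single (unitCell Y))
    (unitMap g) (X := Chain.single p) (X' := Chain.nil Y)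
    (Y := Chain.single p) rfl (Category.id_comp f) (Category.id_comp g) rfl
    (Category.id_comp g) (Category.id_comp g) rfl rfl
    (MCell.pair (cid p) (unitCell Y)) HEq.rfl rfl
  exact h₃.symm.trans ((congrArg₂ (fun y z => paste y z rfl) e (unitMap_unit g)).trans
    (paste_idUnit b rfl))

theorem compC_unitMap_paste {X Y E : C} {f : X ⟶ E} {g : Y ⟶ E} {p : Loose X Y}
    (b : Cell (Chain.single p) f g (unit E)) :
    compC (MCell.pair (unitCell X) (cid p)) (paste (unitMap f) b rfl)
      (P := Chain.single p) rfl (Category.id_comp f) (Category.id_comp g) = b := by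
  have e : compC (MCell.single (cid p)) b (P := Chain.single p) rfl
    (Category.id_comp f) (Category.id_comp g) = b :=
    idm_compC (P := Chain.single p) _ _ _ _
  have h₃ := paste_comp (MCell.single (unitCell X)) (unitMap f) (MCell.single (cid p))
    b (X := Chain.nil X) (X' := Chain.single p)
    (Y := Chain.single p) rfl (Category.id_comp f) (Category.id_comp f) rfl
    (Category.id_comp f) (Category.id_comp g) rfl rfl
    (MCell.pair (unitCell X) (cid p)) HEq.rfl rfl
  exact h₃.symm.trans ((congrArg₂ (fun y z => paste y z rfl) (unitMap_unit f) e).trans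
    (idUnit_paste b rfl))

/-- The generic case of naturality in the right boundary. By opcartesianness of the loose-identity
it suffices to insert `unitCell Y`, after which both sides become `a`. -/
theorem act_paste_unitMap {X Y E F : C} {f : X ⟶ E} {g : Y ⟶ E} {f' : X ⟶ F} {g' : Y ⟶ F}
    (a : Cell (Chain.single (hom f g)) f' g' (unit F)) :
    act a (paste (homCell f g) (unitMap g) rfl) (Category.id_comp f) (Category.id_comp g)
      (Category.id_comp f') (Category.id_comp g') = paste a (unitMap g') rfl := by
  apply unit_factor_ext (R := Chain.single (hom f g)) (S := Chain.nil Y)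
    (X := Chain.single (hom f g)) rfl (Category.id_comp f') (Category.id_comp g')
  refine Eq.trans ?_ (compC_paste_unitMap a).symm
  refine (compC_act (MCell.pair (cid (hom f g)) (unitCell Y)) a _ (Category.id_comp f)
    (Category.id_comp g) (Category.id_comp f') (Category.id_comp g') rfl (Category.id_comp (𝟙 X))
    (Category.id_comp (𝟙 Y)) (Category.id_comp f) (Category.id_comp g) (Category.id_comp f')
    (Category.id_comp g') (Category.id_comp f) (Category.id_comp g) (Category.id_comp f')
    (Category.id_comp g')).trans ?_
  exact (congrArg (fun y => act a y _ _ _ _) (compC_paste_unitMap (homCell f g))).trans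
    (act_homCell a)

theorem act_unitMap_paste {X Y E F : C} {f : X ⟶ E} {g : Y ⟶ E} {f' : X ⟶ F} {g' : Y ⟶ F}
    (a : Cell (Chain.single (hom f g)) f' g' (unit F)) :
    act a (paste (unitMap f) (homCell f g) rfl) (Category.id_comp f) (Category.id_comp g)
      (Category.id_comp f') (Category.id_comp g') = paste (unitMap f') a rfl := by
  apply unit_factor_ext (R := Chain.nil X) (S := Chain.single (hom f g))
    (X := Chain.single (hom f g)) rfl (Category.id_comp f') (Category.id_comp g')
  refine Eq.trans ?_ (compC_unitMap_paste a).symm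
  refine (compC_act (MCell.pair (unitCell X) (cid (hom f g))) a _ (Category.id_comp f)
    (Category.id_comp g) (Category.id_comp f') (Category.id_comp g') rfl (Category.id_comp (𝟙 X))
    (Category.id_comp (𝟙 Y)) (Category.id_comp f) (Category.id_comp g) (Category.id_comp f')
    (Category.id_comp g') (Category.id_comp f) (Category.id_comp g) (Category.id_comp f')
    (Category.id_comp g')).trans ?_
  exact (congrArg (fun y => act a y _ _ _ _) (compC_unitMap_paste (homCell f g))).trans
    (act_homCell a)

theorem act_eq_self {A B X Y E : C} {f : X ⟶ E} {g : Y ⟶ E} {P : Chain (Loose (C := C)) A B}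
    {h : A ⟶ X} {k : B ⟶ Y} {m : A ⟶ E} {n : B ⟶ E} (φ : Cell P m n (unit E))
    (hm : h ≫ f = m) (hn : k ≫ g = n) : act (homCell f g) φ hm hn hm hn = φ :=
  lift_comp φ hm hn

/-- Naturality of the action of a 2-cell in its right boundary. -/
theorem act_paste_push {A B D X Y E F : C} {f : X ⟶ E} {g : Y ⟶ E} {f' : X ⟶ F} {g' : Y ⟶ F}
    (a : Cell (Chain.single (hom f g)) f' g' (unit F)) {P : Chain (Loose (C := C)) A B}
    {Q : Chain (Loose (C := C)) B D}
    {h : A ⟶ X} {k : B ⟶ Y} {k' : D ⟶ Y} {m : A ⟶ E} {n : B ⟶ E} {o : D ⟶ E}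
    {m' : A ⟶ F} {n' : B ⟶ F} {o' : D ⟶ F}
    (φ : Cell P m n (unit E)) (ψ : Cell Q k k' (unit Y)) (hm : h ≫ f = m) (hn : k ≫ g = n)
    (ho : k' ≫ g = o) (hm' : h ≫ f' = m') (hn' : k ≫ g' = n') (ho' : k' ≫ g' = o')
    {Z : Chain (Loose (C := C)) A D} (hZ : P.append Q = Z) :
    act a (paste φ (push ψ g hn ho) hZ) hm ho hm' ho' =
      paste (act a φ hm hn hm' hn') (push ψ g' hn' ho') hZ := by
  -- Both pastings factor through the same sequence, `lift φ` followed by `ψ`; what remains below is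
  -- the generic case `act_paste_unitMap`.
  have hX : (MCell.cons (lift φ hm hn) (MCell.single ψ)).dom = Z := by simp [hZ]
  have e₁ := paste_act (homCell f g) φ hm hn hm hn (MCell.single ψ) (unitMap g)
    (Chain.append_nil Q) ho hZ hX
  have e₂ := paste_act a φ hm hn hm' hn' (MCell.single ψ) (unitMap g')
    (Chain.append_nil Q) ho' hZ hX
  rw [act_eq_self] at e₁
  refine (congrArg (fun y => act a y hm ho hm' ho') e₁).trans ?_
  refine Eq.trans ?_ ((compC_congr (hP := hX) rfl (act_paste_unitMap a)).trans e₂.symm)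
  exact (compC_act _ a _ (Category.id_comp f)
    (Category.id_comp g) (Category.id_comp f') (Category.id_comp g') hX (Category.comp_id h)
    (Category.comp_id k') hm ho hm' ho' hm ho hm' ho').symm

/-- Naturality of the action of a 2-cell in its left boundary. -/
theorem act_push_paste {A B D X Y E F : C} {f : X ⟶ E} {g : Y ⟶ E} {f' : X ⟶ F} {g' : Y ⟶ F}
    (a : Cell (Chain.single (hom f g)) f' g' (unit F)) {P : Chain (Loose (C := C)) A B}
    {Q : Chain (Loose (C := C)) B D}
    {h : A ⟶ X} {h' : B ⟶ X} {k : D ⟶ Y} {m : A ⟶ E} {n : B ⟶ E} {o : D ⟶ E}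
    {m' : A ⟶ F} {n' : B ⟶ F} {o' : D ⟶ F}
    (ψ : Cell P h h' (unit X)) (φ : Cell Q n o (unit E)) (hm : h ≫ f = m) (hn : h' ≫ f = n)
    (ho : k ≫ g = o) (hm' : h ≫ f' = m') (hn' : h' ≫ f' = n') (ho' : k ≫ g' = o')
    {Z : Chain (Loose (C := C)) A D} (hZ : P.append Q = Z) :
    act a (paste (push ψ f hm hn) φ hZ) hm ho hm' ho' =
      paste (push ψ f' hm' hn') (act a φ hn ho hn' ho') hZ := by
  have hX : (MCell.cons ψ (MCell.single (lift φ hn ho))).dom = Z := by simp [hZ]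
  have e₁ := paste_comp (MCell.single ψ) (unitMap f) (MCell.single (lift φ hn ho)) (homCell f g)
    (Chain.append_nil P) hm hn (Chain.append_nil Q) hn ho hZ rfl
    (MCell.cons ψ (MCell.single (lift φ hn ho))) HEq.rfl hX
  have e₂ := paste_comp (MCell.single ψ) (unitMap f') (MCell.single (lift φ hn ho)) a
    (Chain.append_nil P) hm' hn' (Chain.append_nil Q) hn' ho' hZ rfl
    (MCell.cons ψ (MCell.single (lift φ hn ho))) HEq.rfl hX
  rw [lift_comp] at e₁
  refine (congrArg (fun y => act a y hm ho hm' ho') e₁).trans ?_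
  refine Eq.trans ?_ ((compC_congr (hP := hX) rfl (act_unitMap_paste a)).trans e₂.symm)
  exact (compC_act _ a _ (Category.id_comp f)
    (Category.id_comp g) (Category.id_comp f') (Category.id_comp g') hX (Category.comp_id h)
    (Category.comp_id k) hm ho hm' ho' hm ho hm' ho').symm

theorem unitMap_unitMap {A B D : C} (k : A ⟶ B) (k' : B ⟶ D) {k'' : A ⟶ D} (h : k ≫ k' = k'') :
    push (unitMap k) k' h h = unitMap k'' := by
  apply unit_factor_ext (R := Chain.nil A) (S := Chain.nil A)
    (X := Chain.nil A) rfl (Category.id_comp k'') (Category.id_comp k'')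
  have h₁ := compC_push (MCell.single (unitCell A)) (unitMap k) k' h h (P₀ := Chain.nil A) rfl
    (Category.id_comp k) (Category.id_comp k) (Category.id_comp k'') (Category.id_comp k'') h h
  refine h₁.trans ?_
  exact ((congrArg (fun y => push y k' h h) (unitMap_unit k)).trans (push_idUnit k k' h)).trans
    (unitMap_unit k'').symm

theorem push_push {A B E F G : C} {P : Chain (Loose (C := C)) A B} {f : A ⟶ E} {g : B ⟶ E}
    (φ : Cell P f g (unit E)) (k : E ⟶ F) (k' : F ⟶ G) {k'' : E ⟶ G} (h : k ≫ k' = k'')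
    {f' : A ⟶ F} {g' : B ⟶ F} {f'' : A ⟶ G} {g'' : B ⟶ G} (hf : f ≫ k = f') (hg : g ≫ k = g')
    (hf' : f' ≫ k' = f'') (hg' : g' ≫ k' = g'') (hf'' : f ≫ k'' = f'') (hg'' : g ≫ k'' = g'') :
    push (push φ k hf hg) k' hf' hg' = push φ k'' hf'' hg'' := by
  refine (compC_push (MCell.single φ) (unitMap k) k' h h (Chain.append_nil P) hf hg hf'' hg''
    hf' hg').symm.trans ?_
  exact compC_congr rfl (unitMap_unitMap k k' h)

theorem unitMap_id (A : C) : unitMap (𝟙 A) = cid (unit A) := by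
  apply unit_factor_ext (R := Chain.nil A) (S := Chain.nil A)
    (X := Chain.nil A) rfl (Category.id_comp (𝟙 A)) (Category.id_comp (𝟙 A))
  have e₁ : compC (MCell.single (unitCell A)) (cid (unit A)) (P := Chain.nil A) rfl
    (Category.id_comp (𝟙 A)) (Category.id_comp (𝟙 A)) = unitCell A := compC_cid _ _ _ _
  exact (unitMap_unit (𝟙 A)).trans ((nil_compC (unitCell A) rfl _ _).trans e₁.symm)

theorem push_id {A B E : C} {P : Chain (Loose (C := C)) A B} {f : A ⟶ E} {g : B ⟶ E}
    (φ : Cell P f g (unit E)) (hf : f ≫ 𝟙 E = f) (hg : g ≫ 𝟙 E = g) :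
    push φ (𝟙 E) hf hg = φ :=
  (compC_congr rfl (unitMap_id E)).trans (compC_cid φ _ _ _)

/-! ### Composition with sequences ending in identities -/

section Tails

variable {C : Type u} [Category.{v} C]

theorem MCell.cons_heq [VDCData.{w, x} C] {A B D A' B' D' : C} {P P₁ : Chain (Loose (C := C)) A B}
    {f f₁ : A ⟶ A'} {g g₁ : B ⟶ B'} {h h₁ : D ⟶ D'} {q : Loose A' B'}
    {Q Q₁ : Chain (Loose (C := C)) B' D'} {φ : Cell P f g q} {φ₁ : Cell P₁ f₁ g₁ q}
    {M : MCell g h Q} {M₁ : MCell g₁ h₁ Q₁} (hP : P = P₁) (hf : f = f₁) (hg : g = g₁)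
    (hh : h = h₁) (hQ : Q = Q₁) (hφ : HEq φ φ₁) (hM : HEq M M₁) :
    HEq (MCell.cons φ M) (MCell.cons φ₁ M₁) := by
  subst hP hf hg hh hQ; cases hφ; cases hM; rfl

theorem MCell.append_heq [VDCData.{w, x} C] {A B D A' B' D' : C} {f : A ⟶ A'} {g : B ⟶ B'}
    {h : D ⟶ D'} {P : Chain (Loose (C := C)) A' B'} {Q Q₁ : Chain (Loose (C := C)) B' D'}
    (M : MCell f g P) {N : MCell g h Q} {N₁ : MCell g h Q₁} (hQ : Q = Q₁) (hN : HEq N N₁) :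
    HEq (M.append N) (M.append N₁) := by
  subst hQ; cases hN; rfl

variable [VirtualDoubleCategory.{w, x} C]

theorem comp_heq_of_boundary {A B A' B' A'' B'' : C} {f f₁ : A ⟶ A'} {g g₁ : B ⟶ B'}
    {Q Q₁ : Chain (Loose (C := C)) A' B'} {f' : A' ⟶ A''} {g' : B' ⟶ B''}
    {f₁' : A' ⟶ A''} {g₁' : B' ⟶ B''}
    {r : Loose A'' B''} {M : MCell f g Q} {M₁ : MCell f₁ g₁ Q₁} {ψ : Cell Q f' g' r}
    {ψ₁ : Cell Q₁ f₁' g₁' r} (hf : f = f₁) (hg : g = g₁) (hQ : Q = Q₁) (hM : HEq M M₁)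
    (hf' : f' = f₁') (hg' : g' = g₁') (hψ : HEq ψ ψ₁) : HEq (comp M ψ) (comp M₁ ψ₁) := by
  subst hf hg hQ hf' hg'; cases hM; cases hψ; rfl

/-- The law `comp_assoc` requires a full lower storey. Completing it by identities below `N` makes
the law available when only the first few columns have something nontrivial below them. The
comparisons are heterogeneous because the boundaries of `T` agree with those of `N` only up to unit
laws. -/
theorem MCell₂.exists_over_idm {A B A' B' : C} {f : A ⟶ A'} {g : B ⟶ B'}
    {Q : Chain (Loose (C := C)) A' B'} (N : MCell f g Q) :
    ∃ T : MCell₂ f g (𝟙 A') (𝟙 B') Q, HEq T.columns N ∧ T.lower = MCell.idm Q ∧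
      HEq T.upper N := by
  induction N with
  | nil f =>
    refine ⟨MCell₂.nil f (𝟙 _), ?_, rfl, HEq.rfl⟩
    change HEq (MCell.nil (f ≫ 𝟙 _)) (MCell.nil f)
    rw [Category.comp_id]
  | cons φ M ih =>
    obtain ⟨T, h₁, h₂, h₃⟩ := ih
    refine ⟨MCell₂.cons (MCell.single φ) (cid _) T, ?_, ?_, ?_⟩
    · exact MCell.cons_heq (Chain.append_nil _) (Category.comp_id _) (Category.comp_id _)
        (Category.comp_id _) rfl (comp_cid φ) h₁
    · exact congrArg (MCell.cons (cid _)) h₂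
    · refine MCell.cons_heq rfl rfl rfl rfl ?_ HEq.rfl h₃
      rw [h₂, MCell.dom_idm]
      rfl

/-- Associativity of composition, for a sequence ending in identities. -/
theorem compC_cons_idm {A B D A' B' D' A'' A₃ D₃ : C} {f : A ⟶ A'} {g : B ⟶ B'} {k : D ⟶ D'}
    {f' : A' ⟶ A''} {f'' : A'' ⟶ A₃} {k'' : D' ⟶ D₃} {P : Chain (Loose (C := C)) A' B'}
    {Q : Chain (Loose (C := C)) B' D'} {p : Loose A'' B'} {r : Loose A₃ D₃} (M : MCell f g P)
    (ν : Cell P f' (𝟙 B') p) (N : MCell g k Q) (χ : Cell (Chain.cons p Q) f'' k'' r)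
    {X : Chain (Loose (C := C)) A B} {Y : Chain (Loose (C := C)) A D} {F : A ⟶ A''}
    {F₂ : A ⟶ A₃} {H₂ : D ⟶ D₃} {K : A' ⟶ A₃}
    (hM : M.dom = X) (hF : f ≫ f' = F) (hG : g ≫ 𝟙 B' = g)
    (hY : (MCell.cons (compC M ν hM hF hG) N).dom = Y) (hF₂ : F ≫ f'' = F₂) (hH₂ : k ≫ k'' = H₂)
    (h : (MCell.cons ν (MCell.idm Q)).dom = P.append Q) (hK : f' ≫ f'' = K)
    (hK' : 𝟙 D' ≫ k'' = k'') (h₁ : (M.append N).dom = Y) (h₂ : f ≫ K = F₂) :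
    compC (M.append N) (compC (MCell.cons ν (MCell.idm Q)) χ h hK hK') h₁ h₂ hH₂ =
      compC (MCell.cons (compC M ν hM hF hG) N) χ hY hF₂ hH₂ := by
  apply eq_of_heq
  refine (compC_heq ..).trans (HEq.trans ?_ (compC_heq ..).symm)
  subst hM hF hK
  obtain ⟨T, e₁, e₂, e₃⟩ := MCell₂.exists_over_idm N
  have e := comp_assoc (MCell₂.cons M ν T) χ
  have a₁ : HEq (comp (MCell₂.cons M ν T).columns χ)
      (comp (MCell.cons (compC M ν rfl rfl hG) N) χ) :=
    comp_heq_of_boundary rfl (Category.comp_id _) rfl (MCell.cons_heq rfl rfl (Category.comp_id _)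
      (Category.comp_id _) rfl (compC_heq ..).symm e₁) rfl rfl HEq.rfl
  refine HEq.trans (HEq.trans ?_ e.symm) a₁
  have e₂' : (MCell₂.cons M ν T).lower = MCell.cons ν (MCell.idm Q) := congrArg (MCell.cons ν) e₂
  refine comp_heq_of_boundary rfl rfl ?_ ?_ rfl hK'.symm ?_
  · rw [e₂', h]
  · change HEq _ (M.append T.upper)
    exact MCell.append_heq M (by rw [e₂, MCell.dom_idm]) e₃.symm
  · exact (compC_heq ..).trans (by rw [e₂'])

/-- Associativity of composition, for a sequence ending in identities. -/
theorem compC_cons_cons_idm {A B D G A' B' D' G' A'' B'' A₃ D₃ : C} {f : A ⟶ A'} {g : B ⟶ B'}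
    {m : G ⟶ G'} {k : D ⟶ D'}
    {f' : A' ⟶ A''} {g' : B' ⟶ B''} {f'' : A'' ⟶ A₃} {k'' : D' ⟶ D₃}
    {P : Chain (Loose (C := C)) A' B'} {P' : Chain (Loose (C := C)) B' G'}
    {Q : Chain (Loose (C := C)) G' D'} {p : Loose A'' B''} {p' : Loose B'' G'} {r : Loose A₃ D₃}
    (M : MCell f g P) (ν : Cell P f' g' p) (M' : MCell g m P') (ν' : Cell P' g' (𝟙 G') p')
    (N : MCell m k Q) (χ : Cell (Chain.cons p (Chain.cons p' Q)) f'' k'' r)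
    {X : Chain (Loose (C := C)) A B} {X' : Chain (Loose (C := C)) B G}
    {Y : Chain (Loose (C := C)) A D} {Z : Chain (Loose (C := C)) A' D'} {F : A ⟶ A''}
    {H : B ⟶ B''} {F₂ : A ⟶ A₃} {H₂ : D ⟶ D₃} {K : A' ⟶ A₃}
    (hM : M.dom = X) (hF : f ≫ f' = F) (hH : g ≫ g' = H) (hM' : M'.dom = X')
    (hG : m ≫ 𝟙 G' = m)
    (hY : (MCell.cons (compC M ν hM hF hH) (MCell.cons (compC M' ν' hM' hH hG) N)).dom = Y)
    (hF₂ : F ≫ f'' = F₂) (hH₂ : k ≫ k'' = H₂)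
    (h : (MCell.cons ν (MCell.cons ν' (MCell.idm Q))).dom = Z) (hK : f' ≫ f'' = K)
    (hK' : 𝟙 D' ≫ k'' = k'') (MM : MCell f k Z) (hMM : HEq MM (M.append (M'.append N)))
    (h₁ : MM.dom = Y) (h₂ : f ≫ K = F₂) :
    compC MM (compC (MCell.cons ν (MCell.cons ν' (MCell.idm Q))) χ h hK hK') h₁ h₂ hH₂ =
      compC (MCell.cons (compC M ν hM hF hH) (MCell.cons (compC M' ν' hM' hH hG) N)) χ
        hY hF₂ hH₂ := by
  apply eq_of_heq
  refine (compC_heq ..).trans (HEq.trans ?_ (compC_heq ..).symm)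
  subst hM hF hK hM' hH
  obtain ⟨T, e₁, e₂, e₃⟩ := MCell₂.exists_over_idm N
  have e := comp_assoc (MCell₂.cons M ν (MCell₂.cons M' ν' T)) χ
  have a₁ : HEq (comp (MCell₂.cons M ν (MCell₂.cons M' ν' T)).columns χ)
      (comp (MCell.cons (compC M ν rfl rfl rfl) (MCell.cons (compC M' ν' rfl rfl hG) N)) χ) :=
    comp_heq_of_boundary rfl (Category.comp_id _) rfl (MCell.cons_heq rfl rfl rfl
      (Category.comp_id _) rfl (compC_heq ..).symm (MCell.cons_heq rfl rfl (Category.comp_id _)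
      (Category.comp_id _) rfl (compC_heq ..).symm e₁)) rfl rfl HEq.rfl
  refine HEq.trans (HEq.trans ?_ e.symm) a₁
  have e₂' : (MCell₂.cons M ν (MCell₂.cons M' ν' T)).lower =
      MCell.cons ν (MCell.cons ν' (MCell.idm Q)) :=
    congrArg (fun y => MCell.cons ν (MCell.cons ν' y)) e₂
  refine comp_heq_of_boundary rfl rfl ?_ ?_ rfl hK'.symm ?_
  · rw [e₂', h]
  · refine hMM.trans ?_
    change HEq _ (M.append (M'.append T.upper))
    have hQ : Q = T.lower.dom := by rw [e₂, MCell.dom_idm]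
    exact MCell.append_heq M (by rw [← hQ]) (MCell.append_heq M' hQ e₃.symm)
  · exact (compC_heq ..).trans (by rw [e₂'])

end Tails

/-! ### Associativity of pasting and naturality -/

/-- Inserting the universal 2-cell in the middle of the three loose-identities cancels one
`unitComp` on each side, by `unitComp_right` and `unitComp_left` respectively, and leaves the same
pasting of two identities. -/
theorem unitComp_assoc (A : C) :
    paste (X := Chain.cons (unit A) (Chain.cons (unit A) (Chain.single (unit A)))) (unitComp A)
      (cid (unit A)) rfl = paste (cid (unit A)) (unitComp A) rfl := by
  apply unit_factor_ext (R := Chain.single (unit A)) (S := Chain.single (unit A))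
    (X := Chain.cons (unit A) (Chain.single (unit A))) rfl (Category.id_comp _)
    (Category.id_comp _)
  have e₁ : compC (MCell.single (cid (unit A))) (cid (unit A)) (P := Chain.single (unit A)) rfl
    (Category.id_comp (𝟙 A)) (Category.id_comp (𝟙 A)) = cid (unit A) := compC_cid _ _ _ _
  have h₁ := paste_comp (MCell.pair (cid (unit A)) (unitCell A)) (unitComp A)
    (MCell.single (cid (unit A))) (cid (unit A)) (X := Chain.single (unit A))
    (X' := Chain.single (unit A)) (Y := Chain.cons (unit A) (Chain.single (unit A))) rfl
    (Category.id_comp (𝟙 A)) (Category.id_comp (𝟙 A)) rfl (Category.id_comp (𝟙 A))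
    (Category.id_comp (𝟙 A)) rfl rfl
    (MCell.cons (cid (unit A)) (MCell.pair (unitCell A) (cid (unit A)))) HEq.rfl rfl
  have h₂ := paste_comp (MCell.single (cid (unit A))) (cid (unit A))
    (MCell.pair (unitCell A) (cid (unit A))) (unitComp A) (X := Chain.single (unit A))
    (X' := Chain.single (unit A)) (Y := Chain.cons (unit A) (Chain.single (unit A))) rfl
    (Category.id_comp (𝟙 A)) (Category.id_comp (𝟙 A)) rfl (Category.id_comp (𝟙 A))
    (Category.id_comp (𝟙 A)) rfl rfl
    (MCell.cons (cid (unit A)) (MCell.pair (unitCell A) (cid (unit A)))) HEq.rfl rfl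
  refine h₁.symm.trans (Eq.trans ?_ h₂)
  exact congrArg₂ (fun y z => paste y z rfl) ((unitComp_right A).trans e₁.symm)
    (e₁.trans (unitComp_left A).symm)

theorem paste_assoc {A B D G E : C} {P : Chain (Loose (C := C)) A B}
    {Q : Chain (Loose (C := C)) B D} {R : Chain (Loose (C := C)) D G} {f : A ⟶ E} {g : B ⟶ E}
    {h : D ⟶ E} {k : G ⟶ E} (φ : Cell P f g (unit E)) (ψ : Cell Q g h (unit E))
    (χ : Cell R h k (unit E)) {X : Chain (Loose (C := C)) A D} {Y : Chain (Loose (C := C)) B G}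
    {Z : Chain (Loose (C := C)) A G} (hX : P.append Q = X) (hY : Q.append R = Y)
    (hZ : X.append R = Z) (hZ' : P.append Y = Z) :
    paste (paste φ ψ hX) χ hZ = paste φ (paste ψ χ hY) hZ' := by
  have e : ∀ {A B : C} {P : Chain (Loose (C := C)) A B} {f : A ⟶ E} {g : B ⟶ E}
    (φ : Cell P f g (unit E)), compC (MCell.single φ) (cid (unit E)) (Chain.append_nil P)
      (Category.comp_id f) (Category.comp_id g) = φ := fun _ => compC_cid _ _ _ _
  have hd : (MCell.cons φ (MCell.pair ψ χ)).dom = Z := by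
    subst hX hY hZ; simp
  have h₁ := paste_comp (MCell.pair φ ψ) (unitComp E) (MCell.single χ) (cid (unit E))
    (X := X) (by simp [hX]) (Category.comp_id f) (Category.comp_id h) (Chain.append_nil R)
    (Category.comp_id h) (Category.comp_id k) hZ rfl (MCell.cons φ (MCell.pair ψ χ)) HEq.rfl hd
  have h₂ := paste_comp (MCell.single φ) (cid (unit E)) (MCell.pair ψ χ) (unitComp E)
    (X' := Y) (Chain.append_nil P) (Category.comp_id f) (Category.comp_id g) (by simp [hY])
    (Category.comp_id g) (Category.comp_id k) hZ' rfl (MCell.cons φ (MCell.pair ψ χ)) HEq.rfl hd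
  rw [e] at h₁ h₂
  refine h₁.trans (Eq.trans ?_ h₂.symm)
  exact congrArg (fun y => compC _ y hd _ _) (unitComp_assoc E)

theorem res_idUnit {A B E : C} (a : B ⟶ E) (k : A ⟶ B) {a' : A ⟶ E} (ha : k ≫ a = a') :
    res (idUnit a) k ha ha = idUnit a' :=
  compC_nil_nil k a (unitCell E) ha (Category.comp_id a) (Category.comp_id a) ha ha
    (Category.comp_id a') (Category.comp_id a')

theorem res_id {B E : C} {a b : B ⟶ E} (θ : Cell (Chain.nil B) a b (unit E))
    (ha : 𝟙 B ≫ a = a) (hb : 𝟙 B ≫ b = b) : res θ (𝟙 B) ha hb = θ := nil_compC θ _ _ _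

theorem res_paste {A B E : C} {a b c : B ⟶ E} (θ : Cell (Chain.nil B) a b (unit E))
    (θ' : Cell (Chain.nil B) b c (unit E)) (k : A ⟶ B) {a' b' c' : A ⟶ E} (ha : k ≫ a = a')
    (hb : k ≫ b = b') (hc : k ≫ c = c') :
    res (paste θ θ' rfl) k ha hc = paste (res θ k ha hb) (res θ' k hb hc) rfl :=
  (paste_comp (MCell.nil k) θ (MCell.nil k) θ' rfl ha hb rfl hb hc rfl rfl (MCell.nil k)
    HEq.rfl rfl).symm

/-- Naturality of a 2-cell between parallel tight-cells. -/
theorem paste_res {A B D E : C} {a b : D ⟶ E} (θ : Cell (Chain.nil D) a b (unit E))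
    {P : Chain (Loose (C := C)) A B} {f : A ⟶ D} {g : B ⟶ D} (φ : Cell P f g (unit D))
    {fa fb : A ⟶ E} {ga gb : B ⟶ E} (hfa : f ≫ a = fa) (hfb : f ≫ b = fb) (hga : g ≫ a = ga)
    (hgb : g ≫ b = gb) (h : P.append (Chain.nil B) = P) :
    paste (push φ a hfa hga) (res θ g hga hgb) h =
      paste (res θ f hfa hfb) (push φ b hfb hgb) (Chain.nil_append P) := by
  -- The generic case, where `φ` is the identity of the loose-identity of `D`; inserting `unitCell
  -- D` reduces both sides to `θ`.
  have base : paste (unitMap a) θ (X := Chain.single (unit D)) rfl =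
      paste θ (unitMap b) rfl := by
    apply unit_factor_ext (R := Chain.nil D) (S := Chain.nil D) (X := Chain.nil D) rfl
      (Category.id_comp a) (Category.id_comp b)
    have h₁ := paste_comp (MCell.single (unitCell D)) (unitMap a) (MCell.nil (𝟙 D)) θ
      (X := Chain.nil D) (X' := Chain.nil D) (Y := Chain.nil D) rfl
      (Category.id_comp a) (Category.id_comp a) rfl (Category.id_comp a) (Category.id_comp b) rfl
      rfl (MCell.single (unitCell D)) HEq.rfl rfl
    have h₂ := paste_comp (MCell.nil (𝟙 D)) θ (MCell.single (unitCell D)) (unitMap b)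
      (X := Chain.nil D) (X' := Chain.nil D) (Y := Chain.nil D) rfl
      (Category.id_comp a) (Category.id_comp b) rfl (Category.id_comp b) (Category.id_comp b) rfl
      rfl (MCell.single (unitCell D)) HEq.rfl rfl
    have e : compC (MCell.nil (𝟙 D)) θ rfl (Category.id_comp a) (Category.id_comp b) = θ :=
      nil_compC θ _ _ _
    refine h₁.symm.trans (Eq.trans ?_ h₂)
    refine (congrArg₂ (fun y z => paste y z rfl) (unitMap_unit a) e).trans
      (Eq.trans ?_ (congrArg₂ (fun y z => paste y z rfl) e (unitMap_unit b)).symm)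
    exact (idUnit_paste θ rfl).trans (paste_idUnit θ rfl).symm
  have h₁ := paste_comp (MCell.single φ) (unitMap a) (MCell.nil g) θ h hfa hga rfl hga hgb h rfl
    (MCell.single φ) HEq.rfl h
  have h₂ := paste_comp (MCell.nil f) θ (MCell.single φ) (unitMap b) rfl hfa hfb h hfb hgb rfl rfl
    (MCell.single φ) HEq.rfl h
  exact h₁.trans ((compC_congr (hP := h) (M := MCell.single φ) rfl base).trans h₂.symm)

theorem paste_act_res {A B X Y E F : C} {f : X ⟶ E} {g : Y ⟶ E} {f' : X ⟶ F} {g' g'' : Y ⟶ F}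
    (a : Cell (Chain.single (hom f g)) f' g' (unit F))
    {P : Chain (Loose (C := C)) A B} {h : A ⟶ X} {k : B ⟶ Y} {m : A ⟶ E} {n : B ⟶ E}
    {m' : A ⟶ F} {n' n'' : B ⟶ F} (φ : Cell P m n (unit E)) (hm : h ≫ f = m) (hn : k ≫ g = n)
    (hm' : h ≫ f' = m') (hn' : k ≫ g' = n') (hn'' : k ≫ g'' = n'')
    (θ : Cell (Chain.nil Y) g' g'' (unit F)) (hP : P.append (Chain.nil B) = P) :
    paste (act a φ hm hn hm' hn') (res θ k hn' hn'') hP =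
      act (paste a θ rfl) φ hm hn hm' hn'' :=
  paste_act a φ hm hn hm' hn' (MCell.nil k) θ rfl hn'' hP hP

theorem compC_idm_paste {A B D D' E : C} {P : Chain (Loose (C := C)) A B} {f : A ⟶ E}
    {g : B ⟶ E} {h : D ⟶ E} {h' : D' ⟶ E} {k : D' ⟶ D} {Q : Chain (Loose (C := C)) B D}
    (φ : Cell P f g (unit E)) (N : MCell (𝟙 B) k Q) (ψ : Cell Q g h (unit E))
    {Q' : Chain (Loose (C := C)) B D'} {X : Chain (Loose (C := C)) A D}
    {X' : Chain (Loose (C := C)) A D'} (hN : N.dom = Q') (hh : k ≫ h = h')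
    (hX : P.append Q = X) (hX' : P.append Q' = X') (MN : MCell (𝟙 A) k X)
    (hMN : HEq MN ((MCell.idm P).append N)) (hd : MN.dom = X') :
    compC MN (paste φ ψ hX) hd (Category.id_comp f) hh =
      paste φ (compC N ψ hN (Category.id_comp g) hh) hX' := by
  have e : compC (MCell.idm P) φ (MCell.dom_idm P) (Category.id_comp f) (Category.id_comp g) = φ :=
    idm_compC _ _ _ _
  have h₁ := paste_comp (MCell.idm P) φ N ψ (MCell.dom_idm P) (Category.id_comp f)
    (Category.id_comp g) hN (Category.id_comp g) hh hX' hX MN hMN hd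
  rw [e] at h₁
  exact h₁.symm

theorem toUnit_vcomp_eq_act {A B E F : C} {P : Chain (Loose (C := C)) A B} {f : A ⟶ E} {g : B ⟶ E}
    {f' : A ⟶ F} {g' : B ⟶ F} (φ : HomCell P f g) (χ : HomCell (Chain.single (hom f g)) f' g') :
    toUnit (vcomp φ χ) = act (toUnit χ) (toUnit φ) (Category.id_comp f) (Category.id_comp g)
      (Category.id_comp f') (Category.id_comp g') := by
  refine (toUnit_vcomp φ χ).trans ?_
  refine compC_congr (congrArg MCell.single ?_) rfl
  exact (lift_ext (Category.id_comp f) (Category.id_comp g) (lift_comp _ _ _)).symm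

/-! ### Colimits in terms of 2-cells into loose-identities -/

/-- The unit `() ⇒ B(f, 1)` of the companion of a tight-cell, with tight boundaries `1, f`. -/
noncomputable def companionUnit {A B : C} (f : A ⟶ B) :
    Cell (Chain.nil A) (𝟙 A) f (hom f (𝟙 B)) :=
  lift (idUnit f) (Category.id_comp f) (Category.comp_id f)

/-- The unit `() ⇒ B(1, f)` of the conjoint of a tight-cell, with tight boundaries `f, 1`. -/
noncomputable def conjointUnit {A B : C} (f : A ⟶ B) :
    Cell (Chain.nil A) f (𝟙 A) (hom (𝟙 B) f) :=
  lift (idUnit f) (Category.comp_id f) (Category.id_comp f)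

/-- The universal property of a weighted colimit, for 2-cells with tight boundaries into
loose-identities. -/
def IsColimitCell {Z Y W : C} {p : Loose Z Y} {f : Z ⟶ W} {c : Y ⟶ W}
    (l : Cell (Chain.single p) f c (unit W)) : Prop :=
  ∀ ⦃B : C⦄ (Q : Chain (Loose (C := C)) Y B) (g : B ⟶ W), Function.Bijective
    (fun ψ : Cell Q c g (unit W) => (paste l ψ rfl : Cell (Chain.cons p Q) f g (unit W)))

theorem isColimit_iff_bijective {Z Y W : C} {p : Loose Z Y} {f : Z ⟶ W} {c : Y ⟶ W}
    (l : HomCell (Chain.single p) f c) :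
    IsColimit p f c l ↔ ∀ Q : Chain (Loose (C := C)) Y W, Function.Bijective
      (fun ψ : Cell Q c (𝟙 W) (unit W) =>
        (paste (toUnit l) ψ rfl : Cell (Chain.cons p Q) f (𝟙 W) (unit W))) := by
  refine forall_congr' fun Q => ?_
  have hb : ∀ {A B E : C} (P : Chain (Loose (C := C)) A B) (f : A ⟶ E) (g : B ⟶ E),
      Function.Bijective (toUnit : HomCell P f g → Cell P f g (unit E)) := fun P f g =>
    ⟨fun _ _ h => toUnit_injective h, fun y => ⟨ofUnit y, toUnit_ofUnit y⟩⟩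
  have e : (toUnit (f := f) (g := 𝟙 W)) ∘ (fun ψ : HomCell Q c (𝟙 W) =>
      (hcomp l ψ : HomCell (Chain.cons p Q) f (𝟙 W))) =
      (fun ψ : Cell Q c (𝟙 W) (unit W) =>
        (paste (toUnit l) ψ rfl : Cell (Chain.cons p Q) f (𝟙 W) (unit W))) ∘ toUnit :=
    funext fun ψ => toUnit_hcomp l ψ
  exact (Function.Bijective.of_comp_iff' (hb (Chain.cons p Q) f (𝟙 W)) _).symm.trans
    ((iff_of_eq (congrArg Function.Bijective e)).trans
      (Function.Bijective.of_comp_iff _ (hb Q c (𝟙 W))))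

/-- A triangle law for the companion W(g, 1), with unit `companionUnit g` and counit `homCell g (𝟙
W)`: a 2-cell with right boundary `g` is recovered from the one with right boundary the identity
obtained by appending W(g, 1) to its domain. -/
theorem compC_companionUnit {A B W : C} {Q : Chain (Loose (C := C)) A B} {c : A ⟶ W} {g : B ⟶ W}
    (ψ : Cell Q c g (unit W)) (M : MCell (𝟙 A) g (Q.append (Chain.single (hom g (𝟙 W)))))
    (hM : M = (MCell.idm Q).append (MCell.single (companionUnit g)))
    (hd : M.dom = Q) :
    compC M (paste ψ (homCell g (𝟙 W)) rfl) hd (Category.id_comp c) (Category.comp_id g) = ψ := by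
  subst hM
  refine (compC_idm_paste ψ (MCell.single (companionUnit g)) (homCell g (𝟙 W))
    (Q' := Chain.nil B) rfl (Category.comp_id g) rfl (Chain.append_nil Q) _ HEq.rfl hd).trans ?_
  refine (congrArg (fun y => paste ψ y (Chain.append_nil Q)) (lift_comp _ _ _)).trans ?_
  exact paste_idUnit ψ _

/-- The definition tests only 2-cells whose right boundary is the identity. A general right boundary
`g` is reached by appending the companion W(g, 1) to the chain, and `companionUnit g` undoes this.
-/
theorem isColimit_iff {Z Y W : C} {p : Loose Z Y} {f : Z ⟶ W} {c : Y ⟶ W}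
    (l : HomCell (Chain.single p) f c) : IsColimit p f c l ↔ IsColimitCell (toUnit l) := by
  rw [isColimit_iff_bijective]
  refine ⟨fun H B Q g => ⟨fun ψ ψ' h => ?_, fun χ => ?_⟩, fun H Q => H Q (𝟙 W)⟩
  · have h₁ : ∀ ψ : Cell Q c g (unit W),
        paste (toUnit l) (paste ψ (homCell g (𝟙 W)) rfl) rfl =
          paste (paste (toUnit l) ψ rfl) (homCell g (𝟙 W)) rfl := fun ψ =>
      (paste_assoc (toUnit l) ψ (homCell g (𝟙 W)) rfl rfl rfl rfl).symm
    have h₂ := (H _).1 ((h₁ ψ).trans ((congrArg (fun y => paste y (homCell g (𝟙 W)) rfl) h).trans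
      (h₁ ψ').symm))
    have hd : ((MCell.idm Q).append (MCell.single (companionUnit g))).dom = Q := by simp
    exact (compC_companionUnit ψ _ rfl hd).symm.trans
      ((congrArg (fun y => compC _ y hd _ _) h₂).trans (compC_companionUnit ψ' _ rfl hd))
  · obtain ⟨ω, hω⟩ := (H (Q.append (Chain.single (hom g (𝟙 W))))).2
      (paste χ (homCell g (𝟙 W)) rfl)
    have hω' : paste (toUnit l) ω rfl = paste χ (homCell g (𝟙 W)) rfl := hω
    have hd : ((MCell.idm Q).append (MCell.single (companionUnit g))).dom = Q := by simp
    have hd' : ((MCell.idm (Chain.cons p Q)).append (MCell.single (companionUnit g))).dom =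
        Chain.cons p Q := congrArg (Chain.cons p) hd
    refine ⟨compC ((MCell.idm Q).append (MCell.single (companionUnit g))) ω hd
      (Category.id_comp c) (Category.comp_id g), ?_⟩
    have h₁ := compC_idm_paste (toUnit l)
      ((MCell.idm Q).append (MCell.single (companionUnit g))) ω hd (Category.comp_id g) rfl rfl
      ((MCell.idm (Chain.cons p Q)).append (MCell.single (companionUnit g))) HEq.rfl hd'
    refine h₁.symm.trans ((congrArg (fun y => compC _ y hd' _ _) hω').trans ?_)
    exact compC_companionUnit χ _ rfl hd'

/-- Density makes every `f` the E(j, f)-weighted colimit of `j`, the definition being the case of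
the identity. The general case is reached by putting the conjoint E(1, f) in front of `Q`: the
2-cell `a` from E(j, 1), E(1, f) to E(j, f) passes from one domain to the other, and the unit of the
conjoint passes back. -/
theorem IsDense.bijective {A E Z B : C} {j : A ⟶ E} (hj : IsDense j) (f : Z ⟶ E)
    (Q : Chain (Loose (C := C)) Z B) (g : B ⟶ E) : Function.Bijective
      (fun ψ : Cell Q f g (unit E) =>
        (paste (homCell j f) ψ rfl : Cell (Chain.cons (hom j f) Q) j g (unit E))) := by
  have H := (isColimit_iff _).1 hj
  rw [toUnit_cid] at H
  set a : Cell (Chain.cons (hom j (𝟙 E)) (Chain.single (hom (𝟙 E) f))) (𝟙 A) (𝟙 Z) (hom j f) :=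
    lift (paste (homCell j (𝟙 E)) (homCell (𝟙 E) f) rfl) (Category.id_comp j) (Category.id_comp f)
    with ha
  have hd : (MCell.cons (conjointUnit f) (MCell.idm Q)).dom = Q := by simp
  have hb : ∀ ψ : Cell Q f g (unit E), compC (MCell.cons (conjointUnit f) (MCell.idm Q))
      (paste (homCell (𝟙 E) f) ψ rfl) hd (Category.comp_id f) (Category.id_comp g) = ψ := by
    intro ψ
    have h₁ := paste_comp (MCell.single (conjointUnit f)) (homCell (𝟙 E) f) (MCell.idm Q) ψ
      (X := Chain.nil Z) (X' := Q) rfl (Category.comp_id f) (Category.id_comp f) (by simp)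
      (Category.id_comp f) (Category.id_comp g) rfl rfl
      (MCell.cons (conjointUnit f) (MCell.idm Q)) HEq.rfl hd
    refine h₁.symm.trans ?_
    refine (congrArg₂ (fun y z => paste y z rfl) (lift_comp _ _ _) (idm_compC ψ _ _ _)).trans ?_
    exact idUnit_paste ψ rfl
  have hda : (MCell.cons a (MCell.idm Q)).dom =
      (Chain.cons (hom j (𝟙 E)) (Chain.single (hom (𝟙 E) f))).append Q := by simp
  have hc : ∀ ψ : Cell Q f g (unit E), compC (MCell.cons a (MCell.idm Q))
      (paste (homCell j f) ψ rfl) hda (Category.id_comp j) (Category.id_comp g) =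
      paste (homCell j (𝟙 E)) (paste (homCell (𝟙 E) f) ψ rfl) rfl := by
    intro ψ
    have h₁ := paste_comp (MCell.single a) (homCell j f) (MCell.idm Q) ψ
      (X := Chain.cons (hom j (𝟙 E)) (Chain.single (hom (𝟙 E) f))) (X' := Q)
      rfl (Category.id_comp j) (Category.id_comp f) (by simp)
      (Category.id_comp f) (Category.id_comp g) rfl rfl
      (MCell.cons a (MCell.idm Q)) HEq.rfl hda
    refine h₁.symm.trans ?_
    refine (congrArg₂ (fun y z => paste y z rfl) (lift_comp _ _ _) (idm_compC ψ _ _ _)).trans ?_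
    exact paste_assoc _ _ _ rfl rfl rfl rfl
  refine ⟨fun ψ ψ' h => ?_, fun χ => ?_⟩
  · have h₁ := (hc ψ).symm.trans ((congrArg (fun y => compC (MCell.cons a (MCell.idm Q)) y hda
      (Category.id_comp j) (Category.id_comp g)) h).trans (hc ψ'))
    have h₂ := (H _ _).1 h₁
    exact (hb ψ).symm.trans ((congrArg (fun y => compC _ y hd _ _) h₂).trans (hb ψ'))
  · obtain ⟨ω, hω⟩ := (H _ _).2 (compC (MCell.cons a (MCell.idm Q)) χ hda
      (Category.id_comp j) (Category.id_comp g))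
    have hω' : paste (homCell j (𝟙 E)) ω rfl = _ := hω
    refine ⟨compC (MCell.cons (conjointUnit f) (MCell.idm Q)) ω hd (Category.comp_id f)
      (Category.id_comp g), ?_⟩
    -- The sequence `b`, `conjointUnit f` is a section of `a`, that is, `a` after it is the identity
    -- of E(j, f). Hence `χ` survives the passage to the longer chain and back.
    set b : Cell (Chain.single (hom j f)) (𝟙 A) f (hom j (𝟙 E)) :=
      lift (homCell j f) (Category.id_comp j) (Category.comp_id f)
    have hdb : (MCell.cons b (MCell.cons (conjointUnit f) (MCell.idm Q))).dom =
      Chain.cons (hom j f) Q := by simp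
    have h₁ := paste_comp (MCell.single b) (homCell j (𝟙 E))
      (MCell.cons (conjointUnit f) (MCell.idm Q)) ω (X := Chain.single (hom j f)) rfl
      (Category.id_comp j) (Category.comp_id f) hd (Category.comp_id f) (Category.id_comp g) rfl
      rfl (MCell.cons b (MCell.cons (conjointUnit f) (MCell.idm Q))) HEq.rfl hdb
    refine (congrArg (fun y => paste y (compC _ ω hd (Category.comp_id f) (Category.id_comp g))
      rfl) (lift_comp (homCell j f) (Category.id_comp j) (Category.comp_id f))).symm.trans ?_
    refine h₁.trans ((congrArg (fun y => compC _ y hdb _ _) hω').trans ?_)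
    have h₂ := compC_cons_idm (MCell.pair b (conjointUnit f)) a (MCell.idm Q) χ
      (X := Chain.single (hom j f)) (Y := Chain.cons (hom j f) Q) (H₂ := g) rfl
      (Category.id_comp (𝟙 A)) (Category.id_comp (𝟙 Z)) (by simp) (Category.id_comp j)
      (Category.id_comp g) hda (Category.id_comp j) (Category.id_comp g) hdb
      (Category.id_comp j)
    refine h₂.trans ?_
    have h₃ : compC (MCell.pair b (conjointUnit f)) a (P := Chain.single (hom j f)) rfl
        (Category.id_comp (𝟙 A)) (Category.id_comp (𝟙 Z)) = cid (hom j f) := by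
      refine (compC_lift _ _ _ _ rfl (Category.id_comp (𝟙 A)) (Category.id_comp (𝟙 Z))
        (Category.id_comp j) (Category.id_comp f) (Category.id_comp j)
        (Category.id_comp f)).trans ?_
      refine Eq.trans ?_ (lift_homCell j f)
      refine congrArg (fun y => lift y (Category.id_comp j) (Category.id_comp f)) ?_
      have h₄ := paste_comp (MCell.single b) (homCell j (𝟙 E)) (MCell.single (conjointUnit f))
        (homCell (𝟙 E) f) (X := Chain.single (hom j f)) (X' := Chain.nil Z) rfl
        (Category.id_comp j) (Category.comp_id f) rfl (Category.comp_id f) (Category.id_comp f)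
        rfl rfl (MCell.pair b (conjointUnit f)) HEq.rfl rfl
      refine h₄.symm.trans ?_
      refine (congrArg₂ (fun y z => paste y z rfl) (lift_comp _ _ _) (lift_comp _ _ _)).trans ?_
      exact paste_idUnit _ rfl
    exact (compC_congr (congrArg (fun y => MCell.cons y (MCell.idm Q)) h₃) rfl).trans
      (idm_compC (P := Chain.cons (hom j f) Q) χ (by simp) _ _)

/-! ### Absolute extensions along a tight-cell of a relative right adjoint -/

/-- Precomposition of an action with a 2-cell between tight-cells. -/
theorem paste_act_left {A B Y E F : C} {f : A ⟶ E} {g : Y ⟶ E} {f' f'' : A ⟶ F}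
    {g' : Y ⟶ F} (θ : Cell (Chain.nil A) f'' f' (unit F))
    (a : Cell (Chain.single (hom f g)) f' g' (unit F))
    {P : Chain (Loose (C := C)) A B} {k : B ⟶ Y} {n : B ⟶ E}
    {n' : B ⟶ F} (φ : Cell P f n (unit E)) (hn : k ≫ g = n) (hn' : k ≫ g' = n') :
    paste θ (act a φ (Category.id_comp f) hn (Category.id_comp f') hn') (Chain.nil_append P) =
      act (paste θ a rfl) φ (Category.id_comp f) hn (Category.id_comp f'') hn' :=
  (compC_idm_paste θ (MCell.single (lift φ (Category.id_comp f) hn)) a (Chain.append_nil P) hn'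
    rfl rfl (MCell.single (lift φ (Category.id_comp f) hn)) HEq.rfl (Chain.append_nil P)).symm

theorem paste_act_act {A B D X Y Z E F G : C} {f : X ⟶ E} {g : Y ⟶ E} {f' : X ⟶ F} {g' : Y ⟶ F}
    {f₁ : Y ⟶ G} {g₁ : Z ⟶ G} {g₁' : Z ⟶ F}
    (a : Cell (Chain.single (hom f g)) f' g' (unit F))
    (b : Cell (Chain.single (hom f₁ g₁)) g' g₁' (unit F))
    {P : Chain (Loose (C := C)) A B} {Q : Chain (Loose (C := C)) B D}
    {h : A ⟶ X} {k : B ⟶ Y} {z : D ⟶ Z} {m : A ⟶ E} {n : B ⟶ E} {m₁ : B ⟶ G} {n₁ : D ⟶ G}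
    {m' : A ⟶ F} {n' : B ⟶ F} {o' : D ⟶ F}
    (φ : Cell P m n (unit E)) (ψ : Cell Q m₁ n₁ (unit G)) (hm : h ≫ f = m) (hn : k ≫ g = n)
    (hm' : h ≫ f' = m') (hn' : k ≫ g' = n') (hm₁ : k ≫ f₁ = m₁) (hn₁ : z ≫ g₁ = n₁)
    (ho : z ≫ g₁' = o') (hd : (MCell.pair (lift φ hm hn) (lift ψ hm₁ hn₁)).dom = P.append Q) :
    paste (act a φ hm hn hm' hn') (act b ψ hm₁ hn₁ hn' ho) rfl =
      compC (MCell.pair (lift φ hm hn) (lift ψ hm₁ hn₁)) (paste a b rfl) hd hm' ho :=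
  paste_act a φ hm hn hm' hn' (MCell.single (lift ψ hm₁ hn₁)) b (Chain.append_nil Q) ho rfl hd

namespace RelAdjunction

variable {A B D E : C} {j : A ⟶ E} {ℓ : A ⟶ D} {r : D ⟶ E} (adj : RelAdjunction j ℓ r)

theorem toLeft_homCell : adj.toLeft (homCell j r) (Category.id_comp r) = toUnit adj.flat :=
  act_homCell _

theorem toUnit_η : toUnit adj.η = adj.toRight (idUnit ℓ) rfl := toUnit_ofUnit _

theorem toLeft_η : adj.toLeft (toUnit adj.η) rfl = idUnit ℓ := by
  rw [toUnit_η, toLeft_toRight]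

/-- Transposition is determined by the unit: write `φ` as the identity of ℓ pasted with `φ`, and let
`toRight_paste` transpose the first factor and apply r to the second. -/
theorem paste_η_push {P : Chain (Loose (C := C)) A B} {k : B ⟶ D} {m : B ⟶ E}
    (φ : Cell P ℓ k (unit D)) (hm : k ≫ r = m) :
    paste (toUnit adj.η) (push φ r rfl hm) (Chain.nil_append P) = adj.toRight φ hm := by
  rw [toUnit_η]
  refine (adj.toRight_paste (idUnit ℓ) φ rfl hm).symm.trans ?_
  exact congrArg (fun y => adj.toRight y hm) (idUnit_paste φ rfl)

theorem paste_η_push_toLeft {P : Chain (Loose (C := C)) A B} {k : B ⟶ D} {m : B ⟶ E}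
    (φ : Cell P j m (unit E)) (hm : k ≫ r = m) :
    paste (toUnit adj.η) (push (adj.toLeft φ hm) r rfl hm) (Chain.nil_append P) = φ :=
  (adj.paste_η_push _ hm).trans (adj.toRight_toLeft φ hm)

/-- A 2-cell `l : D'(c, 1) ⇒ E(r, e)` corresponds to a 2-cell `D'(ℓ ≫ c, 1) ⇒ E(j, e)`.
The 2-cell `μ` is inverse to it. -/
structure IsTransposeInverse {D' : C} (c : D ⟶ D') {e : D' ⟶ E}
    (l : Cell (Chain.single (hom c (𝟙 D'))) r e (unit E))
    (μ : Cell (Chain.single (hom j e)) (ℓ ≫ c) (𝟙 D') (unit D')) : Prop where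
  paste_η_act : paste (toUnit adj.η) (act l μ rfl (Category.id_comp (𝟙 D')) rfl
    (Category.id_comp e)) rfl = homCell j e
  act_paste : act μ (paste (homCell j r) l rfl) (Category.id_comp j) (Category.id_comp e)
    (Category.id_comp (ℓ ≫ c)) (Category.id_comp (𝟙 D')) =
      paste (push (toUnit adj.flat) c rfl (Category.id_comp c)) (homCell c (𝟙 D')) rfl

namespace IsTransposeInverse

variable {adj} {D' : C} {c : D ⟶ D'} {e : D' ⟶ E}
  {l : Cell (Chain.single (hom c (𝟙 D'))) r e (unit E)}
  {μ : Cell (Chain.single (hom j e)) (ℓ ≫ c) (𝟙 D') (unit D')}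

theorem act_act_eq {P : Chain (Loose (C := C)) A B} {k : B ⟶ D'}
    {m : B ⟶ E} (φ : Cell P j m (unit E)) (hm : k ≫ e = m) :
    act (act l μ rfl (Category.id_comp (𝟙 D')) rfl (Category.id_comp e)) φ (Category.id_comp j) hm
      (Category.id_comp (ℓ ≫ r)) hm =
    act l (act μ φ (Category.id_comp j) hm (Category.id_comp (ℓ ≫ c)) (Category.comp_id k)) rfl
      (Category.comp_id k) rfl hm :=
  (act_act l μ φ (Category.id_comp j) hm (Category.id_comp (ℓ ≫ c)) (Category.comp_id k) rfl
    (Category.id_comp (𝟙 D')) rfl (Category.id_comp e) (Category.id_comp ℓ) (Category.comp_id k)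
    rfl (Category.comp_id k) rfl hm (Category.id_comp (ℓ ≫ r)) hm).symm

theorem paste_η_act_act (H : adj.IsTransposeInverse c l μ) {P : Chain (Loose (C := C)) A B}
    {k : B ⟶ D'} {m : B ⟶ E} (φ : Cell P j m (unit E)) (hm : k ≫ e = m) :
    paste (toUnit adj.η) (act l (act μ φ (Category.id_comp j) hm (Category.id_comp (ℓ ≫ c))
      (Category.comp_id k)) rfl (Category.comp_id k) rfl hm) (Chain.nil_append P) = φ := by
  rw [← act_act_eq φ hm]
  refine (paste_act_left (toUnit adj.η) _ φ hm hm).trans ?_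
  exact (congrArg (fun y => act y φ _ _ _ _) H.paste_η_act).trans (act_eq_self φ _ _)

/-- The field `act_paste` is this equation for the two generic 2-cells of E(j, r) and D'(c, 1). Any
`φ` and `ψ` factor through these, and both sides are compatible with the factorizations. -/
theorem act_paste_act (H : adj.IsTransposeInverse c l μ) {B' : C} {P : Chain (Loose (C := C)) A B}
    {Q : Chain (Loose (C := C)) B B'} {k : B ⟶ D} {k' : B' ⟶ D'} {m : B ⟶ E} {m' : B ⟶ D'}
    {n : B' ⟶ E}
    (φ : Cell P j m (unit E)) (ψ : Cell Q m' k' (unit D')) (hm : k ≫ r = m) (hm' : k ≫ c = m')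
    (hn : k' ≫ e = n) :
    act μ (paste φ (act l ψ hm' (Category.comp_id k') hm hn) rfl) (Category.id_comp j) hn
      (Category.id_comp (ℓ ≫ c)) (Category.comp_id k') =
    paste (push (adj.toLeft φ hm) c rfl hm') ψ rfl := by
  have hd : (MCell.pair (lift φ (Category.id_comp j) hm)
    (lift ψ hm' (Category.comp_id k'))).dom = P.append Q := by simp
  have h₁ := paste_act_act (homCell j r) l φ ψ (Category.id_comp j) hm (Category.id_comp j) hm hm'
    (Category.comp_id k') hn hd
  rw [act_eq_self] at h₁
  have h₂ := paste_act_act (push (toUnit adj.flat) c rfl (Category.id_comp c)) (homCell c (𝟙 D'))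
    φ ψ (Category.id_comp j) hm (Category.id_comp (ℓ ≫ c)) hm' hm'
    (Category.comp_id k') (Category.comp_id k') hd
  rw [act_eq_self] at h₂
  have h₃ : push (adj.toLeft φ hm) c rfl hm' = act (push (toUnit adj.flat) c rfl
      (Category.id_comp c)) φ (Category.id_comp j) hm (Category.id_comp (ℓ ≫ c)) hm' :=
    push_act (toUnit adj.flat) φ _ _ _ _ c _ _ _ _ _ _
  rw [h₁, h₃]
  refine Eq.trans ?_ h₂.symm
  refine Eq.trans ?_ (congrArg (fun y => compC _ y hd (Category.id_comp _)
    (Category.comp_id k')) H.act_paste)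
  exact (compC_act _ μ _ (Category.id_comp j) (Category.id_comp e)
    (Category.id_comp (ℓ ≫ c)) (Category.id_comp (𝟙 D')) hd (Category.id_comp (𝟙 A))
    (Category.comp_id k') (Category.id_comp j) hn (Category.id_comp (ℓ ≫ c))
    (Category.comp_id k') (Category.id_comp j) hn (Category.id_comp (ℓ ≫ c))
    (Category.comp_id k')).symm

end IsTransposeInverse

/-- The action `E(j, r), D(1, 1) ⇒ E(j, r)` and the action `D(1, 1), D'(c, 1) ⇒ D'(c, 1)`
agree after composition with any 2-cell. -/
theorem interchange {X Y Z B : C} {E F : C} {f : X ⟶ E} {g : Y ⟶ E} {f' : Y ⟶ F} {g' : Z ⟶ F}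
    (S : Chain (Loose (C := C)) Z B) {G H : C} {m : X ⟶ G} {n : B ⟶ H} {q : Loose G H}
    (ψ : Cell (Chain.cons (hom f g) (Chain.cons (hom f' g') S)) m n q)
    (a : Cell (Chain.cons (hom f g) (Chain.single (unit Y))) (𝟙 X) (𝟙 Y) (hom f g))
    (ha : a = lift (paste (homCell f g) (unitMap g) rfl) (Category.id_comp f)
      (Category.id_comp g))
    (b : Cell (Chain.cons (unit Y) (Chain.single (hom f' g'))) (𝟙 Y) (𝟙 Z) (hom f' g'))
    (hb : b = lift (paste (unitMap f') (homCell f' g') rfl) (Category.id_comp f')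
      (Category.id_comp g'))
    (h₁ : (MCell.cons a (MCell.cons (cid (hom f' g')) (MCell.idm S))).dom =
      Chain.cons (hom f g) (Chain.cons (unit Y) (Chain.cons (hom f' g') S)))
    (h₂ : (MCell.cons (cid (hom f g)) (MCell.cons b (MCell.idm S))).dom =
      Chain.cons (hom f g) (Chain.cons (unit Y) (Chain.cons (hom f' g') S))) :
    compC (MCell.cons a (MCell.cons (cid (hom f' g')) (MCell.idm S))) ψ h₁ (Category.id_comp m)
      (Category.id_comp n) =
    compC (MCell.cons (cid (hom f g)) (MCell.cons b (MCell.idm S))) ψ h₂ (Category.id_comp m)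
      (Category.id_comp n) := by
  have hs : (MCell.idm S).dom = S := MCell.dom_idm S
  have hX : ((MCell.idm (Chain.single (hom f g))).append (MCell.cons (unitCell Y)
      (MCell.idm (Chain.cons (hom f' g') S)))).dom =
      Chain.cons (hom f g) (Chain.cons (hom f' g') S) :=
    congrArg (fun y => Chain.cons (hom f g) (Chain.cons (hom f' g') y)) hs
  have hY : (MCell.idm (Chain.cons (hom f g) (Chain.cons (hom f' g') S))).dom =
      Chain.cons (hom f g) (Chain.cons (hom f' g') S) := MCell.dom_idm _
  -- Once the universal 2-cell is inserted between the two loose-cells, `a` and `b` both become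
  -- identities.
  apply unit_factor_ext (R := Chain.single (hom f g)) (S := Chain.cons (hom f' g') S)
    hX (Category.id_comp m) (Category.id_comp n)
  have ha' : compC (MCell.pair (cid (hom f g)) (unitCell Y)) a (P := Chain.single (hom f g)) rfl
      (Category.id_comp (𝟙 X)) (Category.id_comp (𝟙 Y)) = cid (hom f g) := by
    rw [ha]
    refine (compC_lift _ _ _ _ rfl (Category.id_comp (𝟙 X)) (Category.id_comp (𝟙 Y))
      (Category.id_comp f) (Category.id_comp g) (Category.id_comp f) (Category.id_comp g)).trans ?_
    exact (congrArg (fun y => lift y _ _) (compC_paste_unitMap (homCell f g))).trans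
      (lift_homCell f g)
  have hb' : compC (MCell.pair (unitCell Y) (cid (hom f' g'))) b
      (P := Chain.single (hom f' g')) rfl
      (Category.id_comp (𝟙 Y)) (Category.id_comp (𝟙 Z)) = cid (hom f' g') := by
    rw [hb]
    refine (compC_lift _ _ _ _ rfl (Category.id_comp (𝟙 Y)) (Category.id_comp (𝟙 Z))
      (Category.id_comp f') (Category.id_comp g') (Category.id_comp f')
      (Category.id_comp g')).trans ?_
    exact (congrArg (fun y => lift y _ _) (compC_unitMap_paste (homCell f' g'))).trans
      (lift_homCell f' g')
  have e₁ : ∀ {X Y : C} (p : Loose X Y), compC (MCell.single (cid p)) (cid p)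
      (P := Chain.single p) rfl (Category.id_comp (𝟙 X)) (Category.id_comp (𝟙 Y)) = cid p :=
    fun p => compC_cid _ _ _ _
  have k₁ := compC_cons_cons_idm (MCell.pair (cid (hom f g)) (unitCell Y)) a
    (MCell.single (cid (hom f' g'))) (cid (hom f' g')) (MCell.idm S) ψ
    (X := Chain.single (hom f g)) (X' := Chain.single (hom f' g')) rfl
    (Category.id_comp (𝟙 X)) (Category.id_comp (𝟙 Y)) rfl (Category.id_comp (𝟙 Z)) hY
    (Category.id_comp m) (Category.id_comp n) h₁ (Category.id_comp m) (Category.id_comp n)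
    ((MCell.idm (Chain.single (hom f g))).append (MCell.cons (unitCell Y)
      (MCell.idm (Chain.cons (hom f' g') S)))) HEq.rfl hX (Category.id_comp m)
  have k₂ := compC_cons_cons_idm (MCell.single (cid (hom f g))) (cid (hom f g))
    (MCell.pair (unitCell Y) (cid (hom f' g'))) b (MCell.idm S) ψ
    (X := Chain.single (hom f g)) (X' := Chain.single (hom f' g')) rfl
    (Category.id_comp (𝟙 X)) (Category.id_comp (𝟙 Y)) rfl (Category.id_comp (𝟙 Z)) hY
    (Category.id_comp m) (Category.id_comp n) h₂ (Category.id_comp m) (Category.id_comp n)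
    ((MCell.idm (Chain.single (hom f g))).append (MCell.cons (unitCell Y)
      (MCell.idm (Chain.cons (hom f' g') S)))) HEq.rfl hX (Category.id_comp m)
  refine k₁.trans (Eq.trans ?_ k₂.symm)
  exact compC_congr (congrArg₂ (fun y z => MCell.cons y (MCell.cons z (MCell.idm S)))
    (ha'.trans (e₁ _).symm) ((e₁ _).trans hb'.symm)) rfl

end RelAdjunction

/-- The universal property of the left-composite with no further loose-cells on the right, carried
along the invertible `θ` from the left-composite to E(j, c). This is all that will be used of
absoluteness. -/
theorem IsAbsolute.existsUnique {A E Z Y : C} {j : A ⟶ E} {p : Loose Z Y} {f : Z ⟶ E} {c : Y ⟶ E}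
    {l : HomCell (Chain.single p) f c} (H : IsAbsolute j p f c l) {A' B' : C} {g : A ⟶ A'}
    {h : Y ⟶ B'} {s : Loose A' B'} (ψ : Cell (Chain.cons (hom j f) (Chain.single p)) g h s) :
    ∃! χ : Cell (Chain.single (hom j c)) g h s,
      compC (MCell.single (hcomp (cid (hom j f)) l)) χ rfl (Category.id_comp g)
        (Category.id_comp h) = ψ := by
  obtain ⟨q, φ, θ, hφ, hθ, θ', h₁, h₂⟩ := H
  have hφ' : ∃! χ : Cell (Chain.single q) g h s,
      compC (MCell.single φ) χ rfl (Category.id_comp g) (Category.id_comp h) = ψ := by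
    have e : ∀ χ : Cell (Chain.single q) g h s,
        comp (MCell.single φ) χ = cast (by simp) ψ ↔
          compC (MCell.single φ) χ rfl (Category.id_comp g) (Category.id_comp h) = ψ := by
      intro χ
      constructor
      · intro k
        exact eq_of_heq ((compC_heq ..).trans ((heq_of_eq k).trans (cast_heq _ _)))
      · intro k
        exact eq_of_heq ((compC_heq ..).symm.trans ((heq_of_eq k).trans (cast_heq _ _).symm))
    obtain ⟨χ, k₁, k₂⟩ := hφ (Chain.nil Y) g h s (cast (by simp [MCell.idm]) ψ)
    exact ⟨χ, (e χ).1 k₁, fun y hy => k₂ y ((e y).2 hy)⟩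
  have a₁ : ∀ χ : Cell (Chain.single (hom j c)) g h s,
      compC (MCell.single (hcomp (cid (hom j f)) l)) χ rfl (Category.id_comp g)
        (Category.id_comp h) = compC (MCell.single φ) (compC (MCell.single θ) χ rfl
          (Category.id_comp g) (Category.id_comp h)) rfl (Category.id_comp g)
        (Category.id_comp h) := by
    intro χ
    refine (compC_congr (congrArg MCell.single hθ.symm) rfl).trans ?_
    exact compC_assoc₁ (MCell.single φ) θ χ _ _ _ _ _ _ _ _ _ _ _ _
  have a₂ : ∀ {p₁ p₂ : Loose A Y} (θ : Cell (Chain.single p₁) (𝟙 A) (𝟙 Y) p₂)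
      (θ' : Cell (Chain.single p₂) (𝟙 A) (𝟙 Y) p₁) (_ : vcomp θ θ' = cid p₁)
      (χ : Cell (Chain.single p₁) g h s), compC (MCell.single θ) (compC (MCell.single θ') χ rfl
        (Category.id_comp g) (Category.id_comp h)) rfl (Category.id_comp g)
        (Category.id_comp h) = χ := by
    intro p₁ p₂ θ θ' hθ χ
    refine (compC_assoc₁ (MCell.single θ) θ' χ rfl (Category.comp_id _) (Category.comp_id _) rfl
      (Category.id_comp g) (Category.id_comp h) _ _ _ _ _ _).symm.trans ?_
    refine (compC_congr (congrArg MCell.single hθ) rfl).trans ?_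
    exact idm_compC (P := Chain.single p₁) χ _ _ _
  obtain ⟨χ, k₁, k₂⟩ := hφ'
  refine ⟨compC (MCell.single θ') χ rfl (Category.id_comp g) (Category.id_comp h), ?_, ?_⟩
  · refine (a₁ _).trans ((compC_congr rfl (a₂ θ θ' h₁ χ)).trans k₁)
  · intro y hy
    have := k₂ _ ((a₁ y).symm.trans hy)
    exact (a₂ θ' θ h₂ y).symm.trans (compC_congr rfl this)

namespace RelAdjunction

variable {A D E : C} {j : A ⟶ E} {ℓ : A ⟶ D} {r : D ⟶ E} (adj : RelAdjunction j ℓ r)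

theorem hcomp_cid_eq_lift {D' : C} {c : D ⟶ D'} {e : D' ⟶ E}
    (l : HomCell (Chain.single (hom c (𝟙 D'))) r e) :
    hcomp (cid (hom j r)) l = lift (paste (homCell j r) (toUnit l)
      (X := Chain.cons (hom j r) (Chain.single (hom c (𝟙 D')))) rfl) (Category.id_comp j)
      (Category.id_comp e) := by
  unfold hcomp ofUnit
  rw [toUnit_cid]
  rfl

/-- The 2-cell μ is the factorization through E(j, e) of the composite that transposes E(j, r) into
D(ℓ, 1), applies c and pastes with D'(c, 1). The equation `act_paste` then holds by construction,
and `paste_η_act` by uniqueness of factorizations. -/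
theorem exists_isTransposeInverse {D' : C} {c : D ⟶ D'} {e : D' ⟶ E}
    {l : HomCell (Chain.single (hom c (𝟙 D'))) r e} (H : IsAbsolute j (hom c (𝟙 D')) r e l) :
    ∃ μ, adj.IsTransposeInverse c (toUnit l) μ := by
  have e₁ : ∀ {F : C} {f' : A ⟶ F} {g' : D' ⟶ F}
      (χ : Cell (Chain.single (hom j e)) f' g' (unit F)),
      compC (MCell.single (hcomp (cid (hom j r)) l)) χ
        (P := Chain.cons (hom j r) (Chain.single (hom c (𝟙 D')))) rfl (Category.id_comp f')
        (Category.id_comp g') = act χ (paste (homCell j r) (toUnit l) rfl) (Category.id_comp j)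
          (Category.id_comp e) (Category.id_comp f') (Category.id_comp g') := fun χ =>
    compC_congr (congrArg MCell.single (hcomp_cid_eq_lift l)) rfl
  obtain ⟨μ, hμ, -⟩ := H.existsUnique (paste (push (toUnit adj.flat) c rfl (Category.id_comp c))
    (homCell c (𝟙 D')) rfl)
  refine ⟨μ, ?_, (e₁ μ).symm.trans hμ⟩
  -- Both sides of `paste_η_act` are factorizations of E(j, r), D'(c, 1) ⇒ E(j, e) itself. For the
  -- left side, naturality of l replaces c by r, and the unit then cancels the transposition.
  refine (H.existsUnique (paste (homCell j r) (toUnit l) rfl)).unique ?_ ?_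
  · refine (e₁ _).trans ?_
    have k₁ := paste_act_left (toUnit adj.η) (act (toUnit l) μ rfl (Category.id_comp (𝟙 D')) rfl
      (Category.id_comp e)) (paste (homCell j r) (toUnit l)
      (X := Chain.cons (hom j r) (Chain.single (hom c (𝟙 D')))) rfl) (Category.id_comp e)
      (Category.id_comp e)
    refine k₁.symm.trans ?_
    rw [IsTransposeInverse.act_act_eq]
    have k₂ := (e₁ μ).symm.trans hμ
    have k₃ := act_push_paste (toUnit l) (toUnit adj.flat) (homCell c (𝟙 D')) rfl
      (Category.id_comp c) (Category.id_comp (𝟙 D')) rfl (Category.id_comp r)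
      (Category.id_comp e) (Z := Chain.cons (hom j r) (Chain.single (hom c (𝟙 D')))) rfl
    rw [act_homCell] at k₃
    have k₄ := (congrArg (fun y => act (toUnit l) y rfl (Category.comp_id (𝟙 D')) rfl
      (Category.id_comp e)) k₂).trans k₃
    refine (congrArg (fun y => paste (toUnit adj.η) y (Chain.nil_append _)) k₄).trans ?_
    refine (paste_assoc (toUnit adj.η) (push (toUnit adj.flat) r rfl (Category.id_comp r))
      (toUnit l) rfl rfl rfl rfl).symm.trans ?_
    refine congrArg (fun y => paste y (toUnit l) rfl) ?_
    have k₅ := adj.paste_η_push_toLeft (homCell j r) (Category.id_comp r)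
    rw [toLeft_homCell] at k₅
    exact k₅
  · exact (e₁ _).trans (act_eq_self _ _ _)

namespace IsTransposeInverse

variable {adj} {D' : C} {c : D ⟶ D'} {e : D' ⟶ E}
  {l : HomCell (Chain.single (hom c (𝟙 D'))) r e}
  {μ : Cell (Chain.single (hom j e)) (ℓ ≫ c) (𝟙 D') (unit D')}

/-- Precomposition with `κ` is inverted by precomposition with the sequence `η'`, `μ'`, which goes
from E(j, e) to E(j, r), D'(c, 1) with ℓ as the intermediate boundary. Thus the 2-cell `κ` into E(j,
e) has the universal property of a left-composite. -/
theorem existsUnique (H : adj.IsTransposeInverse c (toUnit l) μ) {B G K : C}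
    (S : Chain (Loose (C := C)) D' B) {m : A ⟶ G} {n : B ⟶ K} {q : Loose G K}
    (ψ : Cell (Chain.cons (hom j r) (Chain.cons (hom c (𝟙 D')) S)) m n q)
    (hd : (MCell.cons (hcomp (cid (hom j r)) l) (MCell.idm S)).dom =
      Chain.cons (hom j r) (Chain.cons (hom c (𝟙 D')) S)) :
    ∃! χ : Cell (Chain.cons (hom j e) S) m n q,
      compC (MCell.cons (hcomp (cid (hom j r)) l) (MCell.idm S)) χ hd (Category.id_comp m)
        (Category.id_comp n) = ψ := by
  have hs : (MCell.idm S).dom = S := MCell.dom_idm S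
  set κ := hcomp (cid (hom j r)) l with hκ
  have hκ' : κ = lift _ _ _ := hcomp_cid_eq_lift l
  set η' : Cell (Chain.nil A) (𝟙 A) ℓ (hom j r) :=
    lift (toUnit adj.η) (Category.id_comp j) rfl with hη'
  set μ' : Cell (Chain.single (hom j e)) ℓ (𝟙 D') (hom c (𝟙 D')) :=
    lift μ rfl (Category.id_comp (𝟙 D')) with hμ'
  have hσ : (MCell.cons η' (MCell.cons μ' (MCell.idm S))).dom = Chain.cons (hom j e) S :=
    congrArg (Chain.cons (hom j e)) hs
  have hid : (MCell.idm (Chain.cons (hom j e) S)).dom = Chain.cons (hom j e) S :=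
    MCell.dom_idm _
  have hid₂ : (MCell.idm (Chain.cons (hom j r) (Chain.cons (hom c (𝟙 D')) S))).dom =
    Chain.cons (hom j r) (Chain.cons (hom c (𝟙 D')) S) := MCell.dom_idm _
  refine ⟨compC (MCell.cons η' (MCell.cons μ' (MCell.idm S))) ψ hσ (Category.id_comp m)
    (Category.id_comp n), ?_, ?_⟩
  · set b : Cell (Chain.cons (unit D) (Chain.single (hom c (𝟙 D')))) (𝟙 D) (𝟙 D')
        (hom c (𝟙 D')) := lift (paste (unitMap c) (homCell c (𝟙 D')) rfl) (Category.id_comp c)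
        (Category.id_comp (𝟙 D')) with hb
    set a : Cell (Chain.cons (hom j r) (Chain.single (unit D))) (𝟙 A) (𝟙 D) (hom j r) :=
      lift (paste (homCell j r) (unitMap r) rfl) (Category.id_comp j) (Category.id_comp r) with ha
    set κ₂ : Cell (Chain.cons (hom j r) (Chain.single (hom c (𝟙 D')))) ℓ (𝟙 D')
        (hom c (𝟙 D')) := lift (paste (push (toUnit adj.flat) c rfl (Category.id_comp c))
          (homCell c (𝟙 D')) rfl) rfl (Category.id_comp (𝟙 D')) with hκ₂
    have e₁ : compC (MCell.single κ) μ' (P := Chain.cons (hom j r)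
        (Chain.single (hom c (𝟙 D')))) rfl (Category.id_comp ℓ) (Category.id_comp (𝟙 D')) =
        κ₂ := by
      refine (compC_lift _ _ _ _ rfl (Category.id_comp ℓ) (Category.id_comp (𝟙 D'))
        (Category.id_comp (ℓ ≫ c)) (Category.id_comp (𝟙 D')) rfl
        (Category.id_comp (𝟙 D'))).trans ?_
      refine congrArg (fun y => lift y rfl (Category.id_comp (𝟙 D'))) ?_
      refine Eq.trans ?_ H.act_paste
      exact compC_congr (congrArg MCell.single hκ') rfl
    have e₂ : compC (MCell.nil (𝟙 A)) η' rfl (Category.id_comp (𝟙 A)) (Category.id_comp ℓ) = η' :=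
      idm_compC (P := Chain.nil A) η' _ _ _
    have hZ : (MCell.cons η' (MCell.cons κ₂ (MCell.idm S))).dom =
      Chain.cons (hom j r) (Chain.cons (hom c (𝟙 D')) S) :=
      congrArg (fun y => Chain.cons (hom j r) (Chain.cons (hom c (𝟙 D')) y)) hs
    have k₁ := compC_cons_cons_idm (MCell.nil (𝟙 A)) η' (MCell.single κ) μ' (MCell.idm S) ψ
      (X := Chain.nil A) (X' := Chain.cons (hom j r) (Chain.single (hom c (𝟙 D'))))
      rfl (Category.id_comp (𝟙 A)) (Category.id_comp ℓ) rfl (Category.id_comp (𝟙 D')) hZ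
      (Category.id_comp m) (Category.id_comp n) hσ (Category.id_comp m) (Category.id_comp n)
      (MCell.cons κ (MCell.idm S)) HEq.rfl hd (Category.id_comp m)
    refine k₁.trans ((compC_congr (congrArg₂ (fun y z => MCell.cons y (MCell.cons z
      (MCell.idm S))) e₂ e₁) rfl).trans ?_)
    -- Place `flat'` between `η'` and D'(c, 1). Absorbed on the right by `b` it gives `κ₂`; absorbed
    -- on the left by `a` it gives, with `η'`, the identity of E(j, r). The equality `key`
    -- identifies the two.
    set flat' : Cell (Chain.single (hom j r)) ℓ (𝟙 D) (unit D) := toUnit adj.flat with hflat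
    have h₁ : (MCell.cons a (MCell.cons (cid (hom c (𝟙 D'))) (MCell.idm S))).dom =
        Chain.cons (hom j r) (Chain.cons (unit D) (Chain.cons (hom c (𝟙 D')) S)) :=
      congrArg (fun y => Chain.cons (hom j r) (Chain.cons (unit D)
        (Chain.cons (hom c (𝟙 D')) y))) hs
    have h₂ : (MCell.cons (cid (hom j r)) (MCell.cons b (MCell.idm S))).dom =
        Chain.cons (hom j r) (Chain.cons (unit D) (Chain.cons (hom c (𝟙 D')) S)) := h₁
    have key := interchange S ψ a ha b hb h₁ h₂
    set σ := MCell.cons η' (MCell.cons flat' (MCell.idm (Chain.cons (hom c (𝟙 D')) S))) with hσ'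
    have hσd : σ.dom = Chain.cons (hom j r) (Chain.cons (hom c (𝟙 D')) S) := hZ
    have k₂ := congrArg (fun y => compC σ y hσd (Category.id_comp m) (Category.id_comp n)) key
    have k₃ := compC_cons_cons_idm (MCell.pair η' flat') a
      (MCell.single (cid (hom c (𝟙 D')))) (cid (hom c (𝟙 D'))) (MCell.idm S) ψ
      (X := Chain.single (hom j r)) (X' := Chain.single (hom c (𝟙 D')))
      rfl (Category.id_comp (𝟙 A)) (Category.id_comp (𝟙 D)) rfl (Category.id_comp (𝟙 D')) hid₂
      (Category.id_comp m) (Category.id_comp n) h₁ (Category.id_comp m) (Category.id_comp n)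
      σ HEq.rfl hσd (Category.id_comp m)
    have k₄ := compC_cons_cons_idm (MCell.single η') (cid (hom j r))
      (MCell.pair flat' (cid (hom c (𝟙 D')))) b (MCell.idm S) ψ
      (X := Chain.nil A) (X' := Chain.cons (hom j r) (Chain.single (hom c (𝟙 D'))))
      rfl (Category.id_comp (𝟙 A)) (Category.comp_id ℓ) rfl (Category.id_comp (𝟙 D')) hZ
      (Category.id_comp m) (Category.id_comp n) h₂ (Category.id_comp m) (Category.id_comp n)
      σ HEq.rfl hσd (Category.id_comp m)
    -- Transposing E(j, r) to the left and then back along the unit gives the identity.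
    have f₁ : compC (MCell.pair η' flat') a (P := Chain.single (hom j r)) rfl
        (Category.id_comp (𝟙 A)) (Category.id_comp (𝟙 D)) = cid (hom j r) := by
      refine (compC_lift _ _ _ _ rfl (Category.id_comp (𝟙 A)) (Category.id_comp (𝟙 D))
        (Category.id_comp j) (Category.id_comp r) (Category.id_comp j)
        (Category.id_comp r)).trans ?_
      refine Eq.trans ?_ (lift_homCell j r)
      refine congrArg (fun y => lift y (Category.id_comp j) (Category.id_comp r)) ?_
      have g₁ := paste_comp (MCell.single η') (homCell j r) (MCell.single flat')
        (unitMap r) (X := Chain.nil A) (X' := Chain.single (hom j r)) rfl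
        (Category.id_comp j) rfl rfl rfl (Category.id_comp r)
        rfl rfl (MCell.pair η' flat') HEq.rfl rfl
      refine g₁.symm.trans ?_
      refine (congrArg (fun y => paste y _ rfl) (lift_comp _ _ _)).trans ?_
      have k₅ := adj.paste_η_push_toLeft (homCell j r) (Category.id_comp r)
      rw [toLeft_homCell] at k₅
      exact k₅
    have f₂ : compC (MCell.single (cid (hom c (𝟙 D')))) (cid (hom c (𝟙 D')))
        (P := Chain.single (hom c (𝟙 D'))) rfl (Category.id_comp (𝟙 D))
        (Category.id_comp (𝟙 D')) = cid (hom c (𝟙 D')) := compC_cid _ _ _ _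
    have f₃ : compC (MCell.single η') (cid (hom j r)) (P := Chain.nil A) rfl
      (Category.id_comp (𝟙 A)) (Category.comp_id ℓ) = η' := compC_cid _ _ _ _
    have f₄ : compC (MCell.pair flat' (cid (hom c (𝟙 D')))) b
        (P := Chain.cons (hom j r) (Chain.single (hom c (𝟙 D')))) rfl
        (Category.comp_id ℓ) (Category.id_comp (𝟙 D')) = κ₂ := by
      refine (compC_lift _ _ _ _ rfl (Category.comp_id ℓ) (Category.id_comp (𝟙 D'))
        rfl (Category.id_comp (𝟙 D')) rfl (Category.id_comp (𝟙 D'))).trans ?_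
      refine congrArg (fun y => lift y rfl (Category.id_comp (𝟙 D'))) ?_
      have g₁ := paste_comp (MCell.single flat') (unitMap c) (MCell.single (cid (hom c (𝟙 D'))))
        (homCell c (𝟙 D')) (X := Chain.single (hom j r)) (X' := Chain.single (hom c (𝟙 D'))) rfl
        rfl (Category.id_comp c) rfl (Category.id_comp c) (Category.id_comp (𝟙 D'))
        rfl rfl (MCell.pair flat' (cid (hom c (𝟙 D')))) HEq.rfl rfl
      refine g₁.symm.trans ?_
      exact congrArg (fun y => paste _ y rfl)
        (idm_compC (P := Chain.single (hom c (𝟙 D'))) (homCell c (𝟙 D')) _ _ _)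
    have k₃' := k₃.trans (compC_congr (congrArg₂ (fun y z => MCell.cons y (MCell.cons z
      (MCell.idm S))) f₁ f₂) rfl)
    have k₄' := k₄.trans (compC_congr (congrArg₂ (fun y z => MCell.cons y (MCell.cons z
      (MCell.idm S))) f₃ f₄) rfl)
    refine k₄'.symm.trans (k₂.symm.trans (k₃'.trans ?_))
    exact idm_compC (P := Chain.cons (hom j r) (Chain.cons (hom c (𝟙 D')) S)) ψ _ _ _
  -- For uniqueness, `κ` after the sequence `η'`, `μ'` is the identity of E(j, e) by `paste_η_act`,
  -- so `χ` is recovered from `ψ`.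
  · intro χ hχ
    refine Eq.trans ?_ (congrArg (fun y => compC (MCell.cons η' (MCell.cons μ' (MCell.idm S))) y
      hσ (Category.id_comp m) (Category.id_comp n)) hχ)
    have k₁ := compC_cons_idm (MCell.pair η' μ') κ (MCell.idm S) χ
      (X := Chain.single (hom j e)) (Y := Chain.cons (hom j e) S) rfl
      (Category.id_comp (𝟙 A)) (Category.id_comp (𝟙 D')) hid (Category.id_comp m)
      (Category.id_comp n) hd (Category.id_comp m) (Category.id_comp n) hσ (Category.id_comp m)
    refine Eq.trans ?_ k₁.symm
    have f₁ : compC (MCell.pair η' μ') κ (P := Chain.single (hom j e)) rfl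
        (Category.id_comp (𝟙 A)) (Category.id_comp (𝟙 D')) = cid (hom j e) := by
      rw [hκ']
      refine (compC_lift _ _ _ _ rfl (Category.id_comp (𝟙 A)) (Category.id_comp (𝟙 D'))
        (Category.id_comp j) (Category.id_comp e) (Category.id_comp j)
        (Category.id_comp e)).trans ?_
      refine Eq.trans ?_ (lift_homCell j e)
      refine congrArg (fun y => lift y (Category.id_comp j) (Category.id_comp e)) ?_
      have g₁ := paste_comp (MCell.single η') (homCell j r) (MCell.single μ')
        (toUnit l) (X := Chain.nil A) (X' := Chain.single (hom j e)) rfl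
        (Category.id_comp j) rfl rfl rfl (Category.id_comp e)
        rfl rfl (MCell.pair η' μ') HEq.rfl rfl
      refine g₁.symm.trans ?_
      refine (congrArg (fun y => paste y _ rfl) (lift_comp _ _ _)).trans ?_
      exact H.paste_η_act
    refine Eq.trans ?_ (compC_congr (congrArg (fun y => MCell.cons y (MCell.idm S)) f₁) rfl).symm
    exact (idm_compC (P := Chain.cons (hom j e) S) χ _ _ _).symm

/-- By `existsUnique`, E(j, e) itself may be taken as the left-composite, and the comparison is then
an identity. -/
theorem isAbsolute (H : adj.IsTransposeInverse c (toUnit l) μ) :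
    IsAbsolute j (hom c (𝟙 D')) r e l := by
  refine ⟨hom j e, hcomp (cid (hom j r)) l, cid (hom j e), ?_, compC_cid _ _ _ _,
    cid (hom j e), compC_cid _ _ _ _, compC_cid _ _ _ _⟩
  intro B G K S m n q ψ
  have hd : (MCell.cons (hcomp (cid (hom j r)) l) (MCell.idm S)).dom =
      Chain.cons (hom j r) (Chain.cons (hom c (𝟙 D')) S) :=
    congrArg (fun y => Chain.cons (hom j r) (Chain.cons (hom c (𝟙 D')) y)) (MCell.dom_idm S)
  have ht : Cell (MCell.cons (hcomp (cid (hom j r)) l) (MCell.idm S)).dom (𝟙 A ≫ m) (𝟙 B ≫ n) q =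
      Cell (Chain.cons (hom j r) (Chain.cons (hom c (𝟙 D')) S)) m n q := by
    rw [hd, Category.id_comp, Category.id_comp]
  obtain ⟨χ, k₁, k₂⟩ := H.existsUnique S (cast ht ψ) hd
  have e : ∀ χ : Cell (Chain.cons (hom j e) S) m n q,
      comp (MCell.cons (hcomp (cid (hom j r)) l) (MCell.idm S)) χ = ψ ↔
      compC (MCell.cons (hcomp (cid (hom j r)) l) (MCell.idm S)) χ hd (Category.id_comp m)
        (Category.id_comp n) = cast ht ψ := by
    intro χ
    constructor
    · intro k
      exact eq_of_heq ((compC_heq ..).trans ((heq_of_eq k).trans (cast_heq _ _).symm))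
    · intro k
      exact eq_of_heq ((compC_heq ..).symm.trans ((heq_of_eq k).trans (cast_heq _ _)))
  exact ⟨χ, (e χ).2 k₁, fun y hy => k₂ y ((e y).1 hy)⟩

/-- Density is applied at r and at e. Pasting with l and then with the generic 2-cell of E(j, r)
equals pasting with the generic 2-cell of E(j, e) and then precomposing with E(j, r), D'(c, 1) ⇒
E(j, e). The second composite is bijective by density at e and `existsUnique`; cancelling the
bijection given by density at r leaves pasting with l. -/
theorem isColimitCell (H : adj.IsTransposeInverse c (toUnit l) μ) (hj : IsDense j) :
    IsColimitCell (toUnit l) := by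
  intro B Q g
  have hd : (MCell.cons (hcomp (cid (hom j r)) l) (MCell.idm Q)).dom =
      Chain.cons (hom j r) (Chain.cons (hom c (𝟙 D')) Q) :=
    congrArg (fun y => Chain.cons (hom j r) (Chain.cons (hom c (𝟙 D')) y)) (MCell.dom_idm Q)
  have hK : Function.Bijective (fun χ : Cell (Chain.cons (hom j e) Q) j g (unit E) =>
      compC (MCell.cons (hcomp (cid (hom j r)) l) (MCell.idm Q)) χ hd (Category.id_comp j)
        (Category.id_comp g)) :=
    (Function.bijective_iff_existsUnique _).2 fun ψ => H.existsUnique Q ψ hd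
  refine (Function.Bijective.of_comp_iff' (hj.bijective r (Chain.cons (hom c (𝟙 D')) Q) g) _).1 ?_
  have e' := (hK.comp (hj.bijective e Q g))
  convert e' using 1
  funext ψ
  have h₁ := paste_comp (MCell.single (hcomp (cid (hom j r)) l)) (homCell j e) (MCell.idm Q) ψ
    (X := Chain.cons (hom j r) (Chain.single (hom c (𝟙 D')))) rfl (Category.id_comp j)
    (Category.id_comp e) (MCell.dom_idm Q) (Category.id_comp e) (Category.id_comp g) rfl rfl
    (MCell.cons (hcomp (cid (hom j r)) l) (MCell.idm Q)) HEq.rfl hd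
  refine Eq.trans ?_ h₁
  have h₂ : compC (MCell.single (hcomp (cid (hom j r)) l)) (homCell j e)
      (P := Chain.cons (hom j r) (Chain.single (hom c (𝟙 D')))) rfl (Category.id_comp j)
      (Category.id_comp e) = paste (homCell j r) (toUnit l) rfl :=
    (compC_congr (congrArg MCell.single (hcomp_cid_eq_lift l)) rfl).trans (lift_comp _ _ _)
  refine Eq.trans ?_ (congrArg₂ (fun y z => paste y z rfl) h₂ (idm_compC ψ _ _ _)).symm
  exact (paste_assoc _ _ _ rfl rfl rfl rfl).symm

end IsTransposeInverse

end RelAdjunction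

/-! ### Graded morphisms in terms of 2-cells into loose-identities -/

/-- Compatibility of a 2-cell with two extension operators `E(j, m) ⇒ E(t, m)` and
`E(j, n) ⇒ E(t, n)`. -/
def IsGradedCell {A B D E : C} {j t : A ⟶ E} {m : B ⟶ E} {n : D ⟶ E}
    {P : Chain (Loose (C := C)) B D} (a : Cell (Chain.single (hom j m)) t m (unit E))
    (b : Cell (Chain.single (hom j n)) t n (unit E)) (ε : Cell P m n (unit E)) : Prop :=
  paste a ε (X := Chain.cons (hom j m) P) rfl = act b (paste (homCell j m) ε rfl)
    (Category.id_comp j) (Category.id_comp n) (Category.id_comp t) (Category.id_comp n)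

theorem isGradedMorphism_iff {A D D' E : C} {j : A ⟶ E} {T : RelMonad j} (a : Algebra T D)
    (a' : Algebra T D') {P : Chain (Loose (C := C)) D D'} (ε : HomCell P a.carrier a'.carrier) :
    IsGradedMorphism a a' ε ↔ IsGradedCell (toUnit a.ext) (toUnit a'.ext) (toUnit ε) := by
  have h₁ : toUnit (hcomp a.ext ε) = paste (toUnit a.ext) (toUnit ε) rfl := toUnit_hcomp _ _
  have h₂ : toUnit (vcomp (hcomp (cid (hom j a.carrier)) ε) a'.ext) =
      act (toUnit a'.ext) (paste (homCell j a.carrier) (toUnit ε) rfl) (Category.id_comp j)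
        (Category.id_comp _) (Category.id_comp _) (Category.id_comp _) := by
    rw [toUnit_vcomp_eq_act, toUnit_hcomp, toUnit_cid]
  constructor
  · intro H
    exact h₁.symm.trans ((congrArg toUnit H).trans h₂)
  · intro H
    exact toUnit_injective (h₁.trans (H.trans h₂.symm))

/-- The condition is imposed only at the generic 2-cell of E(j, m). This form evaluates it at an
arbitrary `φ` and after precomposing `ε`, which is how it is exploited below. -/
theorem IsGradedCell.compC {A B D E : C} {j t : A ⟶ E} {m : B ⟶ E} {n : D ⟶ E}
    {P : Chain (Loose (C := C)) B D} {a : Cell (Chain.single (hom j m)) t m (unit E)}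
    {b : Cell (Chain.single (hom j n)) t n (unit E)} {ε : Cell P m n (unit E)}
    (H : IsGradedCell a b ε) {B₀ D₀ : C} {P₀ : Chain (Loose (C := C)) A B₀} {k : B₀ ⟶ B}
    {k' : D₀ ⟶ D} {m₀ : B₀ ⟶ E} {n₀ : D₀ ⟶ E} (φ : Cell P₀ j m₀ (unit E)) (hm : k ≫ m = m₀)
    (M : MCell k k' P) {P₁ : Chain (Loose (C := C)) B₀ D₀} (hd : M.dom = P₁)
    (hn : k' ≫ n = n₀) :
    paste (act a φ (Category.id_comp j) hm (Category.id_comp t) hm) (compC M ε hd hm hn) rfl =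
      act b (paste φ (FormalCat.compC M ε hd hm hn) rfl) (Category.id_comp j) hn
        (Category.id_comp t) hn := by
  have hX : (MCell.cons (lift φ (Category.id_comp j) hm) M).dom = P₀.append P₁ :=
    congrArg (Chain.append P₀) hd
  have h₁ := paste_act a φ (Category.id_comp j) hm (Category.id_comp t) hm M ε hd hn rfl hX
  have h₂ := paste_act (homCell j m) φ (Category.id_comp j) hm (Category.id_comp j) hm M ε hd hn
    rfl hX
  rw [act_eq_self] at h₂
  refine h₁.trans ((congrArg (fun y => FormalCat.compC _ y hX (Category.id_comp t) hn) H).trans ?_)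
  refine (compC_act _ b _ (Category.id_comp j) (Category.id_comp n) (Category.id_comp t)
    (Category.id_comp n) hX (Category.id_comp (𝟙 A)) (Category.comp_id k') (Category.id_comp j) hn
    (Category.id_comp t) hn (Category.id_comp j) hn (Category.id_comp t) hn).trans ?_
  exact congrArg (fun y => act b y (Category.id_comp j) hn (Category.id_comp t) hn) h₂.symm

/-! ### Algebras and algebra objects through 2-cells into loose-identities -/

namespace Algebra

variable {A D E N : C} {j : A ⟶ E} {T : RelMonad j}

/-- The algebra with a given carrier and extension operator, the latter being given as a 2-cell
into a loose-identity. -/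
noncomputable def ofCell (e : D ⟶ E) (a : Cell (Chain.single (hom j e)) T.carrier e (unit E))
    (hη : paste (toUnit T.η) a rfl = homCell j e)
    (ha : paste (X := Chain.cons (hom j T.carrier) (Chain.single (hom j e))) (toUnit T.ext) a rfl =
      act a (paste (homCell j T.carrier) a rfl)
      (Category.id_comp j) (Category.id_comp e) (Category.id_comp T.carrier)
      (Category.id_comp e)) : Algebra T D where
  carrier := e
  ext := ofUnit a
  η_ext := by
    apply toUnit_injective
    refine (toUnit_hcomp _ _).trans ?_
    rw [toUnit_ofUnit]
    exact hη.trans (toUnit_cid _ _).symm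
  assoc := by
    apply toUnit_injective
    refine (toUnit_hcomp _ _).trans ?_
    rw [toUnit_ofUnit, toUnit_vcomp_eq_act, toUnit_hcomp, toUnit_cid, toUnit_ofUnit]
    exact ha

theorem assoc_cell (a : Algebra T D) :
    paste (X := Chain.cons (hom j T.carrier) (Chain.single (hom j a.carrier)))
      (toUnit T.ext) (toUnit a.ext) rfl =
      act (toUnit a.ext) (paste (homCell j T.carrier) (toUnit a.ext) rfl)
      (Category.id_comp j) (Category.id_comp _) (Category.id_comp T.carrier)
      (Category.id_comp _) := by
  have h := congrArg toUnit a.assoc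
  rw [toUnit_vcomp_eq_act, toUnit_hcomp, toUnit_hcomp, toUnit_cid] at h
  exact h

theorem η_cell (a : Algebra T D) :
    paste (toUnit T.η) (toUnit a.ext) rfl = homCell j a.carrier :=
  (toUnit_hcomp _ _).symm.trans ((congrArg toUnit a.η_ext).trans (toUnit_cid _ _))

/-- The extension operator of the restriction of an algebra along a tight-cell, as a 2-cell into
a loose-identity. -/
noncomputable def extCell (M : Algebra T N) {B : C} (d : B ⟶ N) {m : B ⟶ E}
    (hm : d ≫ M.carrier = m) : Cell (Chain.single (hom j m)) T.carrier m (unit E) :=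
  act (toUnit M.ext) (homCell j m) (Category.id_comp j) hm (Category.id_comp T.carrier) hm

theorem toUnit_restrict_ext (M : Algebra T N) {B : C} (d : B ⟶ N) :
    toUnit (M.restrict d).ext = M.extCell d rfl := toUnit_ofUnit _

theorem extCell_id (M : Algebra T N) : M.extCell (𝟙 N) (Category.id_comp _) = toUnit M.ext :=
  act_homCell _

theorem act_extCell (M : Algebra T N) {B B' : C} (d : B ⟶ N) {m : B ⟶ E}
    (hm : d ≫ M.carrier = m) {P : Chain (Loose (C := C)) A B'} {k : B' ⟶ B} {d' : B' ⟶ N}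
    {m' : B' ⟶ E} (φ : Cell P j m' (unit E)) (hk : k ≫ m = m') (hd : k ≫ d = d')
    (hm' : d' ≫ M.carrier = m') :
    act (M.extCell d hm) φ (Category.id_comp j) hk (Category.id_comp T.carrier) hk =
      act (toUnit M.ext) φ (Category.id_comp j) hm' (Category.id_comp T.carrier) hm' := by
  have h := act_act (toUnit M.ext) (homCell j m) φ (Category.id_comp j) hk (Category.id_comp j) hk
    (Category.id_comp j) hm (Category.id_comp T.carrier) hm (Category.id_comp (𝟙 A)) hd
    (Category.id_comp j) hm' (Category.id_comp T.carrier) hm' (Category.id_comp T.carrier) hk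
  rw [act_eq_self] at h
  exact h.symm

/-- The types of the extension operators depend on the carriers. Restricting along the identity,
with a free choice of the resulting carrier, records the equality of operators without a cast. -/
theorem exists_extCell_eq {a b : Algebra T D} (h : a = b) :
    ∃ hc : 𝟙 D ≫ a.carrier = b.carrier, a.extCell (𝟙 D) hc = toUnit b.ext := by
  subst h
  exact ⟨Category.id_comp _, act_homCell _⟩

theorem exists_extCell_of_restrict_eq {M : Algebra T N} {d : D ⟶ N} {b : Algebra T D}
    (h : M.restrict d = b) : ∃ hd : d ≫ M.carrier = b.carrier, M.extCell d hd = toUnit b.ext := by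
  obtain ⟨hc, h'⟩ := exists_extCell_eq h
  have hd : d ≫ M.carrier = b.carrier := (Category.id_comp _).symm.trans hc
  refine ⟨hd, Eq.trans ?_ h'⟩
  have h₁ := M.act_extCell d rfl (homCell j b.carrier) hc (Category.id_comp d) hd
  rw [← toUnit_restrict_ext] at h₁
  exact h₁.symm

/-- This is naturality of the extension operator in its right boundary, `act_paste_push`. -/
theorem isGradedCell_push (M : Algebra T N) {B B' : C} {d : B ⟶ N} {d' : B' ⟶ N} {m : B ⟶ E}
    {m' : B' ⟶ E} (hm : d ≫ M.carrier = m) (hm' : d' ≫ M.carrier = m')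
    {P : Chain (Loose (C := C)) B B'} (τ : Cell P d d' (unit N)) :
    IsGradedCell (M.extCell d hm) (M.extCell d' hm') (push τ M.carrier hm hm') := by
  refine Eq.trans ?_ (M.act_extCell d' hm' (k := 𝟙 B') (m' := m') _ (Category.id_comp m')
    (Category.id_comp d') hm').symm
  exact (act_paste_push (toUnit M.ext) (homCell j m) τ (Category.id_comp j) hm hm'
    (Category.id_comp T.carrier) hm hm' rfl).symm

theorem existsUnique_push {M : Algebra T N} (hM : IsAlgebraObject M) {B B' : C} {d : B ⟶ N}
    {d' : B' ⟶ N} {m : B ⟶ E} {m' : B' ⟶ E} (hm : d ≫ M.carrier = m) (hm' : d' ≫ M.carrier = m')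
    {P : Chain (Loose (C := C)) B B'} (ε : Cell P m m' (unit E))
    (H : IsGradedCell (M.extCell d hm) (M.extCell d' hm') ε) :
    ∃! τ : Cell P d d' (unit N), push τ M.carrier hm hm' = ε := by
  subst hm hm'
  have h₁ : IsGradedMorphism (M.restrict d) (M.restrict d') (P := P) (ofUnit ε) := by
    rw [isGradedMorphism_iff, toUnit_restrict_ext, toUnit_restrict_ext]
    exact (congrArg (IsGradedCell _ _) (toUnit_ofUnit ε)).mpr H
  obtain ⟨τ, k₁, k₂⟩ := hM.existsUnique_cell d d' P (ofUnit ε) h₁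
  refine ⟨toUnit τ, ?_, fun y hy => ?_⟩
  · exact (toUnit_ofUnit _).symm.trans ((congrArg toUnit k₁).trans (toUnit_ofUnit ε))
  · have h := k₂ (ofUnit y) ((congrArg (fun z => ofUnit (push z M.carrier rfl rfl))
      (toUnit_ofUnit y)).trans (congrArg ofUnit hy))
    exact (toUnit_ofUnit y).symm.trans (congrArg toUnit h)

theorem push_injective {M : Algebra T N} (hM : IsAlgebraObject M) {B B' : C} {d : B ⟶ N}
    {d' : B' ⟶ N} {m : B ⟶ E} {m' : B' ⟶ E} (hm : d ≫ M.carrier = m) (hm' : d' ≫ M.carrier = m')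
    {P : Chain (Loose (C := C)) B B'} {τ τ' : Cell P d d' (unit N)}
    (h : push τ M.carrier hm hm' = push τ' M.carrier hm hm') : τ = τ' :=
  (existsUnique_push hM hm hm' _ (M.isGradedCell_push hm hm' τ')).unique h rfl

end Algebra

/-! ### The algebra structure carried by an absolute extension of a relative right adjoint -/

namespace RelAdjunction

variable {A B D E : C} {j : A ⟶ E} {ℓ : A ⟶ D} {r : D ⟶ E} {adj : RelAdjunction j ℓ r}

theorem toUnit_bind {k : B ⟶ D} {m : B ⟶ E} (hm : k ≫ r = m) :
    toUnit (adj.bind hm) = push (adj.toLeft (homCell j m) hm) r rfl hm := toUnit_ofUnit _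

theorem toUnit_algebra_ext :
    toUnit adj.algebra.ext = push (toUnit adj.flat) r rfl (Category.id_comp r) := by
  refine (toUnit_bind (adj := adj) (Category.id_comp r)).trans ?_
  rw [toLeft_homCell]

theorem act_algebra_ext {P : Chain (Loose (C := C)) A B} {k : B ⟶ D} {m : B ⟶ E}
    (φ : Cell P j m (unit E)) (hm : k ≫ r = m) :
    act (toUnit adj.algebra.ext) φ (Category.id_comp j) hm (Category.id_comp (ℓ ≫ r)) hm =
      push (adj.toLeft φ hm) r rfl hm := by
  refine (congrArg (fun y => act y φ (Category.id_comp j) hm (Category.id_comp (ℓ ≫ r)) hm)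
    (toUnit_algebra_ext (adj := adj))).trans ?_
  exact (push_act (toUnit adj.flat) φ _ _ _ _ r _ _ _ _ _ _).symm

theorem act_algebra_ext_η :
    act (toUnit adj.algebra.ext) (toUnit adj.η) (Category.id_comp j) rfl
      (Category.id_comp (ℓ ≫ r)) rfl = idUnit (ℓ ≫ r) := by
  refine (act_algebra_ext (toUnit adj.η) rfl).trans ?_
  rw [toLeft_η, push_idUnit]

namespace IsTransposeInverse

variable {D' : C} {c : D ⟶ D'} {e : D' ⟶ E}
  {l : Cell (Chain.single (hom c (𝟙 D'))) r e (unit E)}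
  {μ : Cell (Chain.single (hom j e)) (ℓ ≫ c) (𝟙 D') (unit D')}

/-- The extension operator induced on an absolute extension of a relative right adjoint. -/
noncomputable def extCell (_ : adj.IsTransposeInverse c l μ) :
    Cell (Chain.single (hom j e)) (ℓ ≫ r) e (unit E) :=
  act l μ rfl (Category.id_comp (𝟙 D')) rfl (Category.id_comp e)

/-- By `act_paste`, applying μ to E(j, r), D'(c, 1) amounts to transposing E(j, r) and applying c.
Naturality of l in its left boundary replaces c by r, and transposition followed by r is the
extension operator of r. -/
theorem isGradedCell (H : adj.IsTransposeInverse c l μ) :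
    IsGradedCell (toUnit adj.algebra.ext) H.extCell l := by
  refine Eq.trans ?_ (IsTransposeInverse.act_act_eq (paste (homCell j r) l rfl)
    (Category.id_comp e)).symm
  refine Eq.trans ?_ (congrArg (fun y => act l y rfl (Category.comp_id _) rfl
    (Category.id_comp e)) H.act_paste).symm
  refine Eq.trans ?_ (act_push_paste l (toUnit adj.flat) (homCell c (𝟙 D')) rfl
      (Category.id_comp c) (Category.id_comp (𝟙 D')) rfl (Category.id_comp r)
      (Category.id_comp e) rfl).symm
  rw [act_homCell]
  exact congrArg (fun y => paste y l rfl) toUnit_algebra_ext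

theorem assoc (H : adj.IsTransposeInverse c l μ) :
    paste (X := Chain.cons (hom j (ℓ ≫ r)) (Chain.single (hom j e))) (toUnit adj.monad.ext)
      H.extCell rfl = act H.extCell (paste (homCell j (ℓ ≫ r)) H.extCell rfl)
      (Category.id_comp j) (Category.id_comp e) (Category.id_comp (ℓ ≫ r))
      (Category.id_comp e) := by
  refine Eq.trans ?_ (IsTransposeInverse.act_act_eq (paste (homCell j (ℓ ≫ r)) H.extCell rfl)
    (Category.id_comp e)).symm
  have h := H.act_paste_act (homCell j (ℓ ≫ r)) μ rfl rfl (Category.id_comp e)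
  refine Eq.trans ?_ (congrArg (fun y => act l y rfl (Category.comp_id _) rfl
    (Category.id_comp e)) h).symm
  refine Eq.trans ?_ (act_push_paste l (adj.toLeft (homCell j (ℓ ≫ r)) rfl) μ rfl
      rfl (Category.id_comp (𝟙 D')) rfl rfl (Category.id_comp e) rfl).symm
  exact congrArg (fun y => paste y H.extCell rfl) (toUnit_bind (adj := adj) rfl)

/-- Evaluate the compatibility of l at the unit of the adjunction and at μ. The operator of r sends
the unit to an identity, which leaves `H.extCell` on one side. On the other, the unit pasted with l
after μ is generic by `paste_η_act`, which leaves `b`. -/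
theorem eq_extCell (H : adj.IsTransposeInverse c l μ)
    {b : Cell (Chain.single (hom j e)) (ℓ ≫ r) e (unit E)}
    (hb : IsGradedCell (toUnit adj.algebra.ext) b l) : b = H.extCell := by
  have h := hb.compC (toUnit adj.η) (k := ℓ) rfl (MCell.single (lift μ rfl
    (Category.id_comp (𝟙 D')))) (P₁ := Chain.single (hom j e)) rfl (Category.id_comp e)
  have h₁ := (congrArg (fun y => paste y H.extCell rfl)
    (act_algebra_ext_η (adj := adj))).symm.trans h
  have h₂ := h₁.trans (congrArg (fun y => act b y (Category.id_comp j) (Category.id_comp e)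
    (Category.id_comp (ℓ ≫ r)) (Category.id_comp e)) H.paste_η_act)
  exact (h₂.trans (act_homCell b)).symm.trans (idUnit_paste _ rfl)

/-- The same evaluation at the unit and μ as in `eq_extCell`, with `ψ` carried along on the right.
-/
theorem isGradedCell_of_paste (H : adj.IsTransposeInverse c l μ) {B : C}
    {Q : Chain (Loose (C := C)) D' B} {n : B ⟶ E} {ψ : Cell Q e n (unit E)}
    {b : Cell (Chain.single (hom j n)) (ℓ ≫ r) n (unit E)}
    (h : IsGradedCell (toUnit adj.algebra.ext) b (paste l ψ (X := Chain.cons _ Q) rfl)) :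
    IsGradedCell H.extCell b ψ := by
  set μ' : Cell (Chain.single (hom j e)) ℓ (𝟙 D') (hom c (𝟙 D')) :=
    lift μ rfl (Category.id_comp (𝟙 D'))
  have hd : (MCell.cons μ' (MCell.idm Q)).dom = Chain.cons (hom j e) Q :=
    congrArg (Chain.cons (hom j e)) (MCell.dom_idm Q)
  have k := h.compC (toUnit adj.η) (k := ℓ) rfl (MCell.cons μ' (MCell.idm Q)) hd
    (Category.id_comp n)
  have k₁ : compC (MCell.cons μ' (MCell.idm Q)) (paste l ψ rfl) hd rfl (Category.id_comp n) =
      paste H.extCell ψ rfl := by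
    refine (paste_comp (MCell.single μ') l (MCell.idm Q) ψ (X := Chain.single (hom j e)) rfl rfl
      (Category.id_comp e) (MCell.dom_idm Q) (Category.id_comp e) (Category.id_comp n) rfl rfl
      (MCell.cons μ' (MCell.idm Q)) HEq.rfl hd).symm.trans ?_
    exact congrArg (fun y => paste H.extCell y rfl) (idm_compC ψ _ _ _)
  have k₂ := (congrArg₂ (fun y z => paste y z rfl) (act_algebra_ext_η (adj := adj))
    k₁).symm.trans (k.trans (congrArg (fun y => act b (paste (toUnit adj.η) y rfl)
      (Category.id_comp j) (Category.id_comp n) (Category.id_comp (ℓ ≫ r))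
      (Category.id_comp n)) k₁))
  refine (idUnit_paste (paste H.extCell ψ (X := Chain.cons _ Q) rfl) rfl).symm.trans
    (k₂.trans ?_)
  refine congrArg (fun y => act b y (Category.id_comp j) (Category.id_comp n)
    (Category.id_comp (ℓ ≫ r)) (Category.id_comp n)) ?_
  refine (paste_assoc _ _ _ rfl rfl rfl rfl).symm.trans ?_
  exact congrArg (fun y => paste y ψ rfl) H.paste_η_act

end IsTransposeInverse

end RelAdjunction

/-! ### Invertible 2-cells between tight-cells -/

/-- Mutually inverse 2-cells between parallel tight-cells. -/
structure IsInversePair {A E : C} {a b : A ⟶ E} (θ : Cell (Chain.nil A) a b (unit E))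
    (θ' : Cell (Chain.nil A) b a (unit E)) : Prop where
  paste_inv : paste θ θ' rfl = idUnit a
  inv_paste : paste θ' θ rfl = idUnit b

namespace IsInversePair

variable {A E : C} {a b : A ⟶ E} {θ : Cell (Chain.nil A) a b (unit E)}
  {θ' : Cell (Chain.nil A) b a (unit E)}

theorem symm (H : IsInversePair θ θ') : IsInversePair θ' θ := ⟨H.2, H.1⟩

theorem precomp (H : IsInversePair θ θ') {B : C} (k : B ⟶ A) {a' b' : B ⟶ E} (ha : k ≫ a = a')
    (hb : k ≫ b = b') : IsInversePair (res θ k ha hb) (res θ' k hb ha) where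
  paste_inv := (res_paste θ θ' k ha hb ha).symm.trans
    ((congrArg (fun y => res y k ha ha) H.1).trans (res_idUnit a k ha))
  inv_paste := (res_paste θ' θ k hb ha hb).symm.trans
    ((congrArg (fun y => res y k hb hb) H.2).trans (res_idUnit b k hb))

theorem postcomp (H : IsInversePair θ θ') {F : C} (k : E ⟶ F) {a' b' : A ⟶ F} (ha : a ≫ k = a')
    (hb : b ≫ k = b') : IsInversePair (push θ k ha hb) (push θ' k hb ha) where
  paste_inv := (push_paste θ θ' rfl k ha hb ha).symm.trans
    ((congrArg (fun y => push y k ha ha) H.1).trans (push_idUnit a k ha))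
  inv_paste := (push_paste θ' θ rfl k hb ha hb).symm.trans
    ((congrArg (fun y => push y k hb hb) H.2).trans (push_idUnit b k hb))

theorem cancel_left (H : IsInversePair θ θ') {B : C} {P : Chain (Loose (C := C)) A B} {g : B ⟶ E}
    (φ : Cell P b g (unit E)) : paste θ' (paste θ φ (Chain.nil_append P)) (Chain.nil_append P) =
      φ :=
  (paste_assoc θ' θ φ rfl (Chain.nil_append P) (Chain.nil_append P)
    (Chain.nil_append P)).symm.trans ((congrArg (fun y => paste y φ (Chain.nil_append P))
      H.2).trans (idUnit_paste φ _))

end IsInversePair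

theorem IsInversePair.cancel_right {A B E : C} {a b : B ⟶ E}
    {θ : Cell (Chain.nil B) a b (unit E)} {θ' : Cell (Chain.nil B) b a (unit E)}
    (H : IsInversePair θ θ') {P : Chain (Loose (C := C)) A B} {g : A ⟶ E}
    (φ : Cell P g a (unit E)) : paste (paste φ θ (Chain.append_nil P)) θ' (Chain.append_nil P) =
      φ :=
  (paste_assoc φ θ θ' (Chain.append_nil P) rfl (Chain.append_nil P)
    (Chain.append_nil P)).trans ((congrArg (fun y => paste φ y (Chain.append_nil P))
      H.1).trans (paste_idUnit φ _))

/-- The components at `g` of an invertible 2-cell from the identity make a tight-cell faithful. -/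
theorem IsInversePair.push_injective {D N : C} {K : D ⟶ N} {G : N ⟶ D}
    {θ : Cell (Chain.nil D) (𝟙 D) (K ≫ G) (unit D)} {θ' : Cell (Chain.nil D) (K ≫ G) (𝟙 D) (unit D)}
    (H : IsInversePair θ θ') {A B : C} {P : Chain (Loose (C := C)) A B} {f : A ⟶ D} {g : B ⟶ D}
    {f' : A ⟶ N} {g' : B ⟶ N} (hf : f ≫ K = f') (hg : g ≫ K = g') {φ φ' : Cell P f g (unit D)}
    (h : push φ K hf hg = push φ' K hf hg) : φ = φ' := by
  subst hf hg
  have key : ∀ φ : Cell P f g (unit D), paste φ (res θ g (Category.comp_id g) rfl)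
      (Chain.append_nil P) = paste (res θ f (Category.comp_id f) rfl)
        (push (push φ K rfl rfl) G (Category.assoc f K G) (Category.assoc g K G))
        (Chain.nil_append P) := by
    intro φ
    have h₁ := paste_res θ φ (Category.comp_id f) rfl (Category.comp_id g) rfl
      (Chain.append_nil P)
    rw [push_id] at h₁
    refine h₁.trans (congrArg (fun y => paste _ y (Chain.nil_append P)) ?_)
    exact (push_push φ K G rfl _ _ _ _ _ _).symm
  have h₂ := (key φ).trans ((congrArg (fun y => paste (res θ f (Category.comp_id f) rfl)
    (push y G (Category.assoc f K G) (Category.assoc g K G)) (Chain.nil_append P)) h).trans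
      (key φ').symm)
  have H' := H.precomp g (Category.comp_id g) rfl
  exact (H'.cancel_right φ).symm.trans ((congrArg (fun y => paste y _ (Chain.append_nil P))
    h₂).trans (H'.cancel_right φ'))

/-- A preimage of `ω` is its image under `G` conjugated by `θ`. No triangle law between `θ` and `ε`
is needed: the equality in `N` is checked after the faithful `G`. -/
theorem IsInversePair.push_surjective {D N : C} {K : D ⟶ N} {G : N ⟶ D}
    {θ : Cell (Chain.nil D) (𝟙 D) (K ≫ G) (unit D)} {θ' : Cell (Chain.nil D) (K ≫ G) (𝟙 D) (unit D)}
    (H : IsInversePair θ θ') {ε : Cell (Chain.nil N) (𝟙 N) (G ≫ K) (unit N)}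
    {ε' : Cell (Chain.nil N) (G ≫ K) (𝟙 N) (unit N)} (H' : IsInversePair ε ε')
    {A B : C} {P : Chain (Loose (C := C)) A B} {f : A ⟶ D} {g : B ⟶ D}
    {f' : A ⟶ N} {g' : B ⟶ N} (hf : f ≫ K = f') (hg : g ≫ K = g') (ω : Cell P f' g' (unit N)) :
    ∃ φ : Cell P f g (unit D), push φ K hf hg = ω := by
  subst hf hg
  set θf := res θ f (Category.comp_id f) rfl
  set θg := res θ g (Category.comp_id g) rfl
  set ω' := push ω G (Category.assoc f K G) (Category.assoc g K G)
  have Hf := H.precomp f (Category.comp_id f) rfl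
  have Hg := H.precomp g (Category.comp_id g) rfl
  set φ : Cell P f g (unit D) := paste (paste θf ω' (Chain.nil_append P))
    (res θ' g rfl (Category.comp_id g)) (Chain.append_nil P) with hφ
  refine ⟨φ, ?_⟩
  -- The invertible `ε` makes `G` faithful; after applying `G`, naturality of `θ` at `φ` and
  -- cancellation of `θ` on both sides give the equality.
  refine H'.push_injective (Category.assoc f K G) (Category.assoc g K G) ?_
  have h₁ := paste_res θ φ (Category.comp_id f) rfl (Category.comp_id g) rfl
    (Chain.append_nil P)
  rw [push_id, hφ] at h₁
  have h₂ := (Hg.symm.cancel_right (paste θf ω' (Chain.nil_append P))).symm.trans h₁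
  have h₃ := (Hf.cancel_left ω').symm.trans
    ((congrArg (fun y => paste _ y (Chain.nil_append P)) h₂).trans (Hf.cancel_left _))
  exact (push_push φ K G rfl _ _ _ _ _ _).trans h₃.symm

/-! ### Colimits and invertible 2-cells -/

namespace IsColimitCell

variable {Z Y W : C} {p : Loose Z Y} {f : Z ⟶ W} {c c' : Y ⟶ W}
  {l : Cell (Chain.single p) f c (unit W)} {l' : Cell (Chain.single p) f c' (unit W)}

theorem paste_inverse (H : IsColimitCell l) {θ : Cell (Chain.nil Y) c c' (unit W)}
    {θ' : Cell (Chain.nil Y) c' c (unit W)} (hθ : IsInversePair θ θ') :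
    IsColimitCell (paste l θ (X := Chain.single p) rfl) := by
  intro B Q g
  have hb : Function.Bijective (fun ψ : Cell Q c' g (unit W) => (paste θ ψ rfl :
      Cell Q c g (unit W))) :=
    Function.bijective_iff_has_inverse.2 ⟨fun ψ => paste θ' ψ rfl, fun ψ => hθ.cancel_left ψ,
      fun ψ => hθ.symm.cancel_left ψ⟩
  convert (H Q g).comp hb using 1
  funext ψ
  exact paste_assoc l θ ψ rfl rfl rfl rfl

theorem eq_idUnit (H : IsColimitCell l) {θ : Cell (Chain.nil Y) c c (unit W)}
    (h : paste l θ (X := Chain.single p) rfl = l) : θ = idUnit c :=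
  (H (Chain.nil Y) c).1 (h.trans (paste_idUnit l rfl).symm)

/-- Used to invert a given comparison 2-cell: both composites fix a colimit cocone, so they are
identities. -/
theorem exists_inverse (H : IsColimitCell l) (H' : IsColimitCell l')
    {θ : Cell (Chain.nil Y) c c' (unit W)} (h : paste l θ (X := Chain.single p) rfl = l') :
    ∃ θ' : Cell (Chain.nil Y) c' c (unit W), IsInversePair θ θ' ∧
      paste l' θ' (X := Chain.single p) rfl = l := by
  obtain ⟨θ', h'⟩ := (H' (Chain.nil Y) c).2 l
  refine ⟨θ', ⟨H.eq_idUnit ?_, H'.eq_idUnit ?_⟩, h'⟩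
  · refine (paste_assoc l θ θ' rfl rfl rfl rfl).symm.trans ?_
    exact (congrArg (fun y => paste y θ' rfl) h).trans h'
  · refine (paste_assoc l' θ' θ rfl rfl rfl rfl).symm.trans ?_
    exact (congrArg (fun y => paste y θ rfl) h').trans h

theorem exists_inversePair (H : IsColimitCell l) (H' : IsColimitCell l') :
    ∃ (θ : Cell (Chain.nil Y) c c' (unit W)) (θ' : Cell (Chain.nil Y) c' c (unit W)),
      IsInversePair θ θ' ∧ paste l θ (X := Chain.single p) rfl = l' ∧
      paste l' θ' (X := Chain.single p) rfl = l := by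
  obtain ⟨θ, h⟩ := (H (Chain.nil Y) c').2 l'
  obtain ⟨θ', h₁, h₂⟩ := H.exists_inverse H' h
  exact ⟨θ, θ', h₁, h, h₂⟩

/-- Fully faithful tight-cells reflect colimits. -/
theorem of_push {N : C} (K : W ⟶ N)
    (hK : ∀ {A B : C} (P : Chain (Loose (C := C)) A B) (f : A ⟶ W) (g : B ⟶ W),
      Function.Bijective (fun φ : Cell P f g (unit W) => push φ K (f' := f ≫ K) (g' := g ≫ K)
        rfl rfl)) {f₁ : Z ⟶ N} {c₁ : Y ⟶ N} (hf : f ≫ K = f₁) (hc : c ≫ K = c₁)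
    (H : IsColimitCell (push l K hf hc)) : IsColimitCell l := by
  subst hf hc
  intro B Q g
  refine (Function.Bijective.of_comp_iff' (hK (Chain.cons p Q) f g) _).1 ?_
  convert (H Q (g ≫ K)).comp (hK Q c g) using 1
  funext ψ
  exact push_paste l ψ rfl K rfl rfl rfl

end IsColimitCell

namespace RelAdjunction

variable {A D E N D' : C} {j : A ⟶ E} {ℓ : A ⟶ D} {r : D ⟶ E} {adj : RelAdjunction j ℓ r}

theorem IsTransposeInverse.paste_inverse {c : D ⟶ D'} {e e' : D' ⟶ E}
    {l : Cell (Chain.single (hom c (𝟙 D'))) r e (unit E)}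
    {μ : Cell (Chain.single (hom j e)) (ℓ ≫ c) (𝟙 D') (unit D')}
    (H : adj.IsTransposeInverse c l μ) {θ : Cell (Chain.nil D') e e' (unit E)}
    {θ' : Cell (Chain.nil D') e' e (unit E)} (hθ : IsInversePair θ θ') :
    ∃ μ', adj.IsTransposeInverse c
      (paste l θ (X := Chain.single (hom c (𝟙 D'))) rfl) μ' := by
  -- The new inverse is E(j, e') ⇒ E(j, e), given by θ', followed by μ.
  set φ : Cell (Chain.single (hom j e')) j e (unit E) := paste (homCell j e') θ' rfl with hφ
  set μ' := act μ φ (Category.id_comp j) (Category.id_comp e) (Category.id_comp (ℓ ≫ c))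
    (Category.id_comp (𝟙 D')) with hμ'
  refine ⟨μ', ?_, ?_⟩
  · have h₁ := paste_act_res l μ' rfl (Category.id_comp (𝟙 D')) rfl (Category.id_comp e)
      (Category.id_comp e') θ rfl
    rw [res_id] at h₁
    refine (congrArg (fun y => paste (toUnit adj.η) y rfl) h₁).symm.trans ?_
    refine (paste_assoc _ _ _ rfl rfl rfl rfl).symm.trans ?_
    refine (congrArg (fun y => paste y θ rfl) (H.paste_η_act_act φ (Category.id_comp e))).trans ?_
    exact hθ.symm.cancel_right (homCell j e')
  · set X : Cell (Chain.cons (hom j r) (Chain.single (hom c (𝟙 D')))) j e' (unit E) :=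
      paste (homCell j r) (paste l θ (X := Chain.single (hom c (𝟙 D'))) rfl) rfl with hX
    have h₁ := act_act μ φ X (Category.id_comp j) (Category.id_comp e') (Category.id_comp j)
      (Category.id_comp e) (Category.id_comp j) (Category.id_comp e) (Category.id_comp (ℓ ≫ c))
      (Category.id_comp (𝟙 D')) (Category.id_comp (𝟙 A)) (Category.id_comp (𝟙 D'))
      (Category.id_comp j) (Category.id_comp e) (Category.id_comp (ℓ ≫ c))
      (Category.id_comp (𝟙 D')) (Category.id_comp (ℓ ≫ c)) (Category.id_comp (𝟙 D'))
    refine h₁.symm.trans ?_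
    have h₂ := paste_act_res (homCell j e') X (Category.id_comp j) (Category.id_comp e')
      (Category.id_comp j) (Category.id_comp e') (Category.id_comp e) θ' rfl
    rw [res_id, act_eq_self] at h₂
    have h₃ : paste X θ' (X := Chain.cons (hom j r) (Chain.single (hom c (𝟙 D')))) rfl =
        paste (homCell j r) l rfl := by
      refine (paste_assoc _ _ _ rfl rfl rfl rfl).trans ?_
      exact congrArg (fun y => paste (homCell j r) y rfl) (hθ.cancel_right l)
    exact (congrArg (fun y => act μ y _ _ _ _) (h₂.symm.trans h₃)).trans H.act_paste

/-! ### Absolute extensions and algebra objects -/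

section AlgebraObject

variable {M : Algebra adj.monad N} {K : D ⟶ N} {hKr : K ≫ M.carrier = r}
  {c : D ⟶ D'} {e : D' ⟶ E} {l : Cell (Chain.single (hom c (𝟙 D'))) r e (unit E)}
  {μ : Cell (Chain.single (hom j e)) (ℓ ≫ c) (𝟙 D') (unit D')}

/-- The image of `τ` under the algebra object is a graded morphism, and `eq_extCell` allows only one
structure on e for which l is one. -/
theorem IsTransposeInverse.extCell_eq (H : adj.IsTransposeInverse c l μ)
    (hK : M.extCell K hKr = toUnit adj.algebra.ext) {d : D' ⟶ N} (hd : d ≫ M.carrier = e)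
    (τ : Cell (Chain.single (hom c (𝟙 D'))) K d (unit N)) (hτ : push τ M.carrier hKr hd = l) :
    M.extCell d hd = H.extCell := by
  refine H.eq_extCell ?_
  have h := M.isGradedCell_push hKr hd τ
  rw [hτ, hK] at h
  exact h

/-- The structure `H.extCell` makes e an algebra, which the algebra object classifies by `d`; as l
is a graded morphism for it, l lifts to `τ`. -/
theorem IsTransposeInverse.exists_push (H : adj.IsTransposeInverse c l μ)
    (hM : IsAlgebraObject M) (hK : M.extCell K hKr = toUnit adj.algebra.ext) :
    ∃ (d : D' ⟶ N) (hd : d ≫ M.carrier = e)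
      (τ : Cell (Chain.single (hom c (𝟙 D'))) K d (unit N)), push τ M.carrier hKr hd = l := by
  obtain ⟨d, hd, -⟩ := hM.existsUnique_tight
    (Algebra.ofCell (T := adj.monad) e H.extCell H.paste_η_act H.assoc)
  obtain ⟨hd', h⟩ := Algebra.exists_extCell_of_restrict_eq hd
  have h' : M.extCell d hd' = H.extCell := h.trans (toUnit_ofUnit _)
  obtain ⟨τ, hτ, -⟩ := Algebra.existsUnique_push hM hKr hd' l (by
    rw [hK]
    exact (congrArg (fun y => IsGradedCell _ y l) h').mpr H.isGradedCell)
  exact ⟨d, hd', τ, hτ⟩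

/-- Given `ω` in `N`, its image in `E` factors through l as some `ψ₀`. Pasting with l detects
gradedness, so `ψ₀` is graded and lifts to `N`. Uniqueness holds because the algebra object is
faithful on 2-cells. -/
theorem IsTransposeInverse.isColimitCell_of_push (H : adj.IsTransposeInverse c l μ)
    (hM : IsAlgebraObject M) (hK : M.extCell K hKr = toUnit adj.algebra.ext)
    (hl : IsColimitCell l) {d : D' ⟶ N} (hd : d ≫ M.carrier = e)
    (τ : Cell (Chain.single (hom c (𝟙 D'))) K d (unit N)) (hτ : push τ M.carrier hKr hd = l) :
    IsColimitCell τ := by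
  intro B Q g
  have hp : ∀ ψ : Cell Q d g (unit N), push (paste τ ψ (X := Chain.cons _ Q) rfl) M.carrier
      hKr (g' := g ≫ M.carrier) rfl = paste l (push ψ M.carrier hd rfl) rfl := fun ψ =>
    (push_paste τ ψ rfl M.carrier hKr hd rfl).trans (congrArg (fun y => paste y _ rfl) hτ)
  constructor
  · intro ψ ψ' h
    refine Algebra.push_injective hM hd rfl ?_
    exact (hl Q _).1 ((hp ψ).symm.trans ((congrArg (fun y => push y M.carrier hKr rfl) h).trans
      (hp ψ')))
  · intro ω
    obtain ⟨ψ₀, hψ₀⟩ := (hl Q (g ≫ M.carrier)).2 (push ω M.carrier hKr rfl)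
    have h₁ := M.isGradedCell_push hKr (rfl : g ≫ M.carrier = _) ω
    rw [hK, ← hψ₀] at h₁
    have h₂ := H.isGradedCell_of_paste h₁
    rw [← H.extCell_eq hK hd τ hτ] at h₂
    obtain ⟨ψ, hψ, -⟩ := Algebra.existsUnique_push hM hd rfl ψ₀ h₂
    refine ⟨ψ, Algebra.push_injective hM hKr rfl ?_⟩
    exact (hp ψ).trans ((congrArg (fun y => paste l y rfl) hψ).trans hψ₀)

end AlgebraObject

theorem exists_extCell_comparison {M : Algebra adj.monad N} (hM : IsAlgebraObject M) :
    ∃ h : adj.comparison hM ≫ M.carrier = r,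
      M.extCell (adj.comparison hM) h = toUnit adj.algebra.ext :=
  Algebra.exists_extCell_of_restrict_eq (hM.existsUnique_tight adj.algebra).choose_spec.1

end RelAdjunction

/-! ### Equivalences -/

theorem toUnit_hid {A E : C} (f : A ⟶ E) : toUnit (hid f) = idUnit f := toUnit_ofUnit _

/-- The orientation of the counit is reversed, so that both pairs start at an identity and the full
faithfulness lemmas for invertible 2-cells apply to both tight-cells. -/
theorem isEquivalenceCell_iff {A B : C} (c : A ⟶ B) : IsEquivalenceCell c ↔
    ∃ (d : B ⟶ A) (η : Cell (Chain.nil A) (𝟙 A) (c ≫ d) (unit A))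
      (η' : Cell (Chain.nil A) (c ≫ d) (𝟙 A) (unit A))
      (ε : Cell (Chain.nil B) (𝟙 B) (d ≫ c) (unit B))
      (ε' : Cell (Chain.nil B) (d ≫ c) (𝟙 B) (unit B)),
      IsInversePair η η' ∧ IsInversePair ε ε' := by
  have key : ∀ {A E : C} {a b : A ⟶ E} (θ : HomCell (Chain.nil A) a b)
      (θ' : HomCell (Chain.nil A) b a), hcomp θ θ' = hid a ↔
        paste (toUnit θ) (toUnit θ') (X := Chain.nil A) rfl = idUnit a := by
    intro A E a b θ θ'
    constructor
    · intro h
      exact (toUnit_hcomp θ θ').symm.trans ((congrArg toUnit h).trans (toUnit_hid a))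
    · intro h
      exact toUnit_injective ((toUnit_hcomp θ θ').trans (h.trans (toUnit_hid a).symm))
  constructor
  · rintro ⟨d, η, η', ε, ε', h₁, h₂, h₃, h₄⟩
    exact ⟨d, toUnit η, toUnit η', toUnit ε', toUnit ε, ⟨(key _ _).1 h₁, (key _ _).1 h₂⟩,
      ⟨(key _ _).1 h₄, (key _ _).1 h₃⟩⟩
  · rintro ⟨d, η, η', ε, ε', h₁, h₂⟩
    refine ⟨d, ofUnit η, ofUnit η', ofUnit ε', ofUnit ε, ?_, ?_, ?_, ?_⟩ <;>
      rw [key, toUnit_ofUnit, toUnit_ofUnit]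
    exacts [h₁.1, h₁.2, h₂.2, h₂.1]

theorem toUnit_whisker {A B E F : C} {P : Chain (Loose (C := C)) A B} {f : A ⟶ E} {g : B ⟶ E}
    (φ : HomCell P f g) (k : E ⟶ F) : toUnit (whisker φ k) = push (toUnit φ) k rfl rfl :=
  toUnit_ofUnit _

/-! ### Relative monadicity -/

/-- Replaces the composite of the identity with r by r. Both composites are generalized to variables
in the proof so that the difference disappears by substitution. -/
theorem isColimit_whisker_iff {Y D E : C} {p : Loose D Y} {c : Y ⟶ D} (r : D ⟶ E)
    (l : HomCell (Chain.single p) (𝟙 D) c) {c' : Y ⟶ E} (hc : c ≫ r = c') :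
    IsColimit p (𝟙 D ≫ r) (c ≫ r) (whisker l r) ↔
      IsColimitCell (push (toUnit l) r (Category.id_comp r) hc) := by
  have key : ∀ {f' : D ⟶ E} (hf : 𝟙 D ≫ r = f') {c' : Y ⟶ E} (hc : c ≫ r = c'),
      IsColimit p (𝟙 D ≫ r) (c ≫ r) (whisker l r) ↔
        IsColimitCell (push (toUnit l) r hf hc) := by
    intro f' hf c' hc
    subst hf hc
    rw [isColimit_iff, toUnit_whisker]
  exact key _ _

namespace RelAdjunction

variable {A D E N : C} {j : A ⟶ E} {ℓ : A ⟶ D} {r : D ⟶ E} {adj : RelAdjunction j ℓ r}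

/-- The absolute extension lifts to a colimit `τ` in `N`, and the equivalence K carries it back to a
colimit `l₁` in `D` whose image under r is isomorphic to the given one. Preservation follows by
comparison with `l₁`, reflection by lifting to `N` once more. -/
theorem nonStrictlyCreates_of_isEquivalenceCell {M : Algebra adj.monad N}
    (hM : IsAlgebraObject M) (hE : IsEquivalenceCell (adj.comparison hM)) :
    NonStrictlyCreatesAbsoluteExtensions j r := by
  intro D' c e l₀ hl₀ habs
  obtain ⟨hKr, hK⟩ := exists_extCell_comparison hM
  set K := adj.comparison hM
  obtain ⟨G, η, η', ε, ε', hη, hε⟩ := (isEquivalenceCell_iff K).1 hE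
  have hff : ∀ {A B : C} (P : Chain (Loose (C := C)) A B) (f : A ⟶ D) (g : B ⟶ D),
      Function.Bijective (fun φ : Cell P f g (unit D) => push φ K (f' := f ≫ K) (g' := g ≫ K)
        rfl rfl) := fun P f g =>
    ⟨fun φ φ' h => hη.push_injective rfl rfl h, fun ω => hη.push_surjective hε rfl rfl ω⟩
  have hl := (isColimit_iff l₀).1 hl₀
  obtain ⟨μ, H⟩ := adj.exists_isTransposeInverse habs
  set l := toUnit l₀
  obtain ⟨d, hd, τ, hτ⟩ := H.exists_push hM hK
  have hτ' := H.isColimitCell_of_push hM hK hl hd τ hτ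
  have hpr : ∀ {w : D' ⟶ D} (φ : Cell (Chain.single (hom c (𝟙 D'))) (𝟙 D) w (unit D))
      (hw : (w ≫ K) ≫ M.carrier = w ≫ r),
      push (push φ K (Category.id_comp K) rfl) M.carrier hKr hw =
        push φ r (Category.id_comp r) rfl := fun φ hw => push_push φ K M.carrier hKr _ _ _ _ _ _
  have hi := hε.precomp d (Category.comp_id d) (Category.assoc d G K).symm
  set i := res ε d (Category.comp_id d) (Category.assoc d G K).symm
  -- K need not hit `d` exactly, so `τ` is first transported along the invertible `i` from `d` to
  -- the image under K of `d ≫ G`.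
  obtain ⟨l₁, hl₁⟩ := hη.push_surjective hε (f := 𝟙 D) (g := d ≫ G) (Category.id_comp K) rfl
    (paste τ i (X := Chain.single (hom c (𝟙 D'))) rfl)
  have hw : ∀ w : D' ⟶ D, (w ≫ K) ≫ M.carrier = w ≫ r := fun w => by rw [Category.assoc, hKr]
  have c₁ : IsColimitCell l₁ := by
    refine IsColimitCell.of_push K hff (Category.id_comp K) rfl ?_
    rw [hl₁]
    exact hτ'.paste_inverse hi
  have c₂ : IsColimitCell (push l₁ r (Category.id_comp r) rfl) := by
    rw [← hpr l₁ (hw _), hl₁]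
    have h₁ := push_paste τ i (X := Chain.single (hom c (𝟙 D'))) rfl M.carrier hKr hd (hw (d ≫ G))
    rw [hτ] at h₁
    rw [h₁]
    exact hl.paste_inverse (hi.postcomp M.carrier hd (hw (d ≫ G)))
  refine ⟨fun w l' => ?_, d ≫ G, ofUnit l₁, ?_⟩
  · rw [isColimit_whisker_iff r l' rfl, isColimit_iff]
    constructor
    · intro h
      -- The image of `l'` is a colimit, hence isomorphic to `l`, hence also has a transpose
      -- inverse. Its lift to `N`, the image of `l'` under K, is therefore a colimit, and K reflects
      -- it.
      obtain ⟨θ, θ', hθ, h₁, -⟩ := hl.exists_inversePair h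
      obtain ⟨μ', H'⟩ := H.paste_inverse hθ
      rw [h₁] at H'
      refine IsColimitCell.of_push K hff (Category.id_comp K) rfl ?_
      exact H'.isColimitCell_of_push hM hK h (hw w) _ (hpr _ (hw w))
    · intro h
      obtain ⟨θ, θ', hθ, h₁, -⟩ := c₁.exists_inversePair h
      rw [← h₁]
      have h₂ := push_paste l₁ θ (X := Chain.single (hom c (𝟙 D'))) rfl r (Category.id_comp r)
        rfl rfl
      rw [h₂]
      exact c₂.paste_inverse (hθ.postcomp r rfl rfl)
  · rw [isColimit_iff, toUnit_ofUnit]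
    exact c₁

/-! ### From creation of absolute extensions to an equivalence -/

theorem act_push_homCell {D' F : C} (c : D ⟶ D') (u : D' ⟶ F) {f : D ⟶ F} (hf : c ≫ u = f)
    {A B : C} {P : Chain (Loose (C := C)) A B} {h : A ⟶ D} {k : B ⟶ D'} {m : A ⟶ D'}
    {m' : A ⟶ F} {n' : B ⟶ F} (φ : Cell P m k (unit D')) (hm : h ≫ c = m) (hm' : h ≫ f = m')
    (hn' : k ≫ u = n') (hmn : m ≫ u = m') :
    act (push (homCell c (𝟙 D')) u hf (Category.id_comp u)) φ hm (Category.comp_id k) hm' hn' =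
      push φ u hmn hn' := by
  refine (push_act (homCell c (𝟙 D')) φ hm (Category.comp_id k) hm (Category.comp_id k) u hmn hn'
    hf (Category.id_comp u) hm' hn').symm.trans ?_
  rw [act_eq_self]

/-- Along the identity, r is its own extension and the transpose is the adjunction isomorphism D(ℓ,
1) ≅ E(j, r), with inverse `adj.flat`. Creation of this extension will show that a 2-cell out of the
identity of D is invertible as soon as its image under r is. -/
theorem isTransposeInverse_id (adj : RelAdjunction j ℓ r) : adj.IsTransposeInverse (𝟙 D)
    (push (homCell (𝟙 D) (𝟙 D)) r (Category.id_comp r) (Category.id_comp r))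
    (push (toUnit adj.flat) (𝟙 D) rfl (Category.id_comp (𝟙 D))) where
  paste_η_act := by
    have h₁ := act_push_homCell (𝟙 D) r (Category.id_comp r)
      (push (toUnit adj.flat) (𝟙 D) rfl (Category.id_comp (𝟙 D))) rfl rfl (Category.id_comp r)
      (by rw [Category.comp_id])
    have h₂ := push_push (toUnit adj.flat) (𝟙 D) r (Category.id_comp r) (f' := ℓ ≫ 𝟙 D)
      (f'' := ℓ ≫ r) rfl
      (Category.id_comp (𝟙 D)) (by rw [Category.comp_id]) (Category.id_comp r) rfl
      (Category.id_comp r)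
    refine (congrArg (fun y => paste (toUnit adj.η) y rfl) (h₁.trans h₂)).trans ?_
    rw [← toLeft_homCell]
    exact adj.paste_η_push_toLeft (homCell j r) (Category.id_comp r)
  act_paste := by
    refine (act_paste_push _ (homCell j r) (homCell (𝟙 D) (𝟙 D)) (Category.id_comp j)
      (Category.id_comp r) (Category.id_comp r) (Category.id_comp (ℓ ≫ 𝟙 D))
      (Category.id_comp (𝟙 D)) (Category.id_comp (𝟙 D)) rfl).trans ?_
    rw [act_homCell, push_id]

/-- The right adjoint of an algebra object is an absolute extension along the comparison. -/
theorem exists_isTransposeInverse_comparison {M : Algebra adj.monad N} (hM : IsAlgebraObject M)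
    {K : D ⟶ N} (hKr : K ≫ M.carrier = r) (hK : M.extCell K hKr = toUnit adj.algebra.ext) :
    ∃ μ, adj.IsTransposeInverse K
      (push (homCell K (𝟙 N)) M.carrier hKr (Category.id_comp M.carrier)) μ := by
  have hm : (ℓ ≫ K) ≫ M.carrier = ℓ ≫ r := by rw [Category.assoc, hKr]
  have h₁ : M.extCell (ℓ ≫ K) hm = toUnit adj.monad.ext := by
    have k := M.act_extCell K hKr (homCell j (ℓ ≫ r)) (k := ℓ) rfl rfl hm
    refine k.symm.trans ?_
    refine (congrArg (fun y => act y (homCell j (ℓ ≫ r)) (Category.id_comp j) rfl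
      (Category.id_comp (ℓ ≫ r)) rfl) hK).trans ?_
    exact (act_algebra_ext (homCell j (ℓ ≫ r)) rfl).trans (toUnit_bind (adj := adj) rfl).symm
  -- By `h₁`, restricting M along ℓ;K gives the structure of the monad on its own carrier.
  -- Associativity of M then says that its extension operator is an E(j, u)-graded morphism, so it
  -- lifts to `N`.
  obtain ⟨μ, hμ, -⟩ := Algebra.existsUnique_push hM (d := ℓ ≫ K) (d' := 𝟙 N) hm
    (Category.id_comp M.carrier) (toUnit M.ext) (by
      rw [M.extCell_id]
      exact (congrArg (fun y => IsGradedCell y (toUnit M.ext) (toUnit M.ext)) h₁).mpr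
        M.assoc_cell)
  refine ⟨μ, ?_, ?_⟩
  · have k := act_push_homCell K M.carrier hKr μ rfl rfl (Category.id_comp M.carrier) hm
    refine (congrArg (fun y => paste (toUnit adj.η) y rfl) (k.trans hμ)).trans ?_
    exact M.η_cell
  -- The equation in `N` is checked in `E`, where the image of μ is the extension operator of M and
  -- the claim becomes its naturality.
  · refine Algebra.push_injective hM hm (Category.id_comp M.carrier) ?_
    refine (push_act μ _ (Category.id_comp j) (Category.id_comp M.carrier)
      (Category.id_comp (ℓ ≫ K)) (Category.id_comp (𝟙 N)) M.carrier hm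
      (Category.id_comp M.carrier) hm (Category.id_comp M.carrier) (Category.id_comp (ℓ ≫ r))
      (Category.id_comp M.carrier)).trans ?_
    refine (congrArg (fun y => act y _ (Category.id_comp j) (Category.id_comp M.carrier)
      (Category.id_comp (ℓ ≫ r)) (Category.id_comp M.carrier)) hμ).trans ?_
    refine (act_paste_push (toUnit M.ext) (homCell j r) (homCell K (𝟙 N)) (Category.id_comp j)
      hKr (Category.id_comp M.carrier) (Category.id_comp (ℓ ≫ r)) hKr
      (Category.id_comp M.carrier) rfl).trans ?_
    refine Eq.trans ?_ (push_paste _ (homCell K (𝟙 N)) rfl M.carrier hm hKr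
      (Category.id_comp M.carrier)).symm
    refine congrArg (fun y => paste y _ rfl) ?_
    exact hK.trans (toUnit_algebra_ext.trans (push_push (toUnit adj.flat) K M.carrier hKr rfl
      (Category.id_comp K) hm hKr rfl (Category.id_comp r)).symm)

/-- The pseudo-inverse of the comparison K is the extension `w` of the identity of `D` along K,
obtained by creation from the fact that the algebra object is the absolute extension of r along K.
-/
theorem isEquivalenceCell_of_nonStrictlyCreates (hj : IsDense j)
    (hr : NonStrictlyCreatesAbsoluteExtensions j r) {M : Algebra adj.monad N}
    (hM : IsAlgebraObject M) : IsEquivalenceCell (adj.comparison hM) := by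
  obtain ⟨hKr, hK⟩ := exists_extCell_comparison hM
  set K := adj.comparison hM
  -- A transpose inverse supplies both hypotheses of creation: absoluteness always, and the colimit
  -- property by density.
  have creates : ∀ {D' : C} {c : D ⟶ D'} {e : D' ⟶ E}
      {l : Cell (Chain.single (hom c (𝟙 D'))) r e (unit E)} {μ}
      (_ : adj.IsTransposeInverse c l μ),
      IsColimitCell l ∧ NonStrictlyCreates (hom c (𝟙 D')) (𝟙 D) r := by
    intro D' c e l μ H
    have H' : adj.IsTransposeInverse c (toUnit (ofUnit l)) μ := by
      rw [toUnit_ofUnit]; exact H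
    have h := H'.isColimitCell hj
    refine ⟨?_, hr c e (ofUnit l) ((isColimit_iff _).2 h) H'.isAbsolute⟩
    rw [toUnit_ofUnit] at h
    exact h
  obtain ⟨μ, H⟩ := exists_isTransposeInverse_comparison hM hKr hK
  set u := M.carrier
  set l := push (homCell K (𝟙 N)) u hKr (Category.id_comp u)
  obtain ⟨hl, hiff, w, l₁', hl₁'⟩ := creates H
  -- Since r preserves the created colimit, u and w;r are both extensions of r along K, and `i` is
  -- the resulting isomorphism.
  have hl₂ := (isColimit_whisker_iff r l₁' rfl).1 ((hiff w l₁').2 hl₁')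
  set l₁ := toUnit l₁'
  set l₂ := push l₁ r (Category.id_comp r) rfl
  obtain ⟨i, i', hi, hli, hli'⟩ := hl.exists_inversePair hl₂
  have hw : (w ≫ K) ≫ u = w ≫ r := by rw [Category.assoc, hKr]
  have hpr : push (push l₁ K (Category.id_comp K) rfl) u hKr hw = l₂ :=
    push_push l₁ K u hKr _ _ _ _ _ _
  -- the isomorphism `i : u ≅ w ≫ r` lifts to an isomorphism `1 ≅ w ≫ K`
  have g₁ : IsGradedCell (M.extCell (𝟙 N) (Category.id_comp u)) (M.extCell (w ≫ K) hw) i := by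
    rw [H.extCell_eq hK (Category.id_comp u) (homCell K (𝟙 N)) rfl]
    refine H.isGradedCell_of_paste ?_
    have h := M.isGradedCell_push hKr hw (push l₁ K (Category.id_comp K) rfl)
    rw [hK, hpr, ← hli] at h
    exact h
  have g₂ : IsGradedCell (M.extCell (w ≫ K) hw) (M.extCell (𝟙 N) (Category.id_comp u)) i' := by
    obtain ⟨μ₂, H₂⟩ := H.paste_inverse hi
    rw [hli] at H₂
    rw [H₂.extCell_eq hK hw _ hpr]
    refine H₂.isGradedCell_of_paste ?_
    have h := M.isGradedCell_push hKr (Category.id_comp u) (homCell K (𝟙 N))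
    rw [hK] at h
    exact (congrArg (IsGradedCell _ _) hli').mpr h
  obtain ⟨ε, hε, -⟩ := Algebra.existsUnique_push hM _ _ i g₁
  obtain ⟨ε', hε', -⟩ := Algebra.existsUnique_push hM _ _ i' g₂
  have pε : IsInversePair ε ε' := by
    constructor
    · refine Algebra.push_injective hM (Category.id_comp u) (Category.id_comp u) ?_
      refine (push_paste ε ε' rfl u (Category.id_comp u) hw (Category.id_comp u)).trans ?_
      refine (congrArg₂ (fun y z => paste y z rfl) hε hε').trans ?_
      exact hi.1.trans (push_idUnit (𝟙 N) u (Category.id_comp u)).symm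
    · refine Algebra.push_injective hM hw hw ?_
      refine (push_paste ε' ε rfl u hw (Category.id_comp u) hw).trans ?_
      refine (congrArg₂ (fun y z => paste y z rfl) hε' hε).trans ?_
      exact hi.2.trans (push_idUnit (w ≫ K) u hw).symm
  -- the unit `1 ⇒ K ≫ w` is sent by `r` to an invertible 2-cell
  set θ : Cell (Chain.nil D) (𝟙 D) (K ≫ w) (unit D) := act l₁ (idUnit K) (Category.id_comp K)
    (Category.comp_id K) (Category.id_comp (𝟙 D)) rfl with hθ
  have hKw : K ≫ w ≫ r = (K ≫ w) ≫ r := (Category.assoc K w r).symm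
  -- As `l₂` is `l` pasted with `i`, evaluating it at the identity of K gives the value of `l`
  -- there, which is an identity, followed by `i` restricted along K.
  have hθr : push θ r (Category.id_comp r) rfl = res i K hKr hKw := by
    refine (push_act l₁ (idUnit K) _ _ _ _ r (Category.id_comp r) rfl (Category.id_comp r) rfl
      (Category.id_comp r) hKw).trans ?_
    refine (congrArg (fun y => act y (idUnit K) (Category.id_comp K) (Category.comp_id K)
      (Category.id_comp r) hKw) hli).symm.trans ?_
    refine (paste_act_res l (idUnit K) (Category.id_comp K) (Category.comp_id K)
      (Category.id_comp r) hKr hKw i rfl).symm.trans ?_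
    have h := act_push_homCell K u hKr (idUnit K) (Category.id_comp K) (Category.id_comp r) hKr
      hKr
    refine (congrArg (fun y => paste y _ rfl) (h.trans (push_idUnit K u hKr))).trans ?_
    exact idUnit_paste _ rfl
  -- Creation of the extension of r along the identity of `D` shows that `homCell (𝟙 D) (𝟙 D)` and
  -- its pasting with `θ` are both colimits, their images under r being so. Hence `θ` compares two
  -- colimit cocones and is invertible.
  obtain ⟨d₁, d₂, -⟩ := creates adj.isTransposeInverse_id
  have k₁ : IsColimitCell (homCell (𝟙 D) (𝟙 D)) := by
    have h := (d₂ (𝟙 D) (cid (hom (𝟙 D) (𝟙 D)))).1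
      ((isColimit_whisker_iff r _ (Category.id_comp r)).2 (by rw [toUnit_cid]; exact d₁))
    rw [isColimit_iff, toUnit_cid] at h
    exact h
  set l₃ : Cell (Chain.single (hom (𝟙 D) (𝟙 D))) (𝟙 D) (K ≫ w) (unit D) :=
    paste (homCell (𝟙 D) (𝟙 D)) θ rfl with hl₃
  have k₂ : IsColimitCell l₃ := by
    have h := (d₂ (K ≫ w) (ofUnit l₃)).1 ((isColimit_whisker_iff r _ rfl).2 (by
      rw [toUnit_ofUnit]
      have e := push_paste (homCell (𝟙 D) (𝟙 D)) θ
        (X := Chain.single (hom (𝟙 D) (𝟙 D))) rfl r (Category.id_comp r) (Category.id_comp r) rfl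
      rw [hl₃, e, hθr]
      exact d₁.paste_inverse (hi.precomp K hKr hKw)))
    rw [isColimit_iff, toUnit_ofUnit] at h
    exact h
  obtain ⟨θ', pθ, -⟩ := k₁.exists_inverse k₂ rfl
  exact (isEquivalenceCell_iff K).2 ⟨w, θ, θ', ε, ε', pθ, pε⟩

end RelAdjunction

end FormalCat

theorem mainTheorem7 {C : Type u} [CategoryTheory.Category.{v} C]
    [FormalCat.VirtualEquipment.{w, x} C] {A D E : C} (j : A ⟶ E) (hj : FormalCat.IsDense j)
    (r : D ⟶ E) :
    FormalCat.IsNonStrictlyMonadic j r ↔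
      (∃ (ℓ : A ⟶ D) (adj : FormalCat.RelAdjunction j ℓ r),
        ∃ (N : C) (M : FormalCat.Algebra adj.monad N), FormalCat.IsAlgebraObject M) ∧
      FormalCat.NonStrictlyCreatesAbsoluteExtensions j r := by
  constructor
  · rintro ⟨ℓ, adj, N, M, hM, hE⟩
    exact ⟨⟨ℓ, adj, N, M, hM⟩,
      FormalCat.RelAdjunction.nonStrictlyCreates_of_isEquivalenceCell hM hE⟩
  · rintro ⟨⟨ℓ, adj, N, M, hM⟩, hr⟩
    exact ⟨ℓ, adj, N, M, hM,
      FormalCat.RelAdjunction.isEquivalenceCell_of_nonStrictlyCreates hj hr hM⟩
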